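/- All graphs are finite and simple; $d(u)$ denotes the degree of a vertex $u$. For a graph $G$ of order $n$ let $\delta$ be its minimum degree and let $$\pi_2(G)=\min\{d(u)d(v)\mid u,v\in V(G),\ u\neq v,\ uv\notin E(G)\},$$ with $\pi_2(G)=+\infty$ if $G$ is complete. A graph is $2$-connected if it has at least $3$ vertices and is connected, and remains connected after the deletion of any one vertex. A $2$-proper partition of $G$ is a partition of $V(G)$ every part of which induces a $2$-connected subgraph of $G$. Let $\alpha^*(G)$ be the maximum size of an independent set $I$ of $G$ with $\sum_{u\in I}d(u)\le n-1$. Define the following graphs. - $F_5$ has vertices $a,b_1,\dots,b_4$ and edges $ab_1,ab_2,ab_3,ab_4,b_1b_2,b_3b_4$. - $\mathcal F_{11}$ is the family of graphs with vertices $a,b_1,b_2,c_1,\dots,c_8$ and edge set $\{ac_i\mid 1\le i\le 8\}\cup\{b_1c_i\mid 1\le i\le 4\}\cup\{b_2c_i\mid 5\le i\le 8\}\cup\{c_1c_2,c_3c_4,c_5c_6,c_7c_8\}\cup L$, where $L\subseteq\{ab_1,ab_2\}$. - $\mathcal F_{12}$ is the family of graphs with vertices $a,b_1,b_2,c_1,\dots,c_9$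 and edge set $\{ac_i\mid 1\le i\le 8\}\cup\{b_1c_i\mid 1\le i\le 4\}\cup\{b_2c_i\mid 5\le i\le 8\}\cup\{c_1c_2,c_3c_4,c_5c_6,c_7c_9,c_8c_9\}\cup L$, where $L\subseteq\{ab_1,ab_2,ac_9,b_2c_9\}$ and $L\cap\{ac_9,b_2c_9\}\ne\emptyset$. - For $s\ge 2$, $H_{s,s}$ is obtained from two vertex-disjoint complete graphs $S_1,S_2$ of order $s-1$ by adding four new vertices $a,b,c_1,c_2$ and the edges $\{ax,bx\mid x\in V(S_1)\cup V(S_2)\}\cup\{ab,ac_1,ac_2,c_1c_2\}$, and $H_{s,s}^-=H_{s,s}-ab$. Put $\mathcal H_n^{=}=\{H_{s,s},H_{s,s}^-\mid s\ge 2,\ 2s+2=n\}$ (empty if there is no such $s$). **Corollary.** Let $G$ be a graph of order $n\ge 2$ with minimum degree $\delta$ such that $\pi_2(G)\ge n-\delta$. Then exactly one of the following holds: 1. $G$ has a $2$-proper partition $\mathcal P$ with $|\mathcal P|\le\alpha^*(G)$; 2. $G$ is isomorphic to a graph in $\{K_2,F_5\}\cup\mathcal F_{11}\cup\mathcal F_{12}\cup\mathcal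 H_n^{=}$. -/

import Mathlib

namespace SimpleGraph

section Invariants

variable {V : Type*}

/-- `G` is `k`-connected: it has more than `k` vertices, and deleting fewer than `k` vertices
always leaves a connected graph. -/
def IsKConnected (G : SimpleGraph V) (k : ℕ) : Prop :=
  k < Nat.card V ∧ ∀ S : Finset V, S.card < k → (G.induce ((S : Set V)ᶜ)).Connected

/-- A partition of the vertex set is `k`-proper if each part induces a `k`-connected subgraph. -/
def IsProperPartition [Fintype V] [DecidableEq V] (G : SimpleGraph V) (k : ℕ)
    (P : Finpartition (Finset.univ : Finset V)) : Prop :=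
  ∀ p ∈ P.parts, (G.induce (p : Set V)).IsKConnected k

/-- The minimum degree product `π₂(G)`: the infimum of `d(u) d(v)` over pairs of distinct
non-adjacent vertices, equal to `⊤` when there is no such pair, i.e. when `G` is complete. -/
noncomputable def minDegreeProduct [Fintype V] (G : SimpleGraph V) [DecidableRel G.Adj] : ℕ∞ :=
  ⨅ (u : V) (v : V) (_ : u ≠ v) (_ : ¬ G.Adj u v), ((G.degree u * G.degree v : ℕ) : ℕ∞)

/-- An independent set is light if its degree sum is at most `|V| - 1`. -/
def IsLightIndepSet [Fintype V] (G : SimpleGraph V) [DecidableRel G.Adj] (I : Finset V) : Prop :=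
  G.IsIndepSet (I : Set V) ∧ ∑ u ∈ I, G.degree u ≤ Fintype.card V - 1

/-- The light independence number `α*(G)`, the largest size of a light independent set. The set
of sizes is bounded by `|V|` and contains the size `0` of the empty set. -/
noncomputable def lightIndepNum [Fintype V] (G : SimpleGraph V) [DecidableRel G.Adj] : ℕ :=
  sSup {m : ℕ | ∃ I : Finset V, G.IsLightIndepSet I ∧ I.card = m}

end Invariants

/-- The graph `F₅`, two triangles sharing the vertex `a = 0`; the vertices `b₁, b₂, b₃, b₄` are
`1, 2, 3, 4`. -/
def graphF5 : SimpleGraph (Fin 5) :=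
  fromEdgeSet {s(0, 1), s(0, 2), s(0, 3), s(0, 4), s(1, 2), s(3, 4)}

/-- Vertices `a, b₁, b₂` and `c 0, …, c (m - 1)`, i.e. `c₁, …, cₘ` indexed from `0`. -/
inductive VertexF (m : ℕ) : Type
  | a : VertexF m
  | b₁ : VertexF m
  | b₂ : VertexF m
  | c : Fin m → VertexF m
  deriving DecidableEq

/-- The edges, in one direction, common to all graphs of the family `ℱ₁₁`. -/
def baseRelF11 : VertexF 8 → VertexF 8 → Prop
  | .a, .c _ => True
  | .b₁, .c i => i.val < 4
  | .b₂, .c i => 4 ≤ i.val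
  | .c i, .c j => (i.val, j.val) ∈ ({(0, 1), (2, 3), (4, 5), (6, 7)} : Set (ℕ × ℕ))
  | _, _ => False

/-- The member of the family `ℱ₁₁` with additional edges `L`. -/
def graphF11 (L : Set (Sym2 (VertexF 8))) : SimpleGraph (VertexF 8) :=
  fromRel baseRelF11 ⊔ fromEdgeSet L

/-- The edges, in one direction, common to all graphs of the family `ℱ₁₂`. -/
def baseRelF12 : VertexF 9 → VertexF 9 → Prop
  | .a, .c i => i.val < 8
  | .b₁, .c i => i.val < 4
  | .b₂, .c i => 4 ≤ i.val ∧ i.val < 8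
  | .c i, .c j => (i.val, j.val) ∈ ({(0, 1), (2, 3), (4, 5), (6, 8), (7, 8)} : Set (ℕ × ℕ))
  | _, _ => False

/-- The member of the family `ℱ₁₂` with additional edges `L`. -/
def graphF12 (L : Set (Sym2 (VertexF 9))) : SimpleGraph (VertexF 9) :=
  fromRel baseRelF12 ⊔ fromEdgeSet L

/-- The vertices of `H_{s,t}`: the clique `S₁` of order `s - 1` (constructor `x`), the clique `S₂`
of order `t - 1` (constructor `y`), and `a, b, c₁, c₂`. It is used for `2 ≤ s ≤ t` only. -/
inductive VertexH (s t : ℕ) : Type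
  | a : VertexH s t
  | b : VertexH s t
  | c₁ : VertexH s t
  | c₂ : VertexH s t
  | x : Fin (s - 1) → VertexH s t
  | y : Fin (t - 1) → VertexH s t
  deriving DecidableEq

/-- The edges of `H_{s,t}`, in one direction. -/
def relH (s t : ℕ) : VertexH s t → VertexH s t → Prop
  | .x _, .x _ => True
  | .y _, .y _ => True
  | .a, .x _ => True
  | .a, .y _ => True
  | .b, .x _ => True
  | .b, .y _ => True
  | .a, .b => True
  | .a, .c₁ => True
  | .a, .c₂ => True
  | .c₁, .c₂ => True
  | _, _ => False

/-- The graph `H_{s,t}`. -/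
def graphH (s t : ℕ) : SimpleGraph (VertexH s t) := fromRel (relH s t)

/-- The graph `H_{s,t}⁻ = H_{s,t} - ab`. -/
def graphHMinus (s t : ℕ) : SimpleGraph (VertexH s t) :=
  (graphH s t).deleteEdges {s(VertexH.a, VertexH.b)}

/-- `G` is isomorphic to a graph in `{K₂, F₅} ∪ ℱ₁₁ ∪ ℱ₁₂ ∪ ℋₙ⁼`, where `n` is the order of `G`
and `ℋₙ⁼ = {H_{s,s}, H_{s,s}⁻ | s ≥ 2, 2s + 2 = n}`. -/
def IsExceptional {V : Type*} [Fintype V] (G : SimpleGraph V) : Prop :=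
  Nonempty (G ≃g (⊤ : SimpleGraph (Fin 2))) ∨
  Nonempty (G ≃g graphF5) ∨
  (∃ L : Set (Sym2 (VertexF 8)), L ⊆ {s(.a, .b₁), s(.a, .b₂)} ∧ Nonempty (G ≃g graphF11 L)) ∨
  (∃ L : Set (Sym2 (VertexF 9)),
    L ⊆ {s(.a, .b₁), s(.a, .b₂), s(.a, .c 8), s(.b₂, .c 8)} ∧
    (L ∩ {s(.a, .c 8), s(.b₂, .c 8)}).Nonempty ∧ Nonempty (G ≃g graphF12 L)) ∨
  (∃ s : ℕ, 2 ≤ s ∧ 2 * s + 2 = Fintype.card V ∧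
    (Nonempty (G ≃g graphH s s) ∨ Nonempty (G ≃g graphHMinus s s)))

end SimpleGraph

/-! The hypothesis is used as `ProductCond`: n ≤ d(u)d(v) + d(w) for nonadjacent u ≠ v and any w. A
vertex of degree at most one forces K₂ (`nonempty_iso_top`), so all degrees may be taken to be at
least 2.

Root the graph at a vertex c and work up the block tree. A piece D attached at c has all its
outgoing edges ending at c. Ideally it is free (its 2-proper partition can absorb c without a
further part) or closed (it is partitioned without c, and its independent set avoids the neighbours
of c with room to spare). Both kinds carry an independent set I with as many vertices as there are
parts and with degree sum at most |D|. The whole graph minus c cannot be closed: then d(c) ≤ |I|, no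
vertex of I is adjacent to c, and the product condition (`mul_sum_ge`) makes the degree sum of I too
large. If it is free, the required partition exists.

For a connected piece, let R be the rest of the block of c, and S the vertices of R whose hanging
pieces are free, so that S can be absorbed from below (`exists_decomp`). If all of R is absorbed, D
is closed; if R \ S' is 2-connected for some S' ⊆ S, D is free (`Decomp.cases`). Otherwise consider
T = R \ S. A single vertex is excluded by the product condition. If T is an edge, D is just a
triangle with c. In the remaining case T has two nonadjacent vertices separated by at most one
vertex (`exists_separated_pair`); both join the independent set at the cost of the one part
containing c, so D has a surplus vertex.

A surplus pays for induction on the order. Deleting D ∪ {c} lowers each remaining degree by at most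
one, and the product condition survives (`IsRest.productCond`). The two independent sets together
have one vertex too many, and dropping a vertex of largest degree restores lightness
(`exists_light`). If the rest is K₂, it forms a triangle with c. Any other exceptional rest becomes
2-connected on adding c, with c as a second hub (`IsRest.surplus_of_isProfile`), so it has a surplus
itself and the roles of D and the rest can be exchanged. When both sides are exceptional, small
degrees bound the order and leave only two copies of F₅, or F₅ and a graph of order 6, glued along
c; these give ℱ₁₁ and ℱ₁₂ (`exceptional_of_both`). Triangle pieces are treated directly by a tight
degree count, which yields F₅ or the graphs H (`TrianglePiece.good_or_exceptional`).

The alternatives exclude each other because of cut vertices: K₂ is too small, F₅, ℱ₁₁ and ℱ₁₂ have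
no 2-proper partition at all, and every such partition of H_{s,s} or H_{s,s}⁻ has at least three
parts although α* ≤ 2. -/

namespace SimpleGraph

universe u

set_option linter.unusedSectionVars false
set_option linter.unusedSimpArgs false

/-! ### Degrees into sets, connectivity and partitions for finite vertex sets -/

section Basics

variable {V : Type u} [DecidableEq V]

/-- The neighbours of `v` in the finite set `s`. -/
noncomputable def nbrIn (G : SimpleGraph V) (s : Finset V) (v : V) : Finset V :=
  @Finset.filter V (G.Adj v) (Classical.decPred _) s

/-- The number of neighbours of `v` in `s`. -/
noncomputable def dIn (G : SimpleGraph V) (s : Finset V) (v : V) : ℕ := (G.nbrIn s v).card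

variable {G : SimpleGraph V}

lemma mem_nbrIn {s : Finset V} {v w : V} : w ∈ G.nbrIn s v ↔ w ∈ s ∧ G.Adj v w := by
  exact @Finset.mem_filter _ _ (Classical.decPred _) _ _

lemma dIn_mono {s t : Finset V} (h : s ⊆ t) (v : V) : G.dIn s v ≤ G.dIn t v :=
  Finset.card_le_card fun x hx => by
    rw [mem_nbrIn] at *
    exact ⟨h hx.1, hx.2⟩

lemma dIn_le_card (s : Finset V) (v : V) : G.dIn s v ≤ s.card :=
  Finset.card_le_card fun _ hx => (mem_nbrIn.1 hx).1

lemma dIn_union_of_disjoint {s t : Finset V} (h : Disjoint s t) (v : V) :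
    G.dIn (s ∪ t) v = G.dIn s v + G.dIn t v := by
  unfold dIn
  rw [← Finset.card_union_of_disjoint]
  · congr 1
    ext x
    simp only [mem_nbrIn, Finset.mem_union]
    tauto
  · rw [Finset.disjoint_left] at *
    intro x hx hx'
    exact h (mem_nbrIn.1 hx).1 (mem_nbrIn.1 hx').1

lemma dIn_le_of_forall {s t : Finset V} {v : V} (h : ∀ w ∈ s, G.Adj v w → w ∈ t) :
    G.dIn s v ≤ G.dIn t v :=
  Finset.card_le_card fun x hx => by
    rw [mem_nbrIn] at *
    exact ⟨h x hx.1 hx.2, hx.2⟩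

lemma dIn_le_card_of_forall {s t : Finset V} {v : V} (h : ∀ w ∈ s, G.Adj v w → w ∈ t) :
    G.dIn s v ≤ t.card :=
  (dIn_le_of_forall h).trans (dIn_le_card _ _)

lemma dIn_add_one_le_card {s : Finset V} {v : V} (h : v ∈ s) : G.dIn s v + 1 ≤ s.card := by
  have : G.dIn s v ≤ (s.erase v).card :=
    dIn_le_card_of_forall fun w hw ha => Finset.mem_erase.2 ⟨ha.ne', hw⟩
  rw [Finset.card_erase_of_mem h] at this
  have := Finset.card_pos.2 ⟨v, h⟩
  omega

lemma dIn_eq_zero {s : Finset V} {v : V} (h : ∀ w ∈ s, ¬ G.Adj v w) : G.dIn s v = 0 := by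
  have : G.dIn s v ≤ (∅ : Finset V).card :=
    dIn_le_card_of_forall fun w hw ha => absurd ha (h w hw)
  simpa using this

lemma dIn_insert_le (s : Finset V) (c v : V) : G.dIn (insert c s) v ≤ G.dIn s v + 1 := by
  have : G.nbrIn (insert c s) v ⊆ insert c (G.nbrIn s v) := fun x hx => by
    simp only [mem_nbrIn, Finset.mem_insert] at *
    tauto
  exact (Finset.card_le_card this).trans (Finset.card_insert_le _ _)

/-- If `v` sees as many vertices as `t` has, and only vertices in `t`, it sees all of `t`. -/
lemma adj_of_card_le_dIn {s t : Finset V} {v : V} (h : ∀ w ∈ s, G.Adj v w → w ∈ t)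
    (hc : t.card ≤ G.dIn s v) {w : V} (hw : w ∈ t) : G.Adj v w := by
  have hsub : G.nbrIn s v ⊆ t := fun x hx => h x (mem_nbrIn.1 hx).1 (mem_nbrIn.1 hx).2
  have := Finset.eq_of_subset_of_card_le hsub hc
  rw [← this] at hw
  exact (mem_nbrIn.1 hw).2

/-- The finite set `s` induces a connected subgraph. -/
def Conn (G : SimpleGraph V) (s : Finset V) : Prop :=
  s.Nonempty ∧ ∀ A ⊆ s, A.Nonempty → A ≠ s → ∃ u ∈ A, ∃ v ∈ s, v ∉ A ∧ G.Adj u v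

/-- The finite set `s` induces a `2`-connected subgraph. -/
def TwoConn (G : SimpleGraph V) (s : Finset V) : Prop :=
  3 ≤ s.card ∧ G.Conn s ∧ ∀ x ∈ s, G.Conn (s.erase x)

lemma not_conn {s : Finset V} (hs : s.Nonempty) (h : ¬ G.Conn s) :
    ∃ A ⊆ s, A.Nonempty ∧ (s \ A).Nonempty ∧ ∀ u ∈ A, ∀ v ∈ s \ A, ¬ G.Adj u v := by
  unfold Conn at h
  push Not at h
  obtain ⟨A, hA, hne, hAs, hh⟩ := h hs
  refine ⟨A, hA, hne, ?_, fun u hu v hv => ?_⟩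
  · rw [Finset.sdiff_nonempty]
    exact fun h' => hAs (hA.antisymm h')
  · rw [Finset.mem_sdiff] at hv
    exact hh u hu v hv.1 hv.2

/-- The finite set `s` can be partitioned into `k` sets inducing `2`-connected subgraphs. -/
inductive HasPart (G : SimpleGraph V) : Finset V → ℕ → Prop
  | empty : HasPart G ∅ 0
  | union {p s : Finset V} {k : ℕ} (hp : G.TwoConn p) (hs : HasPart G s k) (hd : Disjoint p s) :
      HasPart G (p ∪ s) (k + 1)

lemma HasPart.union_part {s t : Finset V} {k l : ℕ} (hs : G.HasPart s k) (ht : G.HasPart t l)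
    (hd : Disjoint s t) : G.HasPart (s ∪ t) (k + l) := by
  induction hs with
  | empty => simpa using ht
  | @union p s k hp hs hd' ih =>
    rw [Finset.disjoint_union_left] at hd
    have := HasPart.union hp (ih hd.2) (by
      rw [Finset.disjoint_union_right]; exact ⟨hd', hd.1⟩)
    rw [Finset.union_assoc]
    convert this using 1
    omega

lemma TwoConn.hasPart {p : Finset V} (hp : G.TwoConn p) : G.HasPart p 1 := by
  simpa using HasPart.union hp HasPart.empty (Finset.disjoint_empty_right _)

lemma HasPart.eq_empty {s : Finset V} (h : G.HasPart s 0) : s = ∅ := by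
  cases h; rfl

lemma HasPart.biUnion {ι : Type*} [DecidableEq ι] (R : Finset ι) (f : ι → Finset V) (k : ι → ℕ)
    (hf : ∀ x ∈ R, G.HasPart (f x) (k x))
    (hd : ∀ x ∈ R, ∀ y ∈ R, x ≠ y → Disjoint (f x) (f y)) :
    G.HasPart (R.biUnion f) (∑ x ∈ R, k x) := by
  induction R using Finset.induction_on with
  | empty => simpa using HasPart.empty
  | @insert a R ha ih =>
    rw [Finset.biUnion_insert, Finset.sum_insert ha]
    refine (hf a (Finset.mem_insert_self _ _)).union_part
      (ih (fun x hx => hf x (Finset.mem_insert_of_mem hx))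
        fun x hx y hy => hd x (Finset.mem_insert_of_mem hx) y (Finset.mem_insert_of_mem hy)) ?_
    rw [Finset.disjoint_biUnion_right]
    exact fun x hx => hd a (Finset.mem_insert_self _ _) x (Finset.mem_insert_of_mem hx)
      (fun h => ha (h ▸ hx))

/-- The finite set `I` is independent. -/
def Indep (G : SimpleGraph V) (I : Finset V) : Prop := ∀ u ∈ I, ∀ v ∈ I, ¬ G.Adj u v

lemma Indep.mono {I J : Finset V} (h : G.Indep I) (hJ : J ⊆ I) : G.Indep J :=
  fun u hu v hv => h u (hJ hu) v (hJ hv)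

lemma Indep.union {I J : Finset V} (hI : G.Indep I) (hJ : G.Indep J)
    (h : ∀ u ∈ I, ∀ v ∈ J, ¬ G.Adj u v) : G.Indep (I ∪ J) := by
  intro u hu v hv ha
  rw [Finset.mem_union] at hu hv
  rcases hu with hu | hu <;> rcases hv with hv | hv
  · exact hI u hu v hv ha
  · exact h u hu v hv ha
  · exact h v hv u hu ha.symm
  · exact hJ u hu v hv ha

lemma Indep.insert {I : Finset V} (hI : G.Indep I) {y : V} (h : ∀ v ∈ I, ¬ G.Adj y v) :
    G.Indep (insert y I) := by
  intro u hu v hv ha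
  rw [Finset.mem_insert] at hu hv
  rcases hu with rfl | hu <;> rcases hv with rfl | hv
  · exact ha.ne rfl
  · exact h v hv ha
  · exact h u hu ha.symm
  · exact hI u hu v hv ha

/-- A set of at least two vertices that is neither `2`-connected nor an edge contains two
non-adjacent vertices separated by at most one vertex. -/
lemma exists_separated_pair {T : Finset V} (h2 : 2 ≤ T.card) (hT : ¬ G.TwoConn T)
    (he : ∀ y y', T = {y, y'} → ¬ G.Adj y y') :
    ∃ y ∈ T, ∃ y' ∈ T, y ≠ y' ∧ ¬ G.Adj y y' ∧ G.dIn T y + G.dIn T y' + 1 ≤ T.card := by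
  have hTne : T.Nonempty := Finset.card_pos.1 (by omega)
  by_cases hc : G.Conn T
  · have h3 : 3 ≤ T.card := by
      by_contra h3
      obtain ⟨y, y', hyy, rfl⟩ := Finset.card_eq_two.1 (show T.card = 2 by omega)
      obtain ⟨u, hu, v, hv, hvu, ha⟩ := hc.2 {y} (by simp) (by simp) (by
        intro h
        have : y' ∈ ({y} : Finset V) := by rw [h]; simp
        exact hyy (Finset.mem_singleton.1 this).symm)
      simp only [Finset.mem_singleton, Finset.mem_insert] at hu hv hvu
      subst hu
      rcases hv with hv | hv
      · exact absurd hv hvu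
      · subst hv
        exact he _ _ rfl ha
    have : ∃ x ∈ T, ¬ G.Conn (T.erase x) := by
      by_contra hx
      push Not at hx
      exact hT ⟨h3, hc, hx⟩
    obtain ⟨x, hx, hnc⟩ := this
    have hcard := Finset.card_erase_of_mem hx
    obtain ⟨A, hA, ⟨y, hy⟩, ⟨y', hy'⟩, hno⟩ :=
      not_conn (Finset.card_pos.1 (by omega)) hnc
    have hyT := hA hy
    have hy'T := Finset.mem_sdiff.1 hy'
    refine ⟨y, (Finset.mem_erase.1 hyT).2, y', (Finset.mem_erase.1 hy'T.1).2, ?_,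
      hno y hy y' hy', ?_⟩
    · rintro rfl
      exact hy'T.2 hy
    -- Besides the cut vertex `x`, a vertex sees only its own side of `T - x`, so the two degrees
    -- add up to at most |T| - 1.
    · have h1 : G.dIn T y ≤ (insert x (A.erase y)).card := dIn_le_card_of_forall fun w hw ha => by
        by_contra hcon
        simp only [Finset.mem_insert, Finset.mem_erase, not_or, not_and] at hcon
        refine hno y hy w ?_ ha
        simp only [Finset.mem_sdiff, Finset.mem_erase]
        exact ⟨⟨hcon.1, hw⟩, hcon.2 ha.ne'⟩
      have h2 : G.dIn T y' ≤ (insert x (((T.erase x) \ A).erase y')).card :=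
        dIn_le_card_of_forall fun w hw ha => by
        by_contra hcon
        simp only [Finset.mem_insert, Finset.mem_erase, not_or, not_and, Finset.mem_sdiff,
          not_not] at hcon
        exact hno w (hcon.2 ha.ne' ⟨hcon.1, hw⟩) y' hy' ha.symm
      have h3 := Finset.card_insert_le x (A.erase y)
      have h4 := Finset.card_insert_le x (((T.erase x) \ A).erase y')
      rw [Finset.card_erase_of_mem hy] at h3
      rw [Finset.card_erase_of_mem hy'] at h4
      have h5 := Finset.card_sdiff_add_card_eq_card hA
      have h6 := Finset.card_pos.2 ⟨y, hy⟩
      have h7 := Finset.card_pos.2 ⟨y', hy'⟩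
      omega
  · obtain ⟨A, hA, ⟨y, hy⟩, ⟨y', hy'⟩, hno⟩ := not_conn hTne hc
    have hy'T := Finset.mem_sdiff.1 hy'
    refine ⟨y, hA hy, y', hy'T.1, ?_, hno y hy y' hy', ?_⟩
    · rintro rfl
      exact hy'T.2 hy
    · have h1 : G.dIn T y ≤ (A.erase y).card := dIn_le_card_of_forall fun w hw ha => by
        by_contra hcon
        rw [Finset.mem_erase, not_and] at hcon
        exact hno y hy w (Finset.mem_sdiff.2 ⟨hw, hcon ha.ne'⟩) ha
      have h2 : G.dIn T y' ≤ ((T \ A).erase y').card := dIn_le_card_of_forall fun w hw ha => by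
        by_contra hcon
        simp only [Finset.mem_erase, not_and, Finset.mem_sdiff, not_not] at hcon
        exact hno w (hcon ha.ne' hw) y' hy' ha.symm
      rw [Finset.card_erase_of_mem hy] at h1
      rw [Finset.card_erase_of_mem hy'] at h2
      have h5 := Finset.card_sdiff_add_card_eq_card hA
      have h6 := Finset.card_pos.2 ⟨y, hy⟩
      have h7 := Finset.card_pos.2 ⟨y', hy'⟩
      omega

lemma twoConn_triangle {x y z : V} (hxy : G.Adj x y) (hxz : G.Adj x z) (hyz : G.Adj y z) :
    G.TwoConn {x, y, z} := by
  have key : ∀ s : Finset V, s.Nonempty → (∀ u ∈ s, ∀ v ∈ s, u ≠ v → G.Adj u v) → G.Conn s := by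
    intro s hs h
    refine ⟨hs, fun A hA ⟨u, hu⟩ hne => ?_⟩
    obtain ⟨v, hv⟩ : (s \ A).Nonempty := by
      rw [Finset.sdiff_nonempty]
      exact fun h' => hne (hA.antisymm h')
    rw [Finset.mem_sdiff] at hv
    exact ⟨u, hu, v, hv.1, hv.2, h u (hA hu) v hv.1 fun h => hv.2 (h ▸ hu)⟩
  have hall : ∀ u ∈ ({x, y, z} : Finset V), ∀ v ∈ ({x, y, z} : Finset V), u ≠ v → G.Adj u v := by
    intro u hu v hv huv
    simp only [Finset.mem_insert, Finset.mem_singleton] at hu hv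
    rcases hu with rfl | rfl | rfl <;> rcases hv with rfl | rfl | rfl <;>
      first | exact absurd rfl huv | assumption | (apply SimpleGraph.Adj.symm; assumption)
  have hcard : ({x, y, z} : Finset V).card = 3 :=
    Finset.card_eq_three.2 ⟨x, y, z, hxy.ne, hxz.ne, hyz.ne, rfl⟩
  refine ⟨hcard.ge, key _ (by simp) hall, fun w hw => key _ ?_ fun u hu v hv =>
    hall u (Finset.mem_of_mem_erase hu) v (Finset.mem_of_mem_erase hv)⟩
  rw [← Finset.card_pos, Finset.card_erase_of_mem hw]
  omega

end Basics

/-! ### Light independent sets -/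

section Light

variable {V : Type u} [Fintype V] [DecidableEq V]

/-- The degree condition `π₂(G) ≥ n - δ`, written without subtraction. -/
def ProductCond (G : SimpleGraph V) : Prop :=
  ∀ u v w : V, u ≠ v → ¬ G.Adj u v →
    Fintype.card V ≤ G.dIn Finset.univ u * G.dIn Finset.univ v + G.dIn Finset.univ w

/-- There is a `2`-proper partition with at most as many parts as some light independent set. -/
def Good (G : SimpleGraph V) : Prop :=
  ∃ I : Finset V, G.Indep I ∧ ∑ u ∈ I, G.dIn Finset.univ u + 1 ≤ Fintype.card V ∧
    ∃ k ≤ I.card, G.HasPart Finset.univ k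

variable {G : SimpleGraph V}

/-- If an independent set is nearly light, then dropping a vertex of largest degree makes it
light. -/
lemma exists_light (hG : G.ProductCond) (h1 : ∀ v, 1 ≤ G.dIn Finset.univ v) {I : Finset V}
    (hI : G.Indep I) (h2 : 2 ≤ I.card)
    (hs : ∑ u ∈ I, G.dIn Finset.univ u + 3 ≤ Fintype.card V + I.card) :
    ∃ J ⊆ I, J.card + 1 = I.card ∧ ∑ u ∈ J, G.dIn Finset.univ u + 1 ≤ Fintype.card V := by
  have hne : I.Nonempty := Finset.card_pos.1 (by omega)
  obtain ⟨z, hz, hmax⟩ := Finset.exists_max_image I (G.dIn Finset.univ) hne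
  refine ⟨I.erase z, Finset.erase_subset _ _, Finset.card_erase_add_one hz, ?_⟩
  have hsum := Finset.add_sum_erase I (G.dIn Finset.univ) hz
  by_contra hcon
  -- If the sum without `z` is still at least n, the assumed bound n + |I| - 3 leaves at most |I| -
  -- 3 for the largest degree.
  have hzle : G.dIn Finset.univ z + 3 ≤ I.card := by omega
  obtain ⟨x, hx, hmin⟩ := Finset.exists_min_image I (G.dIn Finset.univ) hne
  have hce := Finset.card_erase_of_mem hx
  obtain ⟨y, hy, hmin'⟩ := Finset.exists_min_image (I.erase x) (G.dIn Finset.univ)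
    (Finset.card_pos.1 (by omega))
  have hyI := Finset.mem_of_mem_erase hy
  have hsumx := Finset.add_sum_erase I (G.dIn Finset.univ) hx
  have hle : (I.erase x).card • G.dIn Finset.univ y ≤ ∑ u ∈ I.erase x, G.dIn Finset.univ u :=
    Finset.card_nsmul_le_sum _ _ _ hmin'
  have hn := hG x y x (Finset.ne_of_mem_erase hy).symm (hI x hx y hyI)
  have hxy := hmin y hyI
  have hyz := hmax y hyI
  have hx1 := h1 x
  rw [hce, smul_eq_mul] at hle
  generalize G.dIn Finset.univ x = a at *
  generalize G.dIn Finset.univ y = b at *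
  generalize G.dIn Finset.univ z = d at *
  obtain ⟨k, hk⟩ : ∃ k, I.card = k + 1 := ⟨I.card - 1, by omega⟩
  rw [hk, Nat.add_sub_cancel] at hle
  rw [hk] at hzle hs
  -- With a ≤ b the two smallest degrees and k = |I| - 1, the sum is at least a + kb, while n ≤ ab +
  -- a bounds it from above. Since b ≤ k - 2, the difference k - a is at least 2, and (k - a)b ≤ k -
  -- 2 fails.
  have h3 : k * b + 2 ≤ a * b + k := by omega
  obtain ⟨e, rfl⟩ : ∃ e, k = a + 2 + e := ⟨k - a - 2, by omega⟩
  obtain ⟨f, rfl⟩ : ∃ f, b = a + f := ⟨b - a, by omega⟩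
  nlinarith [Nat.zero_le (e * f), Nat.zero_le (a * e), Nat.zero_le (a*f), mul_le_mul hx1 (le_refl e) (Nat.zero_le _) (Nat.zero_le _)]

end Light

/-! ### Pieces attached at a vertex, and retraction onto a block -/

section Pieces

variable {V : Type u} [DecidableEq V] {G : SimpleGraph V}

lemma Conn.insert {s : Finset V} (h : G.Conn s) {c u : V} (hu : u ∈ s) (hcu : G.Adj c u) :
    G.Conn (insert c s) := by
  refine ⟨Finset.insert_nonempty _ _, fun A hA hne hAs => ?_⟩
  by_cases hcs : c ∈ s
  · rw [Finset.insert_eq_of_mem hcs] at hA hAs ⊢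
    exact h.2 A hA hne hAs
  by_cases hsA : s ⊆ A
  · have hcA : c ∉ A := fun hc => hAs (hA.antisymm (Finset.insert_subset hc hsA))
    exact ⟨u, hsA hu, c, Finset.mem_insert_self _ _, hcA, hcu.symm⟩
  by_cases hAe : (A ∩ s).Nonempty
  · obtain ⟨x, hx, y, hy, hyA, ha⟩ := h.2 (A ∩ s) Finset.inter_subset_right hAe
      (fun h' => hsA (h' ▸ Finset.inter_subset_left))
    rw [Finset.mem_inter] at hx hyA
    exact ⟨x, hx.1, y, Finset.mem_insert_of_mem hy, fun h => hyA ⟨h, hy⟩, ha⟩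
  · have hsub : ∀ x ∈ A, x = c := fun x hx => by
      rcases Finset.mem_insert.1 (hA hx) with h' | h'
      · exact h'
      · exact absurd ⟨x, Finset.mem_inter.2 ⟨hx, h'⟩⟩ hAe
    obtain ⟨x, hx⟩ := hne
    have hxc := hsub x hx
    subst hxc
    exact ⟨x, hx, u, Finset.mem_insert_of_mem hu, fun h' => hcs (hsub u h' ▸ hu), hcu⟩

/-- All edges leaving the finite set `D` go to the vertex `c`, which is outside of `D`. -/
def Attach (G : SimpleGraph V) (c : V) (D : Finset V) : Prop :=
  c ∉ D ∧ ∀ u ∈ D, ∀ v, v ∉ D → G.Adj u v → v = c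

/-- A map `φ` retracting `D` onto `R` such that the fibres of `φ` hang at single vertices of `R`,
and all neighbours of `c` in `D` are in `R`. -/
structure IsRetract (G : SimpleGraph V) (c : V) (D R : Finset V) (φ : V → V) : Prop where
  sub : R ⊆ D
  nonempty : R.Nonempty
  fix : ∀ x ∈ R, φ x = x
  maps : ∀ x ∈ D, φ x ∈ R
  edge : ∀ u ∈ D, ∀ v ∈ D, G.Adj u v → φ u ≠ φ v → u ∈ R ∧ v ∈ R
  nbr : ∀ u ∈ D, G.Adj c u → u ∈ R

/-- A cut of `R` pulls back along `φ` to a cut of `D`; an edge crossing the latter joins different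
fibres, hence lies in `R`. -/
lemma IsRetract.conn {c : V} {D R : Finset V} {φ : V → V} (h : G.IsRetract c D R φ)
    (hD : G.Conn D) : G.Conn R := by
  refine ⟨h.nonempty, fun A hA ⟨a, ha⟩ hne => ?_⟩
  obtain ⟨b, hb⟩ : (R \ A).Nonempty := by
    rw [Finset.sdiff_nonempty]
    exact fun h' => hne (hA.antisymm h')
  rw [Finset.mem_sdiff] at hb
  obtain ⟨u, hu, v, hv, hvu, huv⟩ := hD.2 (D.filter (φ · ∈ A)) (Finset.filter_subset _ _)
    ⟨a, Finset.mem_filter.2 ⟨h.sub (hA ha), by rwa [h.fix a (hA ha)]⟩⟩ (by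
      intro h'
      have := h.sub hb.1
      rw [← h', Finset.mem_filter, h.fix b hb.1] at this
      exact hb.2 this.2)
  rw [Finset.mem_filter] at hu hvu
  have hvA : φ v ∉ A := fun h' => hvu ⟨hv, h'⟩
  obtain ⟨h1, h2⟩ := h.edge u hu.1 v hv huv (fun h' => hvA (h' ▸ hu.2))
  rw [h.fix u h1] at hu
  rw [h.fix v h2] at hvA
  exact ⟨u, hu.2, v, h2, hvA, huv⟩

/-- When `x` separates `B` from `c` and the rest of `R`, everything lying over `B` can be sent to
`x`. -/
lemma IsRetract.shrink {c : V} {D R : Finset V} {φ : V → V} (h : G.IsRetract c D R φ)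
    {x : V} (hx : x ∈ R) {B : Finset V} (hB : B ⊆ R.erase x)
    (hno : ∀ u ∈ B, ∀ v ∈ (insert c R).erase x, v ∉ B → ¬ G.Adj u v) (hc : c ∉ D) :
    G.IsRetract c D (R \ B) (fun v => if φ v ∈ B then x else φ v) := by
  have hxB : x ∉ B := fun h' => (Finset.mem_erase.1 (hB h')).1 rfl
  refine ⟨Finset.sdiff_subset.trans h.sub, ⟨x, Finset.mem_sdiff.2 ⟨hx, hxB⟩⟩, ?_, ?_, ?_, ?_⟩
  · intro y hy
    rw [Finset.mem_sdiff] at hy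
    simp only [h.fix y hy.1, hy.2, if_false]
  · intro y hy
    split_ifs with h'
    · exact Finset.mem_sdiff.2 ⟨hx, hxB⟩
    · exact Finset.mem_sdiff.2 ⟨h.maps y hy, h'⟩
  · have key : ∀ u ∈ D, ∀ v ∈ D, G.Adj u v → φ u ∈ B → φ v ∉ B → φ v = x := by
      intro u hu v hv ha hu' hv'
      by_contra hvx
      obtain ⟨h1, h2⟩ := h.edge u hu v hv ha (fun h' => hv' (h' ▸ hu'))
      rw [h.fix u h1] at hu'
      rw [h.fix v h2] at hv' hvx
      exact hno u hu' v (Finset.mem_erase.2 ⟨hvx, Finset.mem_insert_of_mem h2⟩) hv' ha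
    intro u hu v hv ha hne
    split_ifs at hne with h1 h2 h2
    · exact absurd rfl hne
    · exact absurd (key u hu v hv ha h1 h2).symm hne
    · exact absurd (key v hv u hu ha.symm h2 h1) hne
    · obtain ⟨h3, h4⟩ := h.edge u hu v hv ha hne
      rw [h.fix u h3] at h1
      rw [h.fix v h4] at h2
      exact ⟨Finset.mem_sdiff.2 ⟨h3, h1⟩, Finset.mem_sdiff.2 ⟨h4, h2⟩⟩
  · intro u hu ha
    have huR := h.nbr u hu ha
    refine Finset.mem_sdiff.2 ⟨huR, fun huB => hno u huB c ?_ ?_ ha.symm⟩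
    · refine Finset.mem_erase.2 ⟨?_, Finset.mem_insert_self _ _⟩
      rintro rfl
      exact hc (h.sub hx)
    · exact fun h' => hc (h.sub (Finset.mem_of_mem_erase (hB h')))

/-- A connected piece `D` attached at `c` retracts onto the rest of the block of `c`. -/
lemma exists_isRetract {c : V} {D : Finset V} (hc : c ∉ D) (hD : G.Conn D)
    (hcD : ∃ u ∈ D, G.Adj c u) :
    ∃ R φ, G.IsRetract c D R φ ∧ (G.TwoConn (insert c R) ∨ ∃ x, R = {x}) := by
  have key : ∀ n, ∀ R φ, G.IsRetract c D R φ → R.card = n →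
      ∃ R φ, G.IsRetract c D R φ ∧ (G.TwoConn (insert c R) ∨ ∃ x, R = {x}) := by
    intro n
    induction n using Nat.strong_induction_on with
    | _ n ih =>
      intro R φ hR hn
      by_cases hgoal : G.TwoConn (insert c R) ∨ ∃ x, R = {x}
      · exact ⟨R, φ, hR, hgoal⟩
      have hcR : c ∉ R := fun h' => hc (hR.sub h')
      push Not at hgoal
      have hRc := hR.conn hD
      obtain ⟨u, hu, hcu⟩ := hcD
      have h2 : 2 ≤ R.card := by
        have h0 := Finset.card_pos.2 hR.nonempty
        by_contra h1
        obtain ⟨x, hx⟩ := Finset.card_eq_one.1 (show R.card = 1 by omega)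
        exact hgoal.2 x hx
      obtain ⟨x, hx, hnc⟩ : ∃ x ∈ insert c R, ¬ G.Conn ((insert c R).erase x) := by
        by_contra hcon
        push Not at hcon
        refine hgoal.1 ⟨?_, hRc.insert (hR.nbr u hu hcu) hcu, hcon⟩
        rw [Finset.card_insert_of_notMem hcR]
        omega
      -- The cut vertex is not `c`, as `R` is connected, being a retract of `D`.
      rcases Finset.mem_insert.1 hx with rfl | hxR
      · rw [Finset.erase_insert hcR] at hnc
        exact absurd hRc hnc
      have hxc : c ≠ x := fun h' => hcR (h' ▸ hxR)
      have hcm : c ∈ (insert c R).erase x := Finset.mem_erase.2 ⟨hxc, Finset.mem_insert_self _ _⟩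
      obtain ⟨A, hA, hA1, hA2, hno⟩ := not_conn ⟨c, hcm⟩ hnc
      -- Take the side of the separation that misses `c`, and collapse it to `x`; the retract
      -- becomes strictly smaller.
      obtain ⟨B, hB, hBne, hcB, hBno⟩ : ∃ B ⊆ (insert c R).erase x, B.Nonempty ∧ c ∉ B ∧
          ∀ u ∈ B, ∀ v ∈ (insert c R).erase x, v ∉ B → ¬ G.Adj u v := by
        by_cases hcA : c ∈ A
        · refine ⟨_, Finset.sdiff_subset, hA2, fun h' => (Finset.mem_sdiff.1 h').2 hcA, ?_⟩
          intro u hu v hv hvB ha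
          refine hno v ?_ u hu ha.symm
          by_contra hvA
          exact hvB (Finset.mem_sdiff.2 ⟨hv, hvA⟩)
        · exact ⟨A, hA, hA1, hcA, fun u hu v hv hvA =>
            hno u hu v (Finset.mem_sdiff.2 ⟨hv, hvA⟩)⟩
      have hBR : B ⊆ R.erase x := fun y hy => by
        have := hB hy
        simp only [Finset.mem_erase, Finset.mem_insert] at this ⊢
        refine ⟨this.1, this.2.resolve_left ?_⟩
        rintro rfl
        exact hcB hy
      refine ih (R \ B).card ?_ _ _ (hR.shrink hxR hBR hBno hc) rfl
      rw [← hn]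
      obtain ⟨b, hb⟩ := hBne
      exact Finset.card_lt_card (Finset.sdiff_ssubset (hBR.trans (Finset.erase_subset _ _)) ⟨b, hb⟩)
  exact key _ D id ⟨subset_rfl, hD.1, fun _ _ => rfl, fun _ h => h, fun _ hu _ hv _ _ => ⟨hu, hv⟩,
    fun _ hu _ => hu⟩ rfl

end Pieces

/-! ### Free and closed pieces, and their assembly along a block -/

section FreeClosed

variable {V : Type u} [Fintype V] [DecidableEq V] {G : SimpleGraph V}

/-- The piece `D` has a `2`-proper partition matched by an independent set of small degree sum,
whether or not `c` is added to it. -/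
def FreePiece (G : SimpleGraph V) (c : V) (D : Finset V) : Prop :=
  ∃ I ⊆ D, I.Nonempty ∧ G.Indep I ∧ ∑ u ∈ I, G.dIn Finset.univ u ≤ D.card ∧
    G.HasPart D I.card ∧ G.HasPart (insert c D) I.card

/-- The piece `D` has a `2`-proper partition matched by an independent set avoiding the
neighbours of `c`, with room for the edges from `c` to `D`. -/
def ClosedPiece (G : SimpleGraph V) (c : V) (D : Finset V) : Prop :=
  ∃ I ⊆ D, G.Indep I ∧ (∀ u ∈ I, ¬ G.Adj c u) ∧
    ∑ u ∈ I, G.dIn Finset.univ u + G.dIn D c ≤ D.card ∧ G.dIn D c ≤ I.card ∧ G.HasPart D I.card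

lemma closed_empty (c : V) : G.ClosedPiece c ∅ :=
  ⟨∅, subset_rfl, fun u hu => absurd hu (Finset.notMem_empty u),
    fun u hu => absurd hu (Finset.notMem_empty u),
    by simp [dIn_eq_zero (G := G) (s := ∅) (v := c) (by simp)],
    by simp [dIn_eq_zero (G := G) (s := ∅) (v := c) (by simp)], by simpa using HasPart.empty⟩

/-- One free piece suffices: it absorbs `c`, while the other piece is always partitioned without
`c`. -/
lemma FreePiece.union {c : V} {D E : Finset V} (hD : G.FreePiece c D)
    (hE : G.FreePiece c E ∨ G.ClosedPiece c E)
    (hDE : Disjoint D E) (hcE : c ∉ E) (hno : ∀ u ∈ D, ∀ v ∈ E, ¬ G.Adj u v) :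
    G.FreePiece c (D ∪ E) := by
  obtain ⟨I, hI, hne, hind, hsum, hp, hpc⟩ := hD
  obtain ⟨J, hJ, hindJ, hsumJ, hpJ⟩ : ∃ J ⊆ E, G.Indep J ∧
      ∑ u ∈ J, G.dIn Finset.univ u ≤ E.card ∧ G.HasPart E J.card := by
    rcases hE with ⟨J, h1, h2, h3, h4, h5, h6⟩ | ⟨J, h1, h2, h3, h4, h5, h6⟩
    · exact ⟨J, h1, h3, h4, h5⟩
    · exact ⟨J, h1, h2, by omega, h6⟩
  have hd : Disjoint I J := Finset.disjoint_of_subset_left hI (Finset.disjoint_of_subset_right hJ hDE)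
  refine ⟨I ∪ J, Finset.union_subset_union hI hJ, hne.mono Finset.subset_union_left,
    hind.union hindJ fun u hu v hv => hno u (hI hu) v (hJ hv), ?_, ?_, ?_⟩
  · rw [Finset.sum_union hd, Finset.card_union_of_disjoint hDE]
    omega
  · rw [Finset.card_union_of_disjoint hd]
    exact hp.union_part hpJ hDE
  · rw [Finset.card_union_of_disjoint hd, ← Finset.insert_union]
    exact hpc.union_part hpJ (Finset.disjoint_insert_left.2 ⟨hcE, hDE⟩)

lemma ClosedPiece.union {c : V} {D E : Finset V} (hD : G.ClosedPiece c D) (hE : G.ClosedPiece c E)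
    (hDE : Disjoint D E) (hno : ∀ u ∈ D, ∀ v ∈ E, ¬ G.Adj u v) : G.ClosedPiece c (D ∪ E) := by
  obtain ⟨I, h1, h2, h3, h4, h5, h6⟩ := hD
  obtain ⟨J, k1, k2, k3, k4, k5, k6⟩ := hE
  have hd : Disjoint I J := Finset.disjoint_of_subset_left h1 (Finset.disjoint_of_subset_right k1 hDE)
  refine ⟨I ∪ J, Finset.union_subset_union h1 k1, h2.union k2 fun u hu v hv =>
    hno u (h1 hu) v (k1 hv), ?_, ?_, ?_, ?_⟩
  · intro u hu
    rcases Finset.mem_union.1 hu with hu | hu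
    exacts [h3 u hu, k3 u hu]
  · rw [Finset.sum_union hd, Finset.card_union_of_disjoint hDE, dIn_union_of_disjoint hDE]
    omega
  · rw [Finset.card_union_of_disjoint hd, dIn_union_of_disjoint hDE]
    omega
  · rw [Finset.card_union_of_disjoint hd]
    exact h6.union_part k6 hDE

/-- The data assembled from a block at `c` with remaining vertices `R`, all of whose hanging
pieces (with union `Z`) are free (at the vertices in `S`) or closed. -/
structure Decomp (G : SimpleGraph V) (c : V) (D R S Z I : Finset V) : Prop where
  ne : R.Nonempty
  union : R ∪ Z = D
  disj : Disjoint R Z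
  sub : S ⊆ R
  block : G.TwoConn (insert c R) ∨ ∃ x, R = {x}
  part : ∀ S' ⊆ S, G.HasPart (S' ∪ Z) I.card
  indep : G.Indep I
  subI : I ⊆ Z
  nadj : ∀ y ∈ R, y ∉ S → ∀ u ∈ I, ¬ G.Adj y u
  sum : ∑ u ∈ I, G.dIn Finset.univ u + ∑ y ∈ R \ S, G.dIn Z y ≤ Z.card
  card : S.card + ∑ y ∈ R \ S, G.dIn Z y ≤ I.card
  nbr : ∀ u ∈ D, G.Adj c u → u ∈ R

/-- The fibre of the retraction over `x ∈ R`, without `x`, is a smaller piece attached at `x`, so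
`ih` applies to it. Different fibres are disjoint and not joined by edges, so partitions,
independent sets and degree bounds add up. -/
lemma exists_decomp {c : V} {D : Finset V} (hat : G.Attach c D) (hD : G.Conn D)
    (hcD : ∃ u ∈ D, G.Adj c u)
    (ih : ∀ x E, E ⊂ D → G.Attach x E → G.FreePiece x E ∨ G.ClosedPiece x E) :
    ∃ R S Z I, G.Decomp c D R S Z I := by
  classical
  obtain ⟨R, φ, hR, hblock⟩ := exists_isRetract hat.1 hD hcD
  let Zf : V → Finset V := fun x => (D.filter (φ · = x)).erase x
  have memZ : ∀ {x z}, z ∈ Zf x ↔ z ≠ x ∧ z ∈ D ∧ φ z = x := by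
    intro x z
    simp only [Zf, Finset.mem_erase, Finset.mem_filter]
  have notR : ∀ {x z}, x ∈ R → z ∈ Zf x → z ∉ R := by
    intro x z hx hz hzR
    rw [memZ] at hz
    exact hz.1 ((hR.fix z hzR).symm.trans hz.2.2)
  have hAt : ∀ x ∈ R, G.Attach x (Zf x) := by
    intro x hx
    refine ⟨fun h => (memZ.1 h).1 rfl, fun u hu v hv ha => ?_⟩
    have hu' := memZ.1 hu
    by_contra hvx
    have hvD : v ∈ D := by
      by_contra hvD
      have := hat.2 u hu'.2.1 v hvD ha
      subst this
      exact notR hx hu (hR.nbr u hu'.2.1 ha.symm)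
    have hne : φ u ≠ φ v := fun h => hv (memZ.2 ⟨hvx, hvD, h ▸ hu'.2.2⟩)
    exact notR hx hu (hR.edge u hu'.2.1 v hvD ha hne).1
  have hsub : ∀ x ∈ R, Zf x ⊂ D := fun x hx =>
    ⟨fun z hz => (memZ.1 hz).2.1, fun h => (memZ.1 (h (hR.sub hx))).1 rfl⟩
  -- One set is chosen per vertex. The closed alternative also records that the piece is not free,
  -- so that the choice agrees with membership in `S`.
  have hex : ∀ x, ∃ I : Finset V, x ∈ R → I ⊆ Zf x ∧ G.Indep I ∧ G.HasPart (Zf x) I.card ∧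
      ((I.Nonempty ∧ ∑ u ∈ I, G.dIn Finset.univ u ≤ (Zf x).card ∧
        G.HasPart (insert x (Zf x)) I.card) ∨ (¬ G.FreePiece x (Zf x) ∧ (∀ u ∈ I, ¬ G.Adj x u) ∧
        ∑ u ∈ I, G.dIn Finset.univ u + G.dIn (Zf x) x ≤ (Zf x).card ∧
        G.dIn (Zf x) x ≤ I.card)) := by
    intro x
    by_cases hx : x ∈ R
    · by_cases hf : G.FreePiece x (Zf x)
      · obtain ⟨I, h1, h2, h3, h4, h5, h6⟩ := hf
        exact ⟨I, fun _ => ⟨h1, h3, h5, Or.inl ⟨h2, h4, h6⟩⟩⟩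
      · obtain ⟨I, h1, h2, h3, h4, h5, h6⟩ :=
          (ih x _ (hsub x hx) (hAt x hx)).resolve_left hf
        exact ⟨I, fun _ => ⟨h1, h2, h6, Or.inr ⟨hf, h3, h4, h5⟩⟩⟩
    · exact ⟨∅, fun h => absurd h hx⟩
  choose I hI using hex
  let S := R.filter fun x => G.FreePiece x (Zf x)
  have hSR : S ⊆ R := Finset.filter_subset _ _
  have hS : ∀ x ∈ S, (I x).Nonempty ∧ ∑ u ∈ I x, G.dIn Finset.univ u ≤ (Zf x).card ∧
      G.HasPart (insert x (Zf x)) (I x).card := by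
    intro x hx
    rcases (hI x (hSR hx)).2.2.2 with h | h
    · exact h
    · exact absurd (Finset.mem_filter.1 hx).2 h.1
  have hT : ∀ x ∈ R, x ∉ S → (∀ u ∈ I x, ¬ G.Adj x u) ∧
      ∑ u ∈ I x, G.dIn Finset.univ u + G.dIn (Zf x) x ≤ (Zf x).card ∧
        G.dIn (Zf x) x ≤ (I x).card := by
    intro x hx hxS
    rcases (hI x hx).2.2.2 with h | h
    · exact absurd (Finset.mem_filter.2 ⟨hx, I x, (hI x hx).1, h.1, (hI x hx).2.1, h.2.1,
        (hI x hx).2.2.1, h.2.2⟩) hxS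
    · exact h.2
  have hZd : ∀ x ∈ R, ∀ y ∈ R, x ≠ y → Disjoint (Zf x) (Zf y) := by
    intro x hx y hy hxy
    rw [Finset.disjoint_left]
    intro z h1 h2
    exact hxy ((memZ.1 h1).2.2.symm.trans (memZ.1 h2).2.2)
  have hId : ∀ x ∈ R, ∀ y ∈ R, x ≠ y → Disjoint (I x) (I y) := fun x hx y hy hxy =>
    Finset.disjoint_of_subset_left (hI x hx).1
      (Finset.disjoint_of_subset_right (hI y hy).1 (hZd x hx y hy hxy))
  have hcross : ∀ x ∈ R, ∀ y ∈ R, x ≠ y → ∀ u ∈ Zf x, ¬ G.Adj y u := by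
    intro x hx y hy hxy u hu ha
    have := (hAt x hx).2 u hu y (fun h => notR hx h hy) ha.symm
    exact hxy this.symm
  have hdZ : ∀ y ∈ R, G.dIn (R.biUnion Zf) y = G.dIn (Zf y) y := by
    intro y hy
    refine le_antisymm (dIn_le_of_forall fun w hw ha => ?_)
      (dIn_mono (Finset.subset_biUnion_of_mem Zf hy) y)
    obtain ⟨x, hx, hwx⟩ := Finset.mem_biUnion.1 hw
    by_cases hxy : x = y
    · exact hxy ▸ hwx
    · exact absurd ha (hcross x hx y hy hxy w hwx)
  have hcardI : (R.biUnion I).card = ∑ x ∈ R, (I x).card := Finset.card_biUnion hId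
  have hsplit : ∀ f : V → ℕ, ∑ x ∈ R, f x = ∑ x ∈ S, f x + ∑ x ∈ R \ S, f x := fun f => by
    rw [add_comm, Finset.sum_sdiff hSR]
  refine ⟨R, S, R.biUnion Zf, R.biUnion I, hR.nonempty, ?_, ?_, hSR, hblock, ?_, ?_, ?_, ?_, ?_,
    ?_, hR.nbr⟩
  · ext z
    simp only [Finset.mem_union, Finset.mem_biUnion, memZ]
    constructor
    · rintro (h | ⟨x, hx, h⟩)
      exacts [hR.sub h, h.2.1]
    · intro hz
      by_cases hzR : z ∈ R
      · exact Or.inl hzR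
      · exact Or.inr ⟨φ z, hR.maps z hz, fun h => hzR (h ▸ hR.maps z hz), hz, rfl⟩
  · rw [Finset.disjoint_biUnion_right]
    intro x hx
    rw [Finset.disjoint_right]
    exact fun z hz => notR hx hz
  · intro S' hS'
    -- Absorbing a free vertex leaves the number of parts unchanged, so any subset of `S` may be
    -- absorbed independently.
    have h1 : S' ∪ R.biUnion Zf = R.biUnion fun x => if x ∈ S' then insert x (Zf x) else Zf x := by
      ext z
      simp only [Finset.mem_union, Finset.mem_biUnion]
      constructor
      · rintro (hz | ⟨x, hx, hz⟩)
        · exact ⟨z, hSR (hS' hz), by simp [hz]⟩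
        · refine ⟨x, hx, ?_⟩
          split_ifs
          exacts [Finset.mem_insert_of_mem hz, hz]
      · rintro ⟨x, hx, hz⟩
        split_ifs at hz with h
        · rcases Finset.mem_insert.1 hz with rfl | hz
          exacts [Or.inl h, Or.inr ⟨x, hx, hz⟩]
        · exact Or.inr ⟨x, hx, hz⟩
    rw [h1, hcardI]
    refine HasPart.biUnion _ _ _ (fun x hx => ?_) fun x hx y hy hxy => ?_
    · split_ifs with h
      exacts [(hS x (hS' h)).2.2, (hI x hx).2.2.1]
    · have key : ∀ x ∈ R, ∀ z ∈ (if x ∈ S' then insert x (Zf x) else Zf x), φ z = x := by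
        intro x hx z hz
        split_ifs at hz
        · rcases Finset.mem_insert.1 hz with rfl | hz
          exacts [hR.fix z hx, (memZ.1 hz).2.2]
        · exact (memZ.1 hz).2.2
      rw [Finset.disjoint_left]
      exact fun z h1 h2 => hxy ((key x hx z h1).symm.trans (key y hy z h2))
  · intro u hu v hv ha
    obtain ⟨x, hx, hux⟩ := Finset.mem_biUnion.1 hu
    obtain ⟨y, hy, hvy⟩ := Finset.mem_biUnion.1 hv
    by_cases hxy : x = y
    · subst hxy
      exact (hI x hx).2.1 u hux v hvy ha
    · have hux' := (hI x hx).1 hux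
      have hvy' := (hI y hy).1 hvy
      have := (hAt x hx).2 u hux' v
        (fun h => Finset.disjoint_left.1 (hZd x hx y hy hxy) h hvy') ha
      exact notR hy hvy' (this ▸ hx)
  · exact Finset.biUnion_mono fun x hx => (hI x hx).1
  · intro y hy hyS u hu
    obtain ⟨x, hx, hux⟩ := Finset.mem_biUnion.1 hu
    by_cases hxy : x = y
    · subst hxy
      exact (hT x hx hyS).1 u hux
    · exact hcross x hx y hy hxy u ((hI x hx).1 hux)
  · rw [Finset.sum_biUnion hId, Finset.card_biUnion hZd, hsplit, hsplit fun x => (Zf x).card,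
      add_assoc, ← Finset.sum_add_distrib]
    refine add_le_add (Finset.sum_le_sum fun x hx => (hS x hx).2.1) (Finset.sum_le_sum fun x hx => ?_)
    rw [Finset.mem_sdiff] at hx
    rw [hdZ x hx.1]
    exact (hT x hx.1 hx.2).2.1
  -- The summand |S| comes from the nonemptiness of the independent sets of free pieces.
  · rw [hcardI, hsplit, Finset.card_eq_sum_ones]
    refine add_le_add (Finset.sum_le_sum fun x hx => Finset.card_pos.2 (hS x hx).1)
      (Finset.sum_le_sum fun x hx => ?_)
    rw [Finset.mem_sdiff] at hx
    rw [hdZ x hx.1]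
    exact (hT x hx.1 hx.2).2.2

end FreeClosed

/-! ### Every piece is free or closed, or calls for induction -/

section Needy

variable {V : Type u} [Fintype V] [DecidableEq V] {G : SimpleGraph V}

/-- A piece `D` at `c` that has, together with `c`, a `2`-proper partition, and contains an
independent set larger than the number of parts. -/
def Surplus (G : SimpleGraph V) (c : V) (D : Finset V) : Prop :=
  ∃ I ⊆ D, G.Indep I ∧ (∃ k, G.HasPart (insert c D) k ∧ k + 1 ≤ I.card) ∧
    ∑ u ∈ I, G.dIn Finset.univ u + 1 ≤ D.card + I.card ∧
    ∃ y ∈ D, ∃ y' ∈ D, G.dIn Finset.univ y + G.dIn Finset.univ y' ≤ D.card + 1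

/-- The piece `D` consists of two vertices that form a triangle with `c`. -/
def TrianglePiece (G : SimpleGraph V) (c : V) (D : Finset V) : Prop :=
  ∃ y y', D = {y, y'} ∧ G.Adj y y' ∧ G.Adj c y ∧ G.Adj c y'

/-- A piece whose complement can only be treated by induction. -/
def Needy (G : SimpleGraph V) (c : V) (D : Finset V) : Prop :=
  G.Attach c D ∧ (∃ v, v ∉ insert c D) ∧ (G.Surplus c D ∨ G.TrianglePiece c D)

lemma Decomp.dIn_le {c : V} {D R S Z I : Finset V} (h : G.Decomp c D R S Z I)
    (hat : G.Attach c D) {y : V} (hy : y ∈ R) :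
    G.dIn Finset.univ y ≤ G.dIn (insert c R) y + G.dIn Z y := by
  have hyD : y ∈ D := by rw [← h.union]; exact Finset.mem_union_left _ hy
  have hd : Disjoint (insert c R) Z := Finset.disjoint_insert_left.2 ⟨fun hc => hat.1 (by
    rw [← h.union]; exact Finset.mem_union_right _ hc), h.disj⟩
  rw [← dIn_union_of_disjoint hd]
  refine dIn_le_of_forall fun w _ ha => ?_
  rw [Finset.insert_union, h.union]
  by_cases hw : w ∈ D
  · exact Finset.mem_insert_of_mem hw
  · rw [hat.2 y hyD w hw ha]
    exact Finset.mem_insert_self _ _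

lemma dIn_outside_le {c : V} {D : Finset V} (hat : G.Attach c D) {v : V} (hv : v ∉ insert c D) :
    G.dIn Finset.univ v + D.card + 1 ≤ Fintype.card V := by
  have h1 : G.dIn Finset.univ v ≤ ((Finset.univ \ D).erase v).card :=
    dIn_le_card_of_forall fun w _ ha => by
      rw [Finset.mem_erase, Finset.mem_sdiff]
      refine ⟨ha.ne', Finset.mem_univ _, fun hw => hv ?_⟩
      rw [hat.2 w hw v (fun h => hv (Finset.mem_insert_of_mem h)) ha.symm]
      exact Finset.mem_insert_self _ _
  have hvD : v ∈ Finset.univ \ D :=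
    Finset.mem_sdiff.2 ⟨Finset.mem_univ _, fun h => hv (Finset.mem_insert_of_mem h)⟩
  rw [Finset.card_erase_of_mem hvD, Finset.card_sdiff_of_subset (Finset.subset_univ _),
    Finset.card_univ] at h1
  have h2 := Finset.card_pos.2 ⟨v, hvD⟩
  rw [Finset.card_sdiff_of_subset (Finset.subset_univ _), Finset.card_univ] at h2
  omega

lemma Attach.not_adj {c : V} {D : Finset V} (hat : G.Attach c D) {u v : V} (hu : u ∈ D)
    (hv : v ∉ insert c D) : ¬ G.Adj u v := fun ha => hv (by
  rw [hat.2 u hu v (fun h => hv (Finset.mem_insert_of_mem h)) ha]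
  exact Finset.mem_insert_self _ _)

/-- Many vertices not adjacent to a vertex of small degree have a large degree sum. -/
lemma mul_sum_ge (hG : G.ProductCond) {y : V} {J : Finset V}
    (hJ : ∀ u ∈ J, u ≠ y ∧ ¬ G.Adj y u) :
    J.card * (Fintype.card V - G.dIn Finset.univ y) ≤
      G.dIn Finset.univ y * ∑ u ∈ J, G.dIn Finset.univ u := by
  rw [Finset.mul_sum, ← smul_eq_mul]
  refine Finset.card_nsmul_le_sum _ _ _ fun u hu => ?_
  have := hG y u y (hJ u hu).1.symm (hJ u hu).2
  omega

lemma Decomp.nadj_ne {c : V} {D R S Z I : Finset V} (h : G.Decomp c D R S Z I)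
    (hat : G.Attach c D) {y v : V} (hy : y ∈ R) (hyS : y ∉ S) (hv : v ∉ insert c D) :
    ∀ u ∈ insert v I, u ≠ y ∧ ¬ G.Adj y u := by
  have hyD : y ∈ D := by rw [← h.union]; exact Finset.mem_union_left _ hy
  intro u hu
  rcases Finset.mem_insert.1 hu with rfl | hu
  · refine ⟨?_, hat.not_adj hyD hv⟩
    rintro rfl
    exact hv (Finset.mem_insert_of_mem hyD)
  · refine ⟨?_, h.nadj y hy hyS u hu⟩
    rintro rfl
    exact Finset.disjoint_left.1 h.disj hy (h.subI hu)

lemma Decomp.card_insert {c : V} {D R S Z I : Finset V} (h : G.Decomp c D R S Z I)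
    {v : V} (hv : v ∉ insert c D) : v ∉ I := fun hI => hv (Finset.mem_insert_of_mem (by
  rw [← h.union]; exact Finset.mem_union_right _ (h.subI hI)))

lemma Decomp.card_eq {c : V} {D R S Z I : Finset V} (h : G.Decomp c D R S Z I) :
    R.card + Z.card = D.card := by
  rw [← h.union, Finset.card_union_of_disjoint h.disj]

/-- The degree d of `y` is at most 1 + |S| + d_Z(y) ≤ |I| + 1, and `y` is nonadjacent to the |I| + 1
vertices of I ∪ {v}. By `mul_sum_ge` their degree sum is at least n - d, whereas the bounds on `Z`
and on the outside vertex `v` keep it below that. -/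
lemma Decomp.false_of_singleton (hG : G.ProductCond) {c : V} {D R S Z I : Finset V}
    (h : G.Decomp c D R S Z I) (hat : G.Attach c D) {y v : V} (hT : R \ S = {y})
    (hv : v ∉ insert c D) (hd : G.dIn (insert c R) y ≤ 1 + S.card) : False := by
  have hy : y ∈ R \ S := by rw [hT]; exact Finset.mem_singleton_self y
  rw [Finset.mem_sdiff] at hy
  have h1 := h.dIn_le hat hy.1
  have h2 := mul_sum_ge hG (h.nadj_ne hat hy.1 hy.2 hv)
  have h3 := dIn_outside_le hat hv
  have h4 := h.sum
  have h5 := h.card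
  have h6 := h.card_eq
  have h7 := Finset.card_sdiff_of_subset h.sub
  rw [hT, Finset.sum_singleton] at h4 h5
  rw [hT, Finset.card_singleton] at h7
  rw [Finset.card_insert_of_notMem (h.card_insert hv),
    Finset.sum_insert (h.card_insert hv)] at h2
  have h8 := Finset.card_le_card h.sub
  generalize G.dIn Finset.univ y = d at *
  have h9 : d * (Fintype.card V - d) ≤ (I.card + 1) * (Fintype.card V - d) :=
    Nat.mul_le_mul_right _ (by omega)
  have h10 := h9.trans h2
  have hd0 : d ≠ 0 := by
    rintro rfl
    have := h2
    have : Fintype.card V = 0 := by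
      rw [zero_mul, Nat.le_zero, mul_eq_zero] at h2
      omega
    rw [Fintype.card_eq_zero_iff] at this
    exact this.elim v
  have := Nat.le_of_mul_le_mul_left h10 (Nat.pos_of_ne_zero hd0)
  omega

/-- The vertices `y` and `y'` share no neighbour in `S`, which bounds the sum of their degrees by 4
+ |I|. If `I` were nonempty, the smaller degree would be at most |I| + 1, and the count used for a
single vertex would give a contradiction. -/
lemma Decomp.eq_pair (hG : G.ProductCond) (h2 : ∀ v, 2 ≤ G.dIn Finset.univ v)
    {c : V} {D R S Z I : Finset V}
    (h : G.Decomp c D R S Z I) (hat : G.Attach c D) {y y' v : V} (hT : R \ S = {y, y'})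
    (hyy : G.Adj y y') (hv : v ∉ insert c D)
    (hS : ∀ s ∈ S, ¬ (G.Adj y s ∧ G.Adj y' s)) : D = {y, y'} := by
  wlog hle : G.dIn Finset.univ y ≤ G.dIn Finset.univ y' generalizing y y'
  · rw [Finset.pair_comm]
    exact this (by rw [hT, Finset.pair_comm]) hyy.symm (fun s hs h' => hS s hs h'.symm) (by omega)
  have hy : y ∈ R \ S := by rw [hT]; simp
  have hy' : y' ∈ R \ S := by rw [hT]; simp
  rw [Finset.mem_sdiff] at hy hy'
  have a1 := h.dIn_le hat hy.1
  have a2 := h.dIn_le hat hy'.1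
  have hRS : R = {y, y'} ∪ S := by rw [← hT, Finset.sdiff_union_of_subset h.sub]
  have hdS : G.dIn S y + G.dIn S y' ≤ S.card := by
    have hdis : Disjoint (G.nbrIn S y) (G.nbrIn S y') := by
      rw [Finset.disjoint_left]
      intro s h1 h2
      rw [mem_nbrIn] at h1 h2
      exact hS s h1.1 ⟨h1.2, h2.2⟩
    unfold dIn
    rw [← Finset.card_union_of_disjoint hdis]
    refine Finset.card_le_card fun s hs => ?_
    rw [Finset.mem_union, mem_nbrIn, mem_nbrIn] at hs
    rcases hs with hs | hs <;> exact hs.1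
  have hdis : Disjoint ({y, y'} : Finset V) S := by rw [← hT]; exact Finset.sdiff_disjoint
  have b1 : G.dIn (insert c R) y ≤ 2 + G.dIn S y := by
    have := dIn_insert_le (G := G) R c y
    rw [hRS, dIn_union_of_disjoint hdis, ← hRS] at this
    have h' := dIn_add_one_le_card (G := G) (s := {y, y'}) (v := y) (by simp)
    rw [Finset.card_pair hyy.ne] at h'
    omega
  have b2 : G.dIn (insert c R) y' ≤ 2 + G.dIn S y' := by
    have := dIn_insert_le (G := G) R c y'
    rw [hRS, dIn_union_of_disjoint hdis, ← hRS] at this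
    have h' := dIn_add_one_le_card (G := G) (s := {y, y'}) (v := y') (by simp)
    rw [Finset.card_pair hyy.ne] at h'
    omega
  have a3 := mul_sum_ge hG (h.nadj_ne hat hy.1 hy.2 hv)
  have a4 := dIn_outside_le hat hv
  have a5 := h.sum
  have a6 := h.card
  have a7 := h.card_eq
  have a8 : R.card = 2 + S.card := by
    rw [hRS, Finset.card_union_of_disjoint hdis, Finset.card_pair hyy.ne]
  rw [hT, Finset.sum_pair hyy.ne] at a5 a6
  rw [Finset.card_insert_of_notMem (h.card_insert hv),
    Finset.sum_insert (h.card_insert hv)] at a3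
  have hd2 := h2 y
  -- For d ≤ |I| + 1 the product condition gives n - d ≤ s, against s + 3 + |S| + d_Z(y) + d_Z(y') ≤
  -- n. Otherwise d, d' ≥ |I| + 2, so 2|I| + 4 ≤ |I| + 4.
  have key : I.card = 0 := by
    generalize G.dIn Finset.univ y = d at *
    generalize G.dIn Finset.univ y' = d' at *
    generalize hn : Fintype.card V = n at *
    have hI : d + d' ≤ 4 + I.card := by omega
    generalize hS : G.dIn Finset.univ v + ∑ x ∈ I, G.dIn Finset.univ x = s at *
    have hs : s + 3 + (S.card + (G.dIn Z y + G.dIn Z y')) ≤ n := by omega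
    by_cases hd : d ≤ I.card + 1
    · have := (Nat.mul_le_mul_right (n - d) hd).trans a3
      have := Nat.le_of_mul_le_mul_left this (by omega)
      omega
    · omega
  have hI0 : I = ∅ := Finset.card_eq_zero.1 key
  have hZ : Z = ∅ := by
    have := h.part ∅ (Finset.empty_subset _)
    rw [key, Finset.empty_union] at this
    exact this.eq_empty
  have hS0 : S = ∅ := Finset.card_eq_zero.1 (by omega)
  rw [← h.union, hZ, hRS, hS0, Finset.union_empty, Finset.union_empty]

lemma Decomp.cases (hG : G.ProductCond) (h2 : ∀ v, 2 ≤ G.dIn Finset.univ v)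
    {c : V} {D R S Z I : Finset V} (h : G.Decomp c D R S Z I) (hat : G.Attach c D) :
    G.FreePiece c D ∨ G.ClosedPiece c D ∨ G.Good ∨ G.Needy c D := by
  have hcard := h.card_eq
  have hRD : R ⊆ D := by rw [← h.union]; exact Finset.subset_union_left
  have hZD : Z ⊆ D := by rw [← h.union]; exact Finset.subset_union_right
  have hcR : c ∉ R := fun hc => hat.1 (hRD hc)
  -- All of `R` is absorbed from below, hence `D` is closed: the neighbours of `c` in `D` lie in `R
  -- = S`, so their number is at most |I|, and |D| = |R| + |Z| leaves room for them in the degree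
  -- bound.
  by_cases hRS : R ⊆ S
  · refine Or.inr (Or.inl ⟨I, h.subI.trans hZD, h.indep, fun u hu ha => ?_, ?_, ?_, ?_⟩)
    · exact Finset.disjoint_left.1 h.disj (h.nbr u (hZD (h.subI hu)) ha) (h.subI hu)
    · have h1 := h.sum
      have h3 : G.dIn D c ≤ R.card := dIn_le_card_of_forall h.nbr
      omega
    · have h3 : G.dIn D c ≤ S.card := dIn_le_card_of_forall fun w hw ha => hRS (h.nbr w hw ha)
      have := h.card
      omega
    · have := h.part S subset_rfl
      rwa [h.sub.antisymm hRS, h.union] at this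
  obtain ⟨y₀, hy₀R, hy₀S⟩ := Finset.not_subset.1 hRS
  have hpartZ : G.HasPart Z I.card := by
    simpa using h.part ∅ (Finset.empty_subset _)
  -- The degree of `y` is at most |R| + d_Z(y), and the bound on `I` reserves d_Z(y); so one more
  -- vertex of R \ S always fits.
  have hlight : ∀ y ∈ R, y ∉ S → y ∉ I ∧ G.Indep (insert y I) ∧
      ∑ u ∈ insert y I, G.dIn Finset.univ u ≤ D.card := by
    intro y hy hyS
    have hyI : y ∉ I := fun hI => Finset.disjoint_left.1 h.disj hy (h.subI hI)
    refine ⟨hyI, h.indep.insert (h.nadj y hy hyS), ?_⟩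
    rw [Finset.sum_insert hyI]
    have h1 := h.dIn_le hat hy
    have h3 := h.sum
    have h4 := dIn_add_one_le_card (G := G) (Finset.mem_insert_of_mem (b := c) hy)
    rw [Finset.card_insert_of_notMem hcR] at h4
    have h5 : G.dIn Z y ≤ ∑ y ∈ R \ S, G.dIn Z y :=
      Finset.single_le_sum (f := fun y => G.dIn Z y) (fun _ _ => Nat.zero_le _)
        (Finset.mem_sdiff.2 ⟨hy, hyS⟩)
    omega
  have hsubI : ∀ y ∈ R, insert y I ⊆ D := fun y hy =>
    Finset.insert_subset (hRD hy) (h.subI.trans hZD)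
  rcases h.block with hblock | ⟨x, rfl⟩
  swap
  · have hS : S = ∅ := by
      rcases Finset.subset_singleton_iff.1 h.sub with hS | hS
      · exact hS
      · exact absurd hS.ge hRS
    subst hS
    obtain ⟨v, hv⟩ : ∃ v, v ∉ insert c D := by
      by_contra hcon
      push Not at hcon
      have h3 : G.dIn Finset.univ c ≤ ({x} : Finset V).card :=
        dIn_le_card_of_forall fun w _ ha => by
          rcases Finset.mem_insert.1 (hcon w) with rfl | hw
          · exact absurd rfl ha.ne
          · exact h.nbr w hw ha
      have := h2 c
      simp at h3
      omega
    refine (h.false_of_singleton hG hat (y := x) (by simp) hv ?_).elim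
    have h3 := dIn_add_one_le_card (G := G) (s := insert c {x}) (v := x) (by simp)
    have := Finset.card_insert_le c {x}
    simp at this ⊢
    omega
  have hpart : G.HasPart (insert c D) (I.card + 1) := by
    have := hblock.hasPart.union_part hpartZ (Finset.disjoint_insert_left.2
      ⟨fun hc => hat.1 (hZD hc), h.disj⟩)
    rwa [Finset.insert_union, h.union, add_comm] at this
  -- Here R \ S' serves as one further part, paid for by `y₀`. The vertex `c` can be absorbed by
  -- using the whole block as that part instead.
  by_cases hfree : ∃ S' ⊆ S, G.TwoConn (R \ S')
  · obtain ⟨S', hS', htc⟩ := hfree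
    obtain ⟨hyI, hind, hsum⟩ := hlight y₀ hy₀R hy₀S
    refine Or.inl ⟨insert y₀ I, hsubI _ hy₀R, Finset.insert_nonempty _ _, hind, hsum, ?_, ?_⟩
    · have := htc.hasPart.union_part (h.part S' hS') (by
        rw [Finset.disjoint_union_right]
        exact ⟨Finset.sdiff_disjoint, Finset.disjoint_of_subset_left Finset.sdiff_subset h.disj⟩)
      rw [← Finset.union_assoc, Finset.sdiff_union_of_subset (hS'.trans h.sub), h.union,
        add_comm] at this
      rwa [Finset.card_insert_of_notMem hyI]
    · rwa [Finset.card_insert_of_notMem hyI]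
  push Not at hfree
  refine Or.inr (Or.inr ?_)
  by_cases huniv : ∃ v, v ∉ insert c D
  swap
  · push Not at huniv
    have huniv' : insert c D = Finset.univ := Finset.eq_univ_iff_forall.2 huniv
    obtain ⟨hyI, hind, hsum⟩ := hlight y₀ hy₀R hy₀S
    refine Or.inl ⟨insert y₀ I, hind, ?_, I.card + 1, ?_, huniv' ▸ hpart⟩
    · have hn : Fintype.card V = D.card + 1 := by
        rw [← Finset.card_insert_of_notMem hat.1, huniv', Finset.card_univ]
      omega
    · rw [Finset.card_insert_of_notMem hyI]
  refine Or.inr ⟨hat, huniv, ?_⟩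
  obtain ⟨v, hv⟩ := huniv
  have hTcard := Finset.card_sdiff_of_subset h.sub
  have hSR := Finset.card_le_card h.sub
  by_cases hT1 : (R \ S).card = 1
  · obtain ⟨y, hy⟩ := Finset.card_eq_one.1 hT1
    refine (h.false_of_singleton hG hat hy hv ?_).elim
    have hyR : y ∈ R := (Finset.mem_sdiff.1 (hy ▸ Finset.mem_singleton_self y)).1
    have := dIn_add_one_le_card (G := G) (Finset.mem_insert_of_mem (b := c) hyR)
    rw [Finset.card_insert_of_notMem hcR] at this
    omega
  have hT2 : 2 ≤ (R \ S).card := by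
    have := Finset.card_pos.2 ⟨y₀, Finset.mem_sdiff.2 ⟨hy₀R, hy₀S⟩⟩
    omega
  by_cases he : ∃ y y', R \ S = {y, y'} ∧ G.Adj y y'
  · obtain ⟨y, y', hT, hyy⟩ := he
    -- A common neighbour `s ∈ S` would complete a triangle R \ (S \ {s}), contradicting `hfree`.
    have hD : D = {y, y'} := by
      refine h.eq_pair hG h2 hat hT hyy hv fun s hs ⟨h3, h4⟩ => ?_
      refine hfree (S.erase s) (Finset.erase_subset _ _) ?_
      have : R \ S.erase s = {y, y', s} := by
        ext w
        have := Finset.ext_iff.1 hT w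
        simp only [Finset.mem_sdiff, Finset.mem_erase, Finset.mem_insert,
          Finset.mem_singleton] at this ⊢
        have hsR := h.sub hs
        constructor
        · rintro ⟨hw, hw'⟩
          by_cases hws : w = s
          · exact Or.inr (Or.inr hws)
          · have := this.1 ⟨hw, fun h => hw' ⟨hws, h⟩⟩
            tauto
        · rintro (hw | hw | rfl)
          · exact ⟨(this.2 (Or.inl hw)).1, fun h => (this.2 (Or.inl hw)).2 h.2⟩
          · exact ⟨(this.2 (Or.inr hw)).1, fun h => (this.2 (Or.inr hw)).2 h.2⟩
          · exact ⟨hsR, fun h => h.1 rfl⟩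
      rw [this]
      exact twoConn_triangle hyy h3 h4
    refine Or.inr ⟨y, y', hD, hyy, ?_⟩
    have key : ∀ z z', D = {z, z'} → G.Adj c z := by
      intro z z' hz
      by_contra hcz
      have h3 : G.dIn Finset.univ z ≤ ({z'} : Finset V).card :=
        dIn_le_card_of_forall fun w _ ha => by
          by_cases hw : w ∈ D
          · rw [hz] at hw
            simp only [Finset.mem_insert, Finset.mem_singleton] at hw ⊢
            exact hw.resolve_left ha.ne'
          · rw [hat.2 z (by rw [hz]; simp) w hw ha] at ha
            exact absurd ha.symm hcz
      have := h2 z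
      simp at h3
      omega
    exact ⟨key y y' hD, key y' y (by rw [hD, Finset.pair_comm])⟩
  · push Not at he
    obtain ⟨y, hy, y', hy', hne, hna, hdeg⟩ :=
      exists_separated_pair hT2 (hfree S subset_rfl) he
    rw [Finset.mem_sdiff] at hy hy'
    have hsplit : ∀ w, G.dIn (insert c R) w ≤ G.dIn (R \ S) w + S.card + 1 := fun w => by
      have h3 := dIn_insert_le (G := G) R c w
      have h4 := dIn_union_of_disjoint (G := G) (Finset.sdiff_disjoint (s := S) (t := R)) w
      rw [Finset.sdiff_union_of_subset h.sub] at h4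
      have := dIn_le_card (G := G) S w
      omega
    have h3 := h.dIn_le hat hy.1
    have h4 := h.dIn_le hat hy'.1
    have h5 := hsplit y
    have h6 := hsplit y'
    have h7 : G.dIn Z y + G.dIn Z y' ≤ ∑ y ∈ R \ S, G.dIn Z y := by
      rw [← Finset.sum_pair hne]
      refine Finset.sum_le_sum_of_subset fun w hw => ?_
      rw [Finset.mem_sdiff]
      rcases Finset.mem_insert.1 hw with rfl | hw
      · exact hy
      · rw [Finset.mem_singleton.1 hw]
        exact hy'
    have h8 := h.sum
    have h9 := h.card
    -- The count gives d(y) + d(y') plus the degree sum of `I` at most |D| + |S| + 1. As |S| ≤ |I|,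
    -- this bounds both the degree sum of the enlarged set and d(y) + d(y') itself.
    have h10 : I.card ≤ ∑ u ∈ I, G.dIn Finset.univ u := by
      rw [Finset.card_eq_sum_ones]
      exact Finset.sum_le_sum fun u _ => by have := h2 u; omega
    obtain ⟨hy'I, hind', -⟩ := hlight y' hy'.1 hy'.2
    have hyI : y ∉ insert y' I := by
      rw [Finset.mem_insert, not_or]
      exact ⟨hne, (hlight y hy.1 hy.2).1⟩
    refine Or.inl ⟨insert y (insert y' I), Finset.insert_subset (hRD hy.1) (hsubI _ hy'.1),
      hind'.insert fun u hu => ?_, ⟨_, hpart, ?_⟩, ?_, y, hRD hy.1, y', hRD hy'.1, ?_⟩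
    · rcases Finset.mem_insert.1 hu with rfl | hu
      · exact hna
      · exact h.nadj y hy.1 hy.2 u hu
    · rw [Finset.card_insert_of_notMem hyI, Finset.card_insert_of_notMem hy'I]
    · rw [Finset.card_insert_of_notMem hyI, Finset.card_insert_of_notMem hy'I,
        Finset.sum_insert hyI, Finset.sum_insert hy'I]
      omega
    · omega

/-- Every piece is free or closed, unless some piece has a complement to be treated by
induction. -/
lemma piece_cases (hG : G.ProductCond) (h2 : ∀ v, 2 ≤ G.dIn Finset.univ v)
    (hg : ¬ G.Good) (hn : ∀ c D, ¬ G.Needy c D) (D : Finset V) :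
    ∀ c, G.Attach c D → G.FreePiece c D ∨ G.ClosedPiece c D := by
  induction D using Finset.strongInduction with
  | H D ih =>
    intro c hat
    rcases D.eq_empty_or_nonempty with rfl | hne
    · exact Or.inr (closed_empty c)
    by_cases hD : G.Conn D
    swap
    · obtain ⟨A, hA, hA1, hA2, hno⟩ := not_conn hne hD
      have hdis : Disjoint A (D \ A) := Finset.disjoint_sdiff
      have hAtA : G.Attach c A := ⟨fun h => hat.1 (hA h), fun u hu v hv ha => by
        by_cases hvD : v ∈ D
        · exact absurd ha (hno u hu v (Finset.mem_sdiff.2 ⟨hvD, hv⟩))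
        · exact hat.2 u (hA hu) v hvD ha⟩
      have hAtB : G.Attach c (D \ A) := ⟨fun h => hat.1 (Finset.sdiff_subset h),
        fun u hu v hv ha => by
        by_cases hvD : v ∈ D
        · have hvA : v ∈ A := by
            by_contra hvA
            exact hv (Finset.mem_sdiff.2 ⟨hvD, hvA⟩)
          exact absurd ha.symm (hno v hvA u hu)
        · exact hat.2 u (Finset.sdiff_subset hu) v hvD ha⟩
      have hssA : A ⊂ D := ⟨hA, fun h => by
        rw [Finset.sdiff_nonempty] at hA2
        exact hA2 h⟩
      have hssB : D \ A ⊂ D := Finset.sdiff_ssubset hA hA1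
      have h1 := ih A hssA c hAtA
      have h3 := ih (D \ A) hssB c hAtB
      have hno' : ∀ u ∈ D \ A, ∀ v ∈ A, ¬ G.Adj u v := fun u hu v hv ha => hno v hv u hu ha.symm
      have hU : A ∪ D \ A = D := Finset.union_sdiff_of_subset hA
      have hU' : D \ A ∪ A = D := Finset.sdiff_union_of_subset hA
      rcases h1 with h1 | h1
      · exact Or.inl (hU ▸ h1.union h3 hdis hAtB.1 hno)
      · rcases h3 with h3 | h3
        · exact Or.inl (hU' ▸ h3.union (Or.inr h1) hdis.symm hAtA.1 hno')
        · exact Or.inr (hU ▸ h1.union h3 hdis hno)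
    by_cases hcD : ∃ u ∈ D, G.Adj c u
    · obtain ⟨R, S, Z, I, h⟩ := exists_decomp hat hD hcD fun x E hE => ih E hE x
      rcases h.cases hG h2 hat with h | h | h | h
      exacts [Or.inl h, Or.inr h, absurd h hg, absurd h (hn c D)]
    · push Not at hcD
      have hd0 : G.dIn D c = 0 := dIn_eq_zero hcD
      obtain ⟨x, hx⟩ := hne
      have hclosed : ∀ u ∈ D, ∀ v, v ∉ D → ¬ G.Adj u v := fun u hu v hv ha => by
        have := hat.2 u hu v hv ha
        subst this
        exact hcD u hu ha.symm
      have hcard := Finset.card_erase_add_one hx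
      have hAt : G.Attach x (D.erase x) := ⟨Finset.notMem_erase x D, fun u hu v hv ha => by
        by_contra hvx
        exact hclosed u (Finset.mem_of_mem_erase hu) v
          (fun h => hv (Finset.mem_erase.2 ⟨hvx, h⟩)) ha⟩
      -- No edge joins `c` to `D`, so `D` is a union of components; reroot it at `x`. If D - x is
      -- free, it absorbs `x` and `D` is closed. It cannot be closed, since then at least d(x)
      -- vertices not adjacent to `x` would have degree sum less than n - d(x).
      rcases ih _ (Finset.erase_ssubset hx) x hAt with
        ⟨I, hI, hI0, hind, hsum, hp, hpx⟩ | ⟨I, hI, hind, hna, hsum, hle, hp⟩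
      · rw [Finset.insert_erase hx] at hpx
        exact Or.inr ⟨I, hI.trans (Finset.erase_subset _ _), hind,
          fun u hu => hcD u (Finset.mem_of_mem_erase (hI hu)), by omega, by omega, hpx⟩
      · exfalso
        have h1 : G.dIn Finset.univ x ≤ G.dIn (D.erase x) x :=
          dIn_le_of_forall fun w _ ha => Finset.mem_erase.2 ⟨ha.ne', by
            by_contra hw
            exact hclosed x hx w hw ha⟩
        have h3 := mul_sum_ge hG (y := x) (J := I) fun u hu =>
          ⟨Finset.ne_of_mem_erase (hI hu), hna u hu⟩
        have h4 := h2 x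
        have h5 := Finset.card_le_univ D
        have h6 := (Nat.mul_le_mul_right (Fintype.card V - G.dIn Finset.univ x)
          (h1.trans hle)).trans h3
        have := Nat.le_of_mul_le_mul_left h6 (by omega)
        omega

/-- The complement of any vertex `c` is a piece at `c`. If free, it yields the partition; if closed,
its independent set violates the product condition at `c`. -/
lemma good_or_needy (hG : G.ProductCond) (h2 : ∀ v, 2 ≤ G.dIn Finset.univ v) [Nonempty V] :
    G.Good ∨ ∃ c D, G.Needy c D := by
  by_contra hcon
  push Not at hcon
  obtain ⟨c⟩ := ‹Nonempty V›
  have hcard := Finset.card_erase_add_one (Finset.mem_univ c)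
  rw [Finset.card_univ] at hcard
  rcases piece_cases hG h2 hcon.1 hcon.2 (Finset.univ.erase c) c
    ⟨Finset.notMem_erase c _, fun u _ v hv _ => by simpa using hv⟩ with
    ⟨I, hI, hI0, hind, hsum, hp, hpx⟩ | ⟨I, hI, hind, hna, hsum, hle, hp⟩
  · rw [Finset.insert_erase (Finset.mem_univ c)] at hpx
    exact hcon.1 ⟨I, hind, by omega, _, le_rfl, hpx⟩
  · have h1 : G.dIn Finset.univ c ≤ G.dIn (Finset.univ.erase c) c :=
      dIn_le_of_forall fun w hw ha => Finset.mem_erase.2 ⟨ha.ne', hw⟩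
    have h3 := mul_sum_ge hG (y := c) (J := I) fun u hu =>
      ⟨Finset.ne_of_mem_erase (hI hu), hna u hu⟩
    have h4 := h2 c
    have h6 := (Nat.mul_le_mul_right (Fintype.card V - G.dIn Finset.univ c)
      (h1.trans hle)).trans h3
    have := Nat.le_of_mul_le_mul_left h6 (by omega)
    omega

end Needy

/-! ### Transfer along embeddings -/

section Transfer

variable {V : Type u} {W : Type*} [DecidableEq V] [DecidableEq W] {G : SimpleGraph V} (f : W ↪ V)

lemma dIn_comap (s : Finset W) (w : W) : (G.comap f).dIn s w = G.dIn (s.map f) (f w) := by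
  unfold dIn
  rw [← Finset.card_map f]
  congr 1
  ext x
  simp only [Finset.mem_map, mem_nbrIn, comap_adj]
  constructor
  · rintro ⟨y, ⟨hy, ha⟩, rfl⟩
    exact ⟨⟨y, hy, rfl⟩, ha⟩
  · rintro ⟨⟨y, hy, rfl⟩, ha⟩
    exact ⟨y, ⟨hy, ha⟩, rfl⟩

lemma conn_comap (s : Finset W) : (G.comap f).Conn s ↔ G.Conn (s.map f) := by
  constructor
  · rintro ⟨hne, h⟩
    refine ⟨hne.map, fun A hA hA0 hAs => ?_⟩
    obtain ⟨B, hB, rfl⟩ := Finset.subset_map_iff.1 hA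
    rw [Finset.map_nonempty] at hA0
    obtain ⟨u, hu, v, hv, hvB, ha⟩ := h B hB hA0 fun h' => hAs (h' ▸ rfl)
    exact ⟨f u, Finset.mem_map_of_mem f hu, f v, Finset.mem_map_of_mem f hv,
      fun h' => hvB ((Finset.mem_map' f).1 h'), ha⟩
  · rintro ⟨hne, h⟩
    refine ⟨Finset.map_nonempty.1 hne, fun A hA hA0 hAs => ?_⟩
    obtain ⟨x, hx, y, hy, hyA, ha⟩ := h (A.map f) (Finset.map_subset_map.2 hA) hA0.map
      fun h' => hAs (Finset.map_injective f h')
    obtain ⟨u, hu, rfl⟩ := Finset.mem_map.1 hx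
    obtain ⟨v, hv, rfl⟩ := Finset.mem_map.1 hy
    exact ⟨u, hu, v, hv, fun h' => hyA (Finset.mem_map_of_mem f h'), ha⟩

lemma twoConn_comap (s : Finset W) : (G.comap f).TwoConn s ↔ G.TwoConn (s.map f) := by
  unfold TwoConn
  rw [Finset.card_map, conn_comap]
  refine and_congr_right fun _ => and_congr_right fun _ => ?_
  constructor
  · intro h x hx
    obtain ⟨y, hy, rfl⟩ := Finset.mem_map.1 hx
    have := (conn_comap f _).1 (h y hy)
    rwa [Finset.map_erase] at this
  · intro h x hx
    rw [conn_comap, Finset.map_erase]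
    exact h _ (Finset.mem_map_of_mem f hx)

lemma HasPart.map {s : Finset W} {k : ℕ} (h : (G.comap f).HasPart s k) :
    G.HasPart (s.map f) k := by
  induction h with
  | empty => simpa using HasPart.empty
  | union hp _ hd ih =>
    rw [Finset.map_union]
    exact HasPart.union ((twoConn_comap f _).1 hp) ih ((Finset.disjoint_map f).2 hd)

lemma Indep.map {s : Finset W} (h : (G.comap f).Indep s) : G.Indep (s.map f) := by
  intro x hx y hy ha
  obtain ⟨u, hu, rfl⟩ := Finset.mem_map.1 hx
  obtain ⟨v, hv, rfl⟩ := Finset.mem_map.1 hy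
  exact h u hu v hv ha

end Transfer

/-! ### Deleting a piece together with its attachment vertex -/

section Rest

variable {V W : Type u} [Fintype V] [DecidableEq V] [Fintype W] [DecidableEq W]
  {G : SimpleGraph V} {f : W ↪ V} {c : V} {D : Finset V}

/-- `f` identifies `W` with the complement of `D ∪ {c}`. -/
def IsRest (f : W ↪ V) (c : V) (D : Finset V) : Prop :=
  c ∉ D ∧ Finset.univ.map f = (insert c D)ᶜ

lemma IsRest.notMem (h : IsRest f c D) (w : W) : f w ∉ insert c D := by
  have := Finset.mem_map_of_mem f (Finset.mem_univ w)
  rwa [h.2, Finset.mem_compl] at this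

lemma IsRest.exists_eq (h : IsRest f c D) {v : V} (hv : v ∉ insert c D) : ∃ w, f w = v := by
  rw [← Finset.mem_compl, ← h.2] at hv
  simpa using hv

lemma IsRest.card (h : IsRest f c D) : Fintype.card W + D.card + 1 = Fintype.card V := by
  have h1 := Finset.card_compl_add_card (insert c D)
  rw [← h.2, Finset.card_map, Finset.card_univ, Finset.card_insert_of_notMem h.1] at h1
  omega

lemma IsRest.dIn_eq (h : IsRest f c D) (hat : G.Attach c D) (w : W) [Decidable (G.Adj (f w) c)] :
    G.dIn Finset.univ (f w) =
      (G.comap f).dIn Finset.univ w + if G.Adj (f w) c then 1 else 0 := by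
  rw [dIn_comap, h.2]
  have h1 : G.dIn Finset.univ (f w) = G.dIn ((insert c D)ᶜ ∪ {c}) (f w) := by
    refine le_antisymm (dIn_le_of_forall fun v _ ha => ?_) (dIn_mono (Finset.subset_univ _) _)
    rw [Finset.mem_union, Finset.mem_compl, Finset.mem_singleton]
    by_contra hcon
    rw [not_or, not_not] at hcon
    rcases Finset.mem_insert.1 hcon.1 with hv | hv
    · exact hcon.2 hv
    · exact hat.not_adj hv (h.notMem w) ha.symm
  rw [h1, dIn_union_of_disjoint (by simp)]
  congr 1
  split_ifs with ha
  · have : G.nbrIn {c} (f w) = {c} := by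
      ext x
      rw [mem_nbrIn, Finset.mem_singleton]
      exact ⟨fun h => h.1, fun h => ⟨h, h ▸ ha⟩⟩
    rw [dIn, this, Finset.card_singleton]
  · exact dIn_eq_zero fun x hx => by rwa [Finset.mem_singleton.1 hx]

lemma IsRest.dIn_le (h : IsRest f c D) (hat : G.Attach c D) (w : W) :
    G.dIn Finset.univ (f w) ≤ (G.comap f).dIn Finset.univ w + 1 := by
  classical
  rw [h.dIn_eq hat]
  split_ifs <;> omega

/-- The condition on degree products is inherited by the complement of `D ∪ {c}`, if `D` is not
too small. -/
lemma IsRest.productCond (h : IsRest f c D) (hat : G.Attach c D) (hG : G.ProductCond)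
    (h2 : ∀ v, 2 ≤ G.dIn Finset.univ v)
    (hD : ∃ y ∈ D, ∃ y' ∈ D, G.dIn Finset.univ y + G.dIn Finset.univ y' ≤ D.card + 1) :
    (G.comap f).ProductCond := by
  obtain ⟨y, hy, y', hy', hyy⟩ := hD
  wlog hle : G.dIn Finset.univ y ≤ G.dIn Finset.univ y' generalizing y y'
  · exact this y' hy' y hy (by omega) (by omega)
  intro u v w huv hna
  wlog huv' : G.dIn Finset.univ (f u) ≤ G.dIn Finset.univ (f v) generalizing u v
  · rw [mul_comm]
    exact this v u huv.symm (fun h' => hna h'.symm) (by omega)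
  have hcard := h.card
  have e1 := hG (f u) (f v) (f w) (f.injective.ne huv) hna
  have e2 := hG y (f u) (f w) (fun h' => h.notMem u (Finset.mem_insert_of_mem (h' ▸ hy)))
    (hat.not_adj hy (h.notMem u))
  have d1 := h.dIn_le hat u
  have d2 := h.dIn_le hat v
  have d3 := h.dIn_le hat w
  have g1 := h2 (f u)
  have g2 := h2 y'
  generalize (G.comap f).dIn Finset.univ u = P at *
  generalize (G.comap f).dIn Finset.univ v = Q at *
  generalize (G.comap f).dIn Finset.univ w = R at *
  generalize G.dIn Finset.univ (f u) = p at *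
  generalize G.dIn Finset.univ (f v) = q at *
  generalize G.dIn Finset.univ (f w) = r at *
  generalize G.dIn Finset.univ y = a at *
  generalize G.dIn Finset.univ y' = b at *
  -- If q ≤ a, then p + q ≤ a + b ≤ |D| + 1 = n - |W|, which covers the loss of p + q - 1 in (p -
  -- 1)(q - 1) and of 1 in r. If q > a, then Q ≥ a, and the condition for `y` and `f u` gives PQ ≥
  -- ap - a ≥ n - r - a; the total loss a + 1 is at most a + b ≤ |D| + 1.
  by_cases hqa : q ≤ a
  · obtain ⟨p₀, rfl⟩ : ∃ p₀, p = p₀ + 1 := ⟨p - 1, by omega⟩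
    obtain ⟨q₀, rfl⟩ : ∃ q₀, q = q₀ + 1 := ⟨q - 1, by omega⟩
    have : p₀ * q₀ ≤ P * Q := Nat.mul_le_mul (by omega) (by omega)
    nlinarith
  · have h6 : a * p ≤ a * (P + 1) := Nat.mul_le_mul_left _ d1
    have h7 : P * a ≤ P * Q := Nat.mul_le_mul_left _ (by omega)
    nlinarith

/-- Each vertex of `J` may gain one neighbour, namely `c`, so I ∪ J has degree sum at most n + |I| +
|J| - 3, exactly what `exists_light` tolerates. The vertex lost there is the surplus vertex of `D`.
-/
lemma IsRest.good (h : IsRest f c D) (hat : G.Attach c D) (hG : G.ProductCond)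
    (h1 : ∀ v, 1 ≤ G.dIn Finset.univ v) (hD : G.Surplus c D) [Nonempty W]
    (hH : (G.comap f).Good) : G.Good := by
  obtain ⟨J, hJ, hJs, l, hl, hJp⟩ := hH
  obtain ⟨I, hI, hind, ⟨k, hk, hkI⟩, hsum, -⟩ := hD
  have hcard := h.card
  have hpart : G.HasPart Finset.univ (k + l) := by
    have h3 := hk.union_part (hJp.map f) (by rw [h.2]; exact disjoint_compl_right)
    rwa [h.2, Finset.union_compl] at h3
  -- Nonemptiness of `W` makes `J` nonempty, so the union has the two vertices that `exists_light`
  -- requires.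
  have hl0 : l ≠ 0 := by
    rintro rfl
    exact Finset.univ_nonempty.ne_empty hJp.eq_empty
  have hdis : Disjoint I (J.map f) := by
    rw [Finset.disjoint_left]
    intro x hx hx'
    obtain ⟨w, -, rfl⟩ := Finset.mem_map.1 hx'
    exact h.notMem w (Finset.mem_insert_of_mem (hI hx))
  have hcu : (I ∪ J.map f).card = I.card + J.card := by
    rw [Finset.card_union_of_disjoint hdis, Finset.card_map]
  have hs : ∑ u ∈ J.map f, G.dIn Finset.univ u ≤
      ∑ u ∈ J, (G.comap f).dIn Finset.univ u + J.card := by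
    rw [Finset.sum_map, Finset.card_eq_sum_ones, ← Finset.sum_add_distrib]
    exact Finset.sum_le_sum fun w _ => h.dIn_le hat w
  have hindU : G.Indep (I ∪ J.map f) := hind.union (hJ.map f) fun u hu v hv => by
    obtain ⟨w, -, rfl⟩ := Finset.mem_map.1 hv
    exact hat.not_adj (hI hu) (h.notMem w)
  obtain ⟨K, hKU, hKc, hKs⟩ := exists_light hG h1 hindU (by omega) (by
    rw [Finset.sum_union hdis]
    omega)
  exact ⟨K, hindU.mono hKU, hKs, _, by omega, hpart⟩

end Rest

lemma graphF5_adj (i j : Fin 5) :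
    graphF5.Adj i j ↔ i ≠ j ∧ (i = 0 ∨ j = 0 ∨ (i.val + 1) / 2 = (j.val + 1) / 2) := by
  simp only [graphF5, fromEdgeSet_adj, Set.mem_insert_iff, Set.mem_singleton_iff, Sym2.eq_iff]
  revert i j
  decide

lemma nonempty_iso_of_bijective {V W : Type*} {G : SimpleGraph V} {H : SimpleGraph W} (f : W → V)
    (hf : Function.Bijective f) (h : ∀ u v, H.Adj u v ↔ G.Adj (f u) (f v)) :
    Nonempty (G ≃g H) :=
  ⟨RelIso.symm ⟨Equiv.ofBijective f hf, fun {u v} => (h u v).symm⟩⟩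

/-! ### Triangle pieces: F₅ and the graphs H -/

section TrianglePieces

variable {V : Type u} [Fintype V] [DecidableEq V] {G : SimpleGraph V}

/-- Only the adjacency of `c` and `b` is left open by the hypotheses; it decides between the two
graphs. -/
lemma nonempty_iso_graphH {c b y y' : V} {A B : Finset V} {s : ℕ} (hA : A.card = s - 1)
    (hB : B.card = s - 1) (hcover : ∀ v, v = c ∨ v = b ∨ v = y ∨ v = y' ∨ v ∈ A ∨ v ∈ B)
    (hyy : G.Adj y y') (hcy : G.Adj c y) (hcy' : G.Adj c y')
    (hyb : ¬ G.Adj y b) (hyb' : ¬ G.Adj y' b)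
    (hyA : ∀ v ∈ A, ¬ G.Adj y v ∧ ¬ G.Adj y' v) (hyB : ∀ v ∈ B, ¬ G.Adj y v ∧ ¬ G.Adj y' v)
    (hcA : ∀ v ∈ A, G.Adj c v) (hcB : ∀ v ∈ B, G.Adj c v)
    (hbA : ∀ v ∈ A, G.Adj b v) (hbB : ∀ v ∈ B, G.Adj b v)
    (hAA : ∀ u ∈ A, ∀ v ∈ A, u ≠ v → G.Adj u v) (hBB : ∀ u ∈ B, ∀ v ∈ B, u ≠ v → G.Adj u v)
    (hAB : ∀ u ∈ A, ∀ v ∈ B, ¬ G.Adj u v) (hcb : c ≠ b) (hyb1 : y ≠ b) (hyb2 : y' ≠ b)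
    (hdis : Disjoint A B) (hyA' : y ∉ A ∧ y' ∉ A) (hyB' : y ∉ B ∧ y' ∉ B) :
    Nonempty (G ≃g graphH s s) ∨ Nonempty (G ≃g graphHMinus s s) := by
  let eA := (A.equivFinOfCardEq hA).symm
  let eB := (B.equivFinOfCardEq hB).symm
  let f : VertexH s s → V := fun p => match p with
    | .a => c
    | .b => b
    | .c₁ => y
    | .c₂ => y'
    | .x i => eA i
    | .y i => eB i
  have mA : ∀ i, (eA i : V) ∈ A := fun i => (eA i).2
  have mB : ∀ i, (eB i : V) ∈ B := fun i => (eB i).2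
  have f1 : ∀ i, G.Adj c (eA i) := fun i => hcA _ (mA i)
  have f2 : ∀ i, G.Adj c (eB i) := fun i => hcB _ (mB i)
  have f3 : ∀ i, G.Adj b (eA i) := fun i => hbA _ (mA i)
  have f4 : ∀ i, G.Adj b (eB i) := fun i => hbB _ (mB i)
  have f5 : ∀ i, ¬ G.Adj y (eA i) := fun i => (hyA _ (mA i)).1
  have f6 : ∀ i, ¬ G.Adj y (eB i) := fun i => (hyB _ (mB i)).1
  have f7 : ∀ i, ¬ G.Adj y' (eA i) := fun i => (hyA _ (mA i)).2
  have f8 : ∀ i, ¬ G.Adj y' (eB i) := fun i => (hyB _ (mB i)).2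
  have f9 : ∀ i j, ¬ G.Adj (eA i : V) (eB j) := fun i j => hAB _ (mA i) _ (mB j)
  have f10 : ∀ i j, G.Adj (eA i : V) (eA j) ↔ i ≠ j := fun i j =>
    ⟨fun h hij => h.ne (by rw [hij]), fun hij => hAA _ (mA i) _ (mA j) fun h =>
      hij (eA.injective (Subtype.ext h))⟩
  have f11 : ∀ i j, G.Adj (eB i : V) (eB j) ↔ i ≠ j := fun i j =>
    ⟨fun h hij => h.ne (by rw [hij]), fun hij => hBB _ (mB i) _ (mB j) fun h =>
      hij (eB.injective (Subtype.ext h))⟩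
  have g1 : ∀ i, c ≠ eA i := fun i => (f1 i).ne
  have g2 : ∀ i, c ≠ eB i := fun i => (f2 i).ne
  have g3 : ∀ i, b ≠ eA i := fun i => (f3 i).ne
  have g4 : ∀ i, b ≠ eB i := fun i => (f4 i).ne
  have g5 : ∀ i, y ≠ eA i := fun i h => hyA'.1 (h ▸ mA i)
  have g6 : ∀ i, y ≠ eB i := fun i h => hyB'.1 (h ▸ mB i)
  have g7 : ∀ i, y' ≠ eA i := fun i h => hyA'.2 (h ▸ mA i)
  have g8 : ∀ i, y' ≠ eB i := fun i h => hyB'.2 (h ▸ mB i)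
  have g9 : ∀ i j, (eA i : V) ≠ eB j := fun i j h =>
    Finset.disjoint_left.1 hdis (mA i) (h ▸ mB j)
  have g10 : ∀ i j, (eA i : V) = eA j ↔ i = j := fun i j =>
    ⟨fun h => eA.injective (Subtype.ext h), fun h => h ▸ rfl⟩
  have g11 : ∀ i j, (eB i : V) = eB j ↔ i = j := fun i j =>
    ⟨fun h => eB.injective (Subtype.ext h), fun h => h ▸ rfl⟩
  have hbij : Function.Bijective f := by
    constructor
    · intro p q h
      have key : ∀ {u v : V}, f p = u → f q = v → u ≠ v → p = q := fun hu hv hne =>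
        absurd (hu.symm.trans (h.trans hv)) hne
      cases p <;> cases q <;> first
        | rfl
        | exact congrArg _ ((g10 _ _).1 h)
        | exact congrArg _ ((g11 _ _).1 h)
        | exact key rfl rfl hcb
        | exact key rfl rfl hcb.symm
        | exact key rfl rfl hcy.ne
        | exact key rfl rfl hcy.ne'
        | exact key rfl rfl hcy'.ne
        | exact key rfl rfl hcy'.ne'
        | exact key rfl rfl hyy.ne
        | exact key rfl rfl hyy.ne'
        | exact key rfl rfl hyb1
        | exact key rfl rfl hyb1.symm
        | exact key rfl rfl hyb2
        | exact key rfl rfl hyb2.symm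
        | exact key rfl rfl (g1 _)
        | exact key rfl rfl (g1 _).symm
        | exact key rfl rfl (g2 _)
        | exact key rfl rfl (g2 _).symm
        | exact key rfl rfl (g3 _)
        | exact key rfl rfl (g3 _).symm
        | exact key rfl rfl (g4 _)
        | exact key rfl rfl (g4 _).symm
        | exact key rfl rfl (g5 _)
        | exact key rfl rfl (g5 _).symm
        | exact key rfl rfl (g6 _)
        | exact key rfl rfl (g6 _).symm
        | exact key rfl rfl (g7 _)
        | exact key rfl rfl (g7 _).symm
        | exact key rfl rfl (g8 _)
        | exact key rfl rfl (g8 _).symm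
        | exact key rfl rfl (g9 _ _)
        | exact key rfl rfl (g9 _ _).symm
    · intro v
      rcases hcover v with rfl | rfl | rfl | rfl | h | h
      · exact ⟨.a, rfl⟩
      · exact ⟨.b, rfl⟩
      · exact ⟨.c₁, rfl⟩
      · exact ⟨.c₂, rfl⟩
      · exact ⟨.x (eA.symm ⟨v, h⟩), by simp [f]⟩
      · exact ⟨.y (eB.symm ⟨v, h⟩), by simp [f]⟩
  have k1 : ¬ G.Adj b y := fun h => hyb h.symm
  have k2 : ¬ G.Adj b y' := fun h => hyb' h.symm
  have k5 : ∀ i, ¬ G.Adj (eA i : V) y := fun i h => f5 i h.symm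
  have k6 : ∀ i, ¬ G.Adj (eB i : V) y := fun i h => f6 i h.symm
  have k7 : ∀ i, ¬ G.Adj (eA i : V) y' := fun i h => f7 i h.symm
  have k8 : ∀ i, ¬ G.Adj (eB i : V) y' := fun i h => f8 i h.symm
  have k9 : ∀ i j, ¬ G.Adj (eB j : V) (eA i) := fun i j h => f9 i j h.symm
  by_cases hab : G.Adj c b
  · refine Or.inl (nonempty_iso_of_bijective f hbij fun p q => ?_)
    cases p <;> cases q <;>
      simp [f, graphH, relH, hcy, hcy', hyy, hab, hyb, hyb', hcy.symm, hcy'.symm, hyy.symm,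
        hab.symm, (f1 _).symm, (f2 _).symm, (f3 _).symm, (f4 _).symm, f1, f2, f3, f4, f5, f6, f7,
        f8, f9, f10, f11, k1, k2, k5, k6, k7, k8, k9]
  · have hab' : ¬ G.Adj b c := fun h => hab h.symm
    refine Or.inr (nonempty_iso_of_bijective f hbij fun p q => ?_)
    cases p <;> cases q <;>
      simp [f, graphHMinus, graphH, relH, hcy, hcy', hyy, hab, hyb, hyb', hcy.symm, hcy'.symm,
        hyy.symm, hab', (f1 _).symm, (f2 _).symm, (f3 _).symm, (f4 _).symm, f1, f2, f3, f4, f5,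
        f6, f7, f8, f9, f10, f11, k1, k2, k5, k6, k7, k8, k9]

lemma nonempty_iso_graphF5 {c y y' v v' : V} (hcover : ∀ w, w = c ∨ w = y ∨ w = y' ∨ w = v ∨ w = v')
    (h1 : G.Adj c y) (h2 : G.Adj c y') (h3 : G.Adj c v) (h4 : G.Adj c v') (h5 : G.Adj y y')
    (h6 : G.Adj v v') (h7 : ¬ G.Adj y v) (h8 : ¬ G.Adj y v') (h9 : ¬ G.Adj y' v)
    (h10 : ¬ G.Adj y' v') (n1 : y ≠ v) (n2 : y ≠ v') (n3 : y' ≠ v) (n4 : y' ≠ v') :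
    Nonempty (G ≃g graphF5) := by
  refine nonempty_iso_of_bijective ![c, y, y', v, v'] ⟨?_, ?_⟩ ?_
  · intro i j h
    fin_cases i <;> fin_cases j <;> first
      | rfl
      | (exfalso; revert h; simp [h1.ne, h2.ne, h3.ne, h4.ne, h5.ne, h6.ne, h1.ne', h2.ne', h3.ne',
          h4.ne', h5.ne', h6.ne', n1, n2, n3, n4, n1.symm, n2.symm, n3.symm, n4.symm])
  · intro w
    rcases hcover w with rfl | rfl | rfl | rfl | rfl
    exacts [⟨0, rfl⟩, ⟨1, rfl⟩, ⟨2, rfl⟩, ⟨3, rfl⟩, ⟨4, rfl⟩]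
  · intro i j
    have k7 : ¬ G.Adj v y := fun h => h7 h.symm
    have k8 : ¬ G.Adj v' y := fun h => h8 h.symm
    have k9 : ¬ G.Adj v y' := fun h => h9 h.symm
    have k10 : ¬ G.Adj v' y' := fun h => h10 h.symm
    rw [graphF5_adj]
    fin_cases i <;> fin_cases j <;>
      simp [h1, h2, h3, h4, h5, h6, h7, h8, h9, h10, h1.symm, h2.symm, h3.symm, h4.symm, h5.symm,
        h6.symm, k7, k8, k9, k10]

/-- The vertex `y` has degree 2, so every `v` in the rest `X` satisfies 2d(v) ≥ |X| + 1. If `X` is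
2-connected, `X` and the triangle are two parts, matched by {y, v}. Otherwise `X` is an edge or has
a cut vertex, and the degree bound is tight everywhere. -/
lemma TrianglePiece.good_or_exceptional (hG : G.ProductCond)
    (h2 : ∀ v, 2 ≤ G.dIn Finset.univ v) {c : V} {D : Finset V} (hat : G.Attach c D)
    (hne : ∃ v, v ∉ insert c D) (hD : G.TrianglePiece c D) : G.Good ∨ G.IsExceptional := by
  obtain ⟨y, y', rfl, hyy, hcy, hcy'⟩ := hD
  set X : Finset V := (insert c {y, y'})ᶜ with hX
  have memX : ∀ {v}, v ∈ X ↔ v ≠ c ∧ v ≠ y ∧ v ≠ y' := by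
    intro v
    simp [hX]
  have hnX : ∀ {v}, v ∈ X → v ∉ insert c ({y, y'} : Finset V) := fun hv =>
    Finset.mem_compl.1 hv
  have hcard : X.card + 3 = Fintype.card V := by
    have := Finset.card_compl_add_card (insert c ({y, y'} : Finset V))
    rw [Finset.card_insert_of_notMem hat.1, Finset.card_pair hyy.ne] at this
    exact this
  have hdy : G.dIn Finset.univ y = 2 := by
    refine le_antisymm ?_ (h2 y)
    refine (dIn_le_card_of_forall (t := {c, y'}) fun w _ ha => ?_).trans (Finset.card_insert_le _ _)
    by_contra hw
    simp only [Finset.mem_insert, Finset.mem_singleton, not_or] at hw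
    exact hat.not_adj (D := {y, y'}) (by simp) (hnX (memX.2 ⟨hw.1, ha.ne', hw.2⟩)) ha
  have hdX : ∀ v ∈ X, G.dIn Finset.univ v ≤ G.dIn X v + 1 := fun v hv => by
    refine (dIn_le_of_forall (t := insert c X) fun w _ ha => ?_).trans (dIn_insert_le _ _ _)
    rw [Finset.mem_insert]
    by_contra hw
    rw [not_or] at hw
    have hwD : w ∈ ({y, y'} : Finset V) := by
      rw [hX, Finset.mem_compl, not_not, Finset.mem_insert] at hw
      exact hw.2.resolve_left hw.1
    exact hat.not_adj hwD (hnX hv) ha.symm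
  have hlow : ∀ v ∈ X, X.card + 1 ≤ 2 * G.dIn Finset.univ v := fun v hv => by
    have := hG y v y (memX.1 hv).2.1.symm (hat.not_adj (by simp) (hnX hv))
    rw [hdy] at this
    omega
  have hyX : ∀ v ∈ X, ¬ G.Adj y v ∧ ¬ G.Adj y' v := fun v hv =>
    ⟨hat.not_adj (by simp) (hnX hv), hat.not_adj (by simp) (hnX hv)⟩
  obtain ⟨v, hv⟩ := hne
  rw [← Finset.mem_compl, ← hX] at hv
  by_cases htc : G.TwoConn X
  · left
    have hpart := (twoConn_triangle hcy hcy' hyy).hasPart.union_part htc.hasPart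
      (by rw [hX]; exact disjoint_compl_right)
    rw [hX, Finset.union_compl] at hpart
    have hyv := (memX.1 hv).2.1.symm
    refine ⟨{y, v}, ?_, ?_, 2, ?_, hpart⟩
    · intro a ha b hb hab
      simp only [Finset.mem_insert, Finset.mem_singleton] at ha hb
      have := (hyX v hv).1
      rcases ha with rfl | rfl <;> rcases hb with rfl | rfl
      exacts [hab.ne rfl, this hab, this hab.symm, hab.ne rfl]
    · rw [Finset.sum_pair hyv, hdy]
      have := hdX v hv
      have := dIn_add_one_le_card (G := G) hv
      omega
    · rw [Finset.card_pair hyv]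
  right
  have hX2 : 2 ≤ X.card := by
    have := h2 v
    have := hdX v hv
    have := dIn_add_one_le_card (G := G) hv
    omega
  -- Here 2d(v) > |X| ≥ 2|t|, so `v` needs all of `t` and also `c`, the only possible neighbour
  -- outside `X`.
  have hadj : ∀ v ∈ X, ∀ t : Finset V, (∀ w ∈ X, G.Adj v w → w ∈ t) → 2 * t.card ≤ X.card →
      G.Adj c v ∧ ∀ w ∈ t, G.Adj v w := by
    intro v hv t ht htc
    have h3 : G.dIn X v ≤ t.card := dIn_le_card_of_forall ht
    have h4 := hdX v hv
    have h5 := hlow v hv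
    refine ⟨?_, fun w hw => adj_of_card_le_dIn ht (by omega) hw⟩
    by_contra hcv
    have : G.dIn Finset.univ v ≤ G.dIn X v := dIn_le_of_forall fun w _ ha => by
      by_contra hw
      rw [hX, Finset.mem_compl, not_not, Finset.mem_insert] at hw
      rcases hw with rfl | hw
      · exact hcv ha.symm
      · exact hat.not_adj hw (hnX hv) ha.symm
    omega
  rcases hX2.eq_or_lt with hX2 | hX3
  · obtain ⟨u, w, huw, hXe⟩ := Finset.card_eq_two.1 hX2.symm
    have hu : u ∈ X := by rw [hXe]; simp
    have hw : w ∈ X := by rw [hXe]; simp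
    have h3 := hadj u hu {w} (fun z hz ha => by
      rw [hXe, Finset.mem_insert] at hz
      exact hz.resolve_left ha.ne') (by rw [Finset.card_singleton]; omega)
    have h4 := hadj w hw {u} (fun z hz ha => by
      rw [hXe, Finset.mem_insert, Finset.mem_singleton] at hz
      rw [Finset.mem_singleton]
      exact hz.resolve_right ha.ne') (by rw [Finset.card_singleton]; omega)
    refine Or.inr (Or.inl (nonempty_iso_graphF5 (c := c) (y := y) (y' := y') (v := u) (v' := w)
      (fun z => ?_) hcy hcy' h3.1 h4.1 hyy (h3.2 w (by simp)) (hyX u hu).1 (hyX w hw).1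
      (hyX u hu).2 (hyX w hw).2 (memX.1 hu).2.1.symm (memX.1 hw).2.1.symm (memX.1 hu).2.2.symm
      (memX.1 hw).2.2.symm))
    by_cases hz : z ∈ X
    · rw [hXe, Finset.mem_insert, Finset.mem_singleton] at hz
      tauto
    · rw [memX] at hz
      tauto
  -- If `X` split into two sides with no edges between them, each side would have more than |X|/2
  -- vertices.
  have hconn : G.Conn X := by
    by_contra hnc
    obtain ⟨A, hA, ⟨p, hp⟩, ⟨q, hq⟩, hno⟩ := not_conn ⟨v, hv⟩ hnc
    have hqX := Finset.mem_sdiff.1 hq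
    have h3 : G.dIn X p ≤ G.dIn A p := dIn_le_of_forall fun w hw ha => by
      by_contra hwA
      exact hno p hp w (Finset.mem_sdiff.2 ⟨hw, hwA⟩) ha
    have h4 : G.dIn X q ≤ G.dIn (X \ A) q := dIn_le_of_forall fun w hw ha => by
      by_contra hwA
      rw [Finset.mem_sdiff, not_and, not_not] at hwA
      exact hno w (hwA hw) q hq ha.symm
    have h5 := dIn_add_one_le_card (G := G) hp
    have h6 := dIn_add_one_le_card (G := G) hq
    have h7 := Finset.card_sdiff_add_card_eq_card hA
    have := hlow p (hA hp)
    have := hlow q hqX.1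
    have := hdX p (hA hp)
    have := hdX q hqX.1
    omega
  obtain ⟨b, hb, hnb⟩ : ∃ b ∈ X, ¬ G.Conn (X.erase b) := by
    by_contra hcon
    push Not at hcon
    exact htc ⟨hX3, hconn, hcon⟩
  have hce := Finset.card_erase_of_mem hb
  obtain ⟨A, hA, hA0, hB0, hno⟩ := not_conn (Finset.card_pos.1 (by omega)) hnb
  set B := X.erase b \ A with hB
  have hBX : B ⊆ X.erase b := Finset.sdiff_subset
  have hcAB := Finset.card_sdiff_add_card_eq_card hA
  rw [← hB] at hcAB
  have hAX : ∀ {u}, u ∈ A → u ∈ X := fun hu => Finset.mem_of_mem_erase (hA hu)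
  have hBX' : ∀ {u}, u ∈ B → u ∈ X := fun hu => Finset.mem_of_mem_erase (hBX hu)
  have hbA : b ∉ A := fun h => Finset.notMem_erase b X (hA h)
  have hbB : b ∉ B := fun h => Finset.notMem_erase b X (hBX h)
  have nA : ∀ p ∈ A, ∀ w ∈ X, G.Adj p w → w ∈ insert b (A.erase p) := fun p hp w hw ha => by
    by_contra hcon
    simp only [Finset.mem_insert, Finset.mem_erase, not_or, not_and] at hcon
    exact hno p hp w (Finset.mem_sdiff.2 ⟨Finset.mem_erase.2 ⟨hcon.1, hw⟩, hcon.2 ha.ne'⟩) ha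
  have nB : ∀ p ∈ B, ∀ w ∈ X, G.Adj p w → w ∈ insert b (B.erase p) := fun p hp w hw ha => by
    by_contra hcon
    simp only [Finset.mem_insert, Finset.mem_erase, not_or, not_and] at hcon
    have hwA : w ∈ A := by
      by_contra hwA
      exact hcon.2 ha.ne' (Finset.mem_sdiff.2 ⟨Finset.mem_erase.2 ⟨hcon.1, hw⟩, hwA⟩)
    exact hno w hwA p hp ha.symm
  have cA : ∀ p ∈ A, (insert b (A.erase p)).card = A.card := fun p hp => by
    rw [Finset.card_insert_of_notMem (fun h => hbA (Finset.mem_of_mem_erase h)),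
      Finset.card_erase_add_one hp]
  have cB : ∀ p ∈ B, (insert b (B.erase p)).card = B.card := fun p hp => by
    rw [Finset.card_insert_of_notMem (fun h => hbB (Finset.mem_of_mem_erase h)),
      Finset.card_erase_add_one hp]
  have hA1 := Finset.card_pos.2 hA0
  -- A vertex of a side sees in `X` only `b` and the rest of that side. Since |A| + |B| = |X| - 1,
  -- both sides have exactly (|X| - 1)/2 vertices; then all possible edges are present.
  have hAB : X.card ≤ 2 * A.card + 1 ∧ X.card ≤ 2 * B.card + 1 := by
    obtain ⟨p, hp⟩ := hA0
    obtain ⟨q, hq⟩ := hB0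
    have h3 : G.dIn X p ≤ _ := dIn_le_card_of_forall (nA p hp)
    have h4 : G.dIn X q ≤ _ := dIn_le_card_of_forall (nB q hq)
    rw [cA p hp] at h3
    rw [cB q hq] at h4
    have := hlow p (hAX hp)
    have := hlow q (hBX' hq)
    have := hdX p (hAX hp)
    have := hdX q (hBX' hq)
    omega
  have aA : ∀ p ∈ A, G.Adj c p ∧ ∀ w ∈ insert b (A.erase p), G.Adj p w := fun p hp =>
    hadj p (hAX hp) _ (nA p hp) (by rw [cA p hp]; omega)
  have aB : ∀ p ∈ B, G.Adj c p ∧ ∀ w ∈ insert b (B.erase p), G.Adj p w := fun p hp =>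
    hadj p (hBX' hp) _ (nB p hp) (by rw [cB p hp]; omega)
  refine Or.inr (Or.inr (Or.inr (Or.inr ⟨A.card + 1, by omega, by omega, ?_⟩)))
  refine nonempty_iso_graphH (c := c) (b := b) (y := y) (y' := y') (A := A) (B := B) (by omega)
    (by omega) (fun w => ?_) hyy hcy hcy' (hyX b hb).1 (hyX b hb).2 (fun w hw => hyX w (hAX hw))
    (fun w hw => hyX w (hBX' hw)) (fun w hw => (aA w hw).1) (fun w hw => (aB w hw).1)
    (fun w hw => ((aA w hw).2 b (Finset.mem_insert_self _ _)).symm)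
    (fun w hw => ((aB w hw).2 b (Finset.mem_insert_self _ _)).symm)
    (fun p hp q hq hpq => (aA p hp).2 q
      (Finset.mem_insert_of_mem (Finset.mem_erase.2 ⟨hpq.symm, hq⟩)))
    (fun p hp q hq hpq => (aB p hp).2 q
      (Finset.mem_insert_of_mem (Finset.mem_erase.2 ⟨hpq.symm, hq⟩)))
    hno (memX.1 hb).1.symm (memX.1 hb).2.1.symm (memX.1 hb).2.2.symm Finset.disjoint_sdiff
    ⟨fun h => (memX.1 (hAX h)).2.1 rfl, fun h => (memX.1 (hAX h)).2.2 rfl⟩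
    ⟨fun h => (memX.1 (hBX' h)).2.1 rfl, fun h => (memX.1 (hBX' h)).2.2 rfl⟩
  by_cases hw : w ∈ X
  · by_cases hwb : w = b
    · exact Or.inr (Or.inl hwb)
    · by_cases hwA : w ∈ A
      · tauto
      · have : w ∈ B := Finset.mem_sdiff.2 ⟨Finset.mem_erase.2 ⟨hwb, hw⟩, hwA⟩
        tauto
  · rw [memX] at hw
    tauto

end TrianglePieces

/-! ### Common features of the exceptional graphs -/

section Profile

/-- Bounds on the order of an exceptional graph and on the degrees of two of its vertices. -/
def ProfileBound (N e e' : ℕ) : Prop :=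
  (N = 5 ∧ e = 2 ∧ e' = 2) ∨ (11 ≤ N ∧ e = 3 ∧ e' = 3) ∨
    ∃ s, 2 ≤ s ∧ N = 2 * s + 2 ∧ ((e = s ∧ e' = 2) ∨ (e = 2 ∧ e' = s))

/-- Some common features of the exceptional graphs of order at least three: a set `A` of vertices of
small degree, all adjacent to `u`, such that all vertices outside of `A` have neighbours in `A`. -/
structure IsProfile {T : Type*} (K : SimpleGraph T) (N : ℕ) (u : T) (A : Set T) : Prop where
  nonempty : A.Nonempty
  notMem : u ∉ A
  adj : ∀ x ∈ A, K.Adj u x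
  two : ∀ z, z ≠ u → z ∉ A → ∃ x ∈ A, ∃ y ∈ A, x ≠ y ∧ K.Adj z x ∧ K.Adj z y
  low : ∀ x ∈ A, ∃ x' ∈ A, x ≠ x' ∧ ¬ K.Adj x x' ∧ ∃ e e', ProfileBound N e e' ∧
    (∃ t : Finset T, t.card ≤ e ∧ ∀ w, K.Adj x w → w ∈ t) ∧
    ∃ t : Finset T, t.card ≤ e' ∧ ∀ w, K.Adj x' w → w ∈ t

lemma IsProfile.of_iso {T W : Type*} {K : SimpleGraph T} {H : SimpleGraph W} {N : ℕ} {u : T}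
    {A : Set T} (h : K.IsProfile N u A) (φ : H ≃g K) :
    H.IsProfile N (φ.symm u) (φ ⁻¹' A) := by
  have tr : ∀ x e, (∃ t : Finset T, t.card ≤ e ∧ ∀ w, K.Adj x w → w ∈ t) →
      ∃ t : Finset W, t.card ≤ e ∧ ∀ w, H.Adj (φ.symm x) w → w ∈ t := by
    rintro x e ⟨t, ht, hx⟩
    refine ⟨t.map φ.symm.toEquiv.toEmbedding, by rwa [Finset.card_map], fun w hw => ?_⟩
    rw [Finset.mem_map]
    refine ⟨φ w, hx _ ?_, by simp⟩
    rw [← φ.map_adj_iff] at hw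
    simpa using hw
  have ad : ∀ x y, H.Adj (φ.symm x) (φ.symm y) ↔ K.Adj x y := fun x y => φ.symm.map_adj_iff
  refine ⟨?_, by simpa using h.notMem, fun x hx => ?_, fun z hz hzA => ?_, fun x hx => ?_⟩
  · obtain ⟨x, hx⟩ := h.nonempty
    exact ⟨φ.symm x, by simpa using hx⟩
  · have := h.adj _ hx
    rw [← ad] at this
    simpa using this
  · obtain ⟨x, hx, y, hy, hxy, h1, h2⟩ := h.two (φ z) (fun h' => hz (by rw [← h']; simp)) hzA
    refine ⟨φ.symm x, by simpa using hx, φ.symm y, by simpa using hy, by simpa using hxy, ?_, ?_⟩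
    · rw [← ad] at h1
      simpa using h1
    · rw [← ad] at h2
      simpa using h2
  · obtain ⟨x', hx', hne, hna, e, e', hb, h1, h2⟩ := h.low _ hx
    refine ⟨φ.symm x', by simpa using hx', fun h' => hne (by rw [h']; simp), ?_, e, e', hb, ?_,
      tr _ _ h2⟩
    · rw [← ad] at hna
      simpa using hna
    · simpa using tr _ _ h1

lemma isProfile_graphF5 : graphF5.IsProfile 5 0 {i | i ≠ 0} := by
  refine ⟨⟨1, by decide⟩, by simp, ?_, ?_, ?_⟩
  · intro x hx
    rw [graphF5_adj]
    exact ⟨Ne.symm hx, Or.inl rfl⟩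
  · intro z h1 h2
    exact absurd h1 h2
  · have key : ∀ x : Fin 5, ∃ t : Finset (Fin 5), x ≠ 0 →
        t.card ≤ 2 ∧ ∀ w, graphF5.Adj x w → w ∈ t := by
      intro x
      simp only [graphF5_adj]
      refine ⟨Finset.univ.filter fun w =>
        x ≠ w ∧ (x = 0 ∨ w = 0 ∨ (x.val + 1) / 2 = (w.val + 1) / 2), ?_⟩
      revert x
      decide
    intro x hx
    obtain ⟨x', hx', hne, hna⟩ : ∃ x' : Fin 5, x' ≠ 0 ∧ x ≠ x' ∧ ¬ graphF5.Adj x x' := by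
      simp only [graphF5_adj]
      replace hx : x ≠ 0 := hx
      revert x
      decide
    obtain ⟨t, ht⟩ := key x
    obtain ⟨t', ht'⟩ := key x'
    exact ⟨x', hx', hne, hna, 2, 2, Or.inl ⟨rfl, rfl, rfl⟩, ⟨t, ht hx⟩, ⟨t', ht' hx'⟩⟩

lemma VertexF.card (m : ℕ) : Nat.card (VertexF m) = m + 3 ∧ Finite (VertexF m) := by
  let e : VertexF m ≃ Option (Option (Option (Fin m))) :=
    { toFun := fun p => match p with
        | .a => none
        | .b₁ => some none
        | .b₂ => some (some none)
        | .c i => some (some (some i))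
      invFun := fun p => match p with
        | none => .a
        | some none => .b₁
        | some (some none) => .b₂
        | some (some (some i)) => .c i
      left_inv := by rintro (_ | _ | _ | i) <;> rfl
      right_inv := by rintro (_ | _ | _ | i) <;> rfl }
  refine ⟨?_, Finite.of_equiv _ e.symm⟩
  rw [Nat.card_congr e, Nat.card_eq_fintype_card]
  simp

lemma graphF11_adj_c {L : Set (Sym2 (VertexF 8))} (hL : L ⊆ {s(.a, .b₁), s(.a, .b₂)}) (i : Fin 8)
    (p : VertexF 8) : (graphF11 L).Adj (.c i) p ↔ (match p with
      | .a => True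
      | .b₁ => i.val < 4
      | .b₂ => 4 ≤ i.val
      | .c j => i ≠ j ∧ i.val / 2 = j.val / 2) := by
  have hL' : s(.c i, p) ∉ L := fun h => by
    have := hL h
    simp at this
  rw [graphF11, sup_adj, fromRel_adj, fromEdgeSet_adj]
  cases p with
  | a => simp [baseRelF11]
  | b₁ => simp [baseRelF11, hL']
  | b₂ => simp [baseRelF11, hL']
  | c j =>
    simp only [hL', false_and, or_false, baseRelF11, Set.mem_insert_iff, Set.mem_singleton_iff,
      Prod.mk.injEq, ne_eq, VertexF.c.injEq]
    clear hL'
    revert i j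
    decide

lemma isProfile_graphF11 {L : Set (Sym2 (VertexF 8))} (hL : L ⊆ {s(.a, .b₁), s(.a, .b₂)}) :
    (graphF11 L).IsProfile 11 .a (Set.range .c) := by
  have ad := graphF11_adj_c hL
  have hnb : ∀ i : Fin 8, ∃ t : Finset (VertexF 8), t.card ≤ 3 ∧
      ∀ w, (graphF11 L).Adj (.c i) w → w ∈ t := by
    intro i
    have hj : ∃ j : Fin 8, ∀ k : Fin 8, i ≠ k ∧ i.val / 2 = k.val / 2 → k = j := by
      revert i
      decide
    obtain ⟨j, hj⟩ := hj
    refine ⟨{.a, if i.val < 4 then .b₁ else .b₂, .c j}, Finset.card_le_three, fun w hw => ?_⟩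
    rw [ad] at hw
    cases w with
    | a => simp
    | b₁ => simp [show i.val < 4 from hw]
    | b₂ => simp [show ¬ i.val < 4 from not_lt.2 hw]
    | c k => simp [hj k hw]
  refine ⟨⟨_, 0, rfl⟩, by simp, ?_, ?_, ?_⟩
  · rintro _ ⟨i, rfl⟩
    rw [adj_comm, ad]
    trivial
  · intro z hz hzA
    cases z with
    | a => exact absurd rfl hz
    | b₁ => exact ⟨.c 0, ⟨0, rfl⟩, .c 1, ⟨1, rfl⟩, by simp, by rw [adj_comm, ad]; decide,
        by rw [adj_comm, ad]; decide⟩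
    | b₂ => exact ⟨.c 4, ⟨4, rfl⟩, .c 5, ⟨5, rfl⟩, by simp, by rw [adj_comm, ad]; decide,
        by rw [adj_comm, ad]; decide⟩
    | c i => exact absurd ⟨i, rfl⟩ hzA
  · rintro _ ⟨i, rfl⟩
    have : ∃ j : Fin 8, i ≠ j ∧ ¬ (i ≠ j ∧ i.val / 2 = j.val / 2) := by
      revert i
      decide
    obtain ⟨j, hij, hj⟩ := this
    exact ⟨.c j, ⟨j, rfl⟩, by simpa using hij, by rw [ad]; exact hj, 3, 3,
      Or.inr (Or.inl ⟨le_rfl, rfl, rfl⟩), hnb i, hnb j⟩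

lemma graphF12_adj_c {L : Set (Sym2 (VertexF 9))}
    (hL : L ⊆ {s(.a, .b₁), s(.a, .b₂), s(.a, .c 8), s(.b₂, .c 8)}) (i : Fin 9) (hi : i.val < 8)
    (p : VertexF 9) : (graphF12 L).Adj (.c i) p ↔ (match p with
      | .a => True
      | .b₁ => i.val < 4
      | .b₂ => 4 ≤ i.val
      | .c j => (i.val < 6 ∧ i ≠ j ∧ i.val / 2 = j.val / 2) ∨ (6 ≤ i.val ∧ j = 8)) := by
  have hi' : i ≠ 8 := fun h => by simp [h] at hi
  have hL' : s(.c i, p) ∉ L := fun h => by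
    have := hL h
    simp [hi'] at this
  rw [graphF12, sup_adj, fromRel_adj, fromEdgeSet_adj]
  cases p with
  | a => simp [baseRelF12, hi]
  | b₁ => simp [baseRelF12, hL']
  | b₂ => simp [baseRelF12, hL', hi]
  | c j =>
    simp only [hL', false_and, or_false, baseRelF12, Set.mem_insert_iff, Set.mem_singleton_iff,
      Prod.mk.injEq, ne_eq, VertexF.c.injEq]
    clear hL' hi'
    revert i j
    decide

lemma isProfile_graphF12 {L : Set (Sym2 (VertexF 9))}
    (hL : L ⊆ {s(.a, .b₁), s(.a, .b₂), s(.a, .c 8), s(.b₂, .c 8)}) :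
    (graphF12 L).IsProfile 12 .a {p | ∃ i : Fin 9, i.val < 8 ∧ p = .c i} := by
  have ad := graphF12_adj_c hL
  have hnb : ∀ i : Fin 9, i.val < 8 → ∃ t : Finset (VertexF 9), t.card ≤ 3 ∧
      ∀ w, (graphF12 L).Adj (.c i) w → w ∈ t := by
    intro i hi
    have hj : ∃ j : Fin 9, ∀ k : Fin 9, (i.val < 6 ∧ i ≠ k ∧ i.val / 2 = k.val / 2) ∨
        (6 ≤ i.val ∧ k = 8) → k = j := by
      revert i
      decide
    obtain ⟨j, hj⟩ := hj
    refine ⟨{.a, if i.val < 4 then .b₁ else .b₂, .c j}, Finset.card_le_three, fun w hw => ?_⟩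
    rw [ad i hi] at hw
    cases w with
    | a => simp
    | b₁ => simp [show i.val < 4 from hw]
    | b₂ => simp [show ¬ i.val < 4 from not_lt.2 hw]
    | c k => simp [hj k hw]
  refine ⟨⟨_, 0, by decide, rfl⟩, by simp, ?_, ?_, ?_⟩
  · rintro _ ⟨i, hi, rfl⟩
    rw [adj_comm, ad i hi]
    trivial
  · intro z hz hzA
    cases z with
    | a => exact absurd rfl hz
    | b₁ => exact ⟨.c 0, ⟨0, by decide, rfl⟩, .c 1, ⟨1, by decide, rfl⟩, by simp,
        by rw [adj_comm, ad _ (by decide)]; decide, by rw [adj_comm, ad _ (by decide)]; decide⟩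
    | b₂ => exact ⟨.c 4, ⟨4, by decide, rfl⟩, .c 5, ⟨5, by decide, rfl⟩, by simp,
        by rw [adj_comm, ad _ (by decide)]; decide, by rw [adj_comm, ad _ (by decide)]; decide⟩
    | c i =>
      have hi : i = 8 := by
        by_contra h
        exact hzA ⟨i, by omega, rfl⟩
      subst hi
      exact ⟨.c 6, ⟨6, by decide, rfl⟩, .c 7, ⟨7, by decide, rfl⟩, by simp,
        by rw [adj_comm, ad _ (by decide)]; decide, by rw [adj_comm, ad _ (by decide)]; decide⟩
  · rintro _ ⟨i, hi, rfl⟩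
    have : ∃ j : Fin 9, j.val < 8 ∧ i ≠ j ∧ ¬ ((i.val < 6 ∧ i ≠ j ∧ i.val / 2 = j.val / 2) ∨
        (6 ≤ i.val ∧ j = 8)) := by
      revert i
      decide
    obtain ⟨j, hj8, hij, hj⟩ := this
    exact ⟨.c j, ⟨j, hj8, rfl⟩, by simpa using hij, by rw [ad i hi]; exact hj, 3, 3,
      Or.inr (Or.inl ⟨by norm_num, rfl, rfl⟩), hnb i hi, hnb j hj8⟩

/-- All exceptional graphs in which `a` and `b` may or may not be adjacent. -/
lemma isProfile_of_graphH {s : ℕ} (hs : 2 ≤ s) {K : SimpleGraph (VertexH s s)}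
    (hK : ∀ p q, s(p, q) ≠ s(.a, .b) → (K.Adj p q ↔ (graphH s s).Adj p q)) :
    K.IsProfile (2 * s + 2) .a {p | p ≠ .a ∧ p ≠ .b} := by
  have i0 : Fin (s - 1) := ⟨0, by omega⟩
  have h1 : ∃ t : Finset (VertexH s s), t.card ≤ 2 ∧ ∀ w, K.Adj .c₁ w → w ∈ t := by
    refine ⟨{.a, .c₂}, Finset.card_le_two, fun w hw => ?_⟩
    rw [hK _ _ (by simp)] at hw
    cases w <;> simp [graphH, relH] at hw ⊢
  have h2 : ∃ t : Finset (VertexH s s), t.card ≤ 2 ∧ ∀ w, K.Adj .c₂ w → w ∈ t := by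
    refine ⟨{.a, .c₁}, Finset.card_le_two, fun w hw => ?_⟩
    rw [hK _ _ (by simp)] at hw
    cases w <;> simp [graphH, relH] at hw ⊢
  have h3 : ∀ i, ∃ t : Finset (VertexH s s), t.card ≤ s ∧ ∀ w, K.Adj (.x i) w → w ∈ t := by
    intro i
    refine ⟨insert .a (insert .b ((Finset.univ.erase i).image .x)), ?_, fun w hw => ?_⟩
    · refine (Finset.card_insert_le _ _).trans ?_
      have := Finset.card_insert_le VertexH.b ((Finset.univ.erase i).image (VertexH.x (t := s)))
      have h' := Finset.card_image_le (s := Finset.univ.erase i) (f := VertexH.x (t := s))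
      rw [Finset.card_erase_of_mem (Finset.mem_univ _), Finset.card_univ, Fintype.card_fin] at h'
      omega
    · rw [hK _ _ (by simp)] at hw
      cases w <;> simp [graphH, relH] at hw ⊢
      exact Ne.symm hw
  have h4 : ∀ i, ∃ t : Finset (VertexH s s), t.card ≤ s ∧ ∀ w, K.Adj (.y i) w → w ∈ t := by
    intro i
    refine ⟨insert .a (insert .b ((Finset.univ.erase i).image .y)), ?_, fun w hw => ?_⟩
    · refine (Finset.card_insert_le _ _).trans ?_
      have := Finset.card_insert_le VertexH.b ((Finset.univ.erase i).image (VertexH.y (s := s)))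
      have h' := Finset.card_image_le (s := Finset.univ.erase i) (f := VertexH.y (s := s))
      rw [Finset.card_erase_of_mem (Finset.mem_univ _), Finset.card_univ, Fintype.card_fin] at h'
      omega
    · rw [hK _ _ (by simp)] at hw
      cases w <;> simp [graphH, relH] at hw ⊢
      exact Ne.symm hw
  refine ⟨⟨.c₁, by simp⟩, by simp, ?_, ?_, ?_⟩
  · rintro p ⟨hpa, hpb⟩
    rw [hK _ _ (by simp [hpb])]
    cases p <;> simp [graphH, relH] at hpa hpb ⊢
  · intro z hz hzA
    have hzb : z = .b := by
      by_contra h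
      exact hzA ⟨hz, h⟩
    subst hzb
    refine ⟨.x i0, by simp, .y i0, by simp, by simp, ?_, ?_⟩ <;>
    · rw [hK _ _ (by simp)]
      simp [graphH, relH]
  · rintro p ⟨hpa, hpb⟩
    cases p with
    | a => exact absurd rfl hpa
    | b => exact absurd rfl hpb
    | c₁ => exact ⟨.x i0, by simp, by simp, by rw [hK _ _ (by simp)]; simp [graphH, relH], 2, s,
        Or.inr (Or.inr ⟨s, hs, rfl, Or.inr ⟨rfl, rfl⟩⟩), h1, h3 i0⟩
    | c₂ => exact ⟨.x i0, by simp, by simp, by rw [hK _ _ (by simp)]; simp [graphH, relH], 2, s,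
        Or.inr (Or.inr ⟨s, hs, rfl, Or.inr ⟨rfl, rfl⟩⟩), h2, h3 i0⟩
    | x i => exact ⟨.c₁, by simp, by simp, by rw [hK _ _ (by simp)]; simp [graphH, relH], s, 2,
        Or.inr (Or.inr ⟨s, hs, rfl, Or.inl ⟨rfl, rfl⟩⟩), h3 i, h1⟩
    | y i => exact ⟨.c₁, by simp, by simp, by rw [hK _ _ (by simp)]; simp [graphH, relH], s, 2,
        Or.inr (Or.inr ⟨s, hs, rfl, Or.inl ⟨rfl, rfl⟩⟩), h4 i, h1⟩

lemma graphHMinus_adj {s t : ℕ} (p q : VertexH s t) (h : s(p, q) ≠ s(.a, .b)) :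
    (graphHMinus s t).Adj p q ↔ (graphH s t).Adj p q := by
  rw [graphHMinus, deleteEdges_adj, Set.mem_singleton_iff]
  exact and_iff_left h

lemma IsExceptional.exists_isProfile {W : Type*} [Fintype W] {H : SimpleGraph W}
    (h : H.IsExceptional) (hne : ¬ Nonempty (H ≃g (⊤ : SimpleGraph (Fin 2)))) :
    ∃ u A, H.IsProfile (Fintype.card W) u A := by
  rcases h with h | ⟨⟨φ⟩⟩ | ⟨L, hL, ⟨φ⟩⟩ | ⟨L, hL, -, ⟨φ⟩⟩ | ⟨s, hs, hcard, ⟨⟨φ⟩⟩ | ⟨⟨φ⟩⟩⟩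
  · exact absurd h hne
  · have := Fintype.card_congr φ.toEquiv
    rw [this]
    exact ⟨_, _, isProfile_graphF5.of_iso φ⟩
  · have := (Nat.card_congr φ.toEquiv).trans (VertexF.card 8).1
    rw [Nat.card_eq_fintype_card] at this
    rw [this]
    exact ⟨_, _, (isProfile_graphF11 hL).of_iso φ⟩
  · have := (Nat.card_congr φ.toEquiv).trans (VertexF.card 9).1
    rw [Nat.card_eq_fintype_card] at this
    rw [this]
    exact ⟨_, _, (isProfile_graphF12 hL).of_iso φ⟩
  · rw [← hcard]
    exact ⟨_, _, (isProfile_of_graphH hs fun _ _ _ => Iff.rfl).of_iso φ⟩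
  · rw [← hcard]
    exact ⟨_, _, (isProfile_of_graphH hs graphHMinus_adj).of_iso φ⟩

end Profile

/-! ### 2-connectedness from two hubs -/

section Hub

variable {V : Type u} [DecidableEq V] {G : SimpleGraph V}

/-- Every vertex reaches the hub `h` through `A`, so both sides of a separation would contain `h`.
-/
lemma conn_of_hub {s : Finset V} {h : V} (hh : h ∈ s) (A : Set V) (hA : ∀ x ∈ A, G.Adj h x)
    (hs : ∀ z ∈ s, z ≠ h → z ∉ A → ∃ x ∈ A, x ∈ s ∧ G.Adj z x) : G.Conn s := by
  have key : ∀ B ⊆ s, (∀ u ∈ B, ∀ v ∈ s, v ∉ B → ¬ G.Adj u v) → B.Nonempty → h ∈ B := by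
    rintro B hB hno ⟨z, hz⟩
    by_contra hhB
    have hA' : ∀ x ∈ A, x ∉ B := fun x hx hxB => hno x hxB h hh hhB (hA x hx).symm
    by_cases hzA : z ∈ A
    · exact hA' z hzA hz
    · obtain ⟨x, hx, hxs, ha⟩ := hs z (hB hz) (fun h' => hhB (h' ▸ hz)) hzA
      exact hno z hz x hxs (hA' x hx) ha
  by_contra hnc
  obtain ⟨B, hB, hB1, hB2, hno⟩ := not_conn ⟨h, hh⟩ hnc
  have h1 := key B hB (fun u hu v hv hvB => hno u hu v (Finset.mem_sdiff.2 ⟨hv, hvB⟩)) hB1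
  have h2 := key (s \ B) Finset.sdiff_subset (fun u hu v hv hvB ha => by
    rw [Finset.mem_sdiff, not_and, not_not] at hvB
    exact hno v (hvB hv) u hu ha.symm) hB2
  exact (Finset.mem_sdiff.1 h2).2 h1

/-- After the deletion of one vertex, one hub survives, and each vertex outside `A` keeps one of its
two neighbours in `A`. -/
lemma twoConn_of_hubs {s : Finset V} {h h' : V} (hh : h ∈ s) (hh' : h' ∈ s) (hne : h ≠ h')
    (A : Set V) (hAs : ∀ x ∈ A, x ∈ s) (hA : ∀ x ∈ A, G.Adj h x ∧ G.Adj h' x)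
    (hs : ∀ z ∈ s, z ≠ h → z ≠ h' → z ∉ A → ∃ x ∈ A, ∃ y ∈ A, x ≠ y ∧ G.Adj z x ∧ G.Adj z y)
    (h2 : ∃ x ∈ A, ∃ y ∈ A, x ≠ y) : G.TwoConn s := by
  have pick : ∀ z ∈ s, z ∉ A → ∃ x ∈ A, ∃ y ∈ A, x ≠ y ∧ G.Adj z x ∧ G.Adj z y := by
    intro z hz hzA
    by_cases hzh : z = h
    · obtain ⟨x, hx, y, hy, hxy⟩ := h2
      exact ⟨x, hx, y, hy, hxy, hzh ▸ (hA x hx).1, hzh ▸ (hA y hy).1⟩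
    · by_cases hzh' : z = h'
      · obtain ⟨x, hx, y, hy, hxy⟩ := h2
        exact ⟨x, hx, y, hy, hxy, hzh' ▸ (hA x hx).2, hzh' ▸ (hA y hy).2⟩
      · exact hs z hz hzh hzh' hzA
  obtain ⟨x, hx, y, hy, hxy⟩ := h2
  refine ⟨?_, ?_, fun w hw => ?_⟩
  · have hsub : ({h, h', x} : Finset V) ⊆ s := by
      intro z hz
      simp only [Finset.mem_insert, Finset.mem_singleton] at hz
      rcases hz with rfl | rfl | rfl
      exacts [hh, hh', hAs _ hx]
    have := Finset.card_le_card hsub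
    rwa [Finset.card_eq_three.2 ⟨h, h', x, hne, (hA x hx).1.ne, (hA x hx).2.ne, rfl⟩] at this
  · refine conn_of_hub hh A (fun x hx => (hA x hx).1) fun z hz _ hzA => ?_
    obtain ⟨x, hx, -, -, -, ha, -⟩ := pick z hz hzA
    exact ⟨x, hx, hAs x hx, ha⟩
  · have key : ∀ k ∈ s.erase w, (∀ x ∈ A, G.Adj k x) → G.Conn (s.erase w) := by
      intro k hk hkA
      refine conn_of_hub hk A hkA fun z hz _ hzA => ?_
      obtain ⟨x, hx, y, hy, hxy, h3, h4⟩ := pick z (Finset.mem_of_mem_erase hz) hzA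
      by_cases hxw : x = w
      · exact ⟨y, hy, Finset.mem_erase.2 ⟨fun h => hxy (hxw.trans h.symm), hAs y hy⟩, h4⟩
      · exact ⟨x, hx, Finset.mem_erase.2 ⟨hxw, hAs x hx⟩, h3⟩
    by_cases hwh : h = w
    · exact key h' (Finset.mem_erase.2 ⟨fun h' => hne (hwh.trans h'.symm), hh'⟩)
        fun x hx => (hA x hx).2
    · exact key h (Finset.mem_erase.2 ⟨hwh, hh⟩) fun x hx => (hA x hx).1

end Hub

/-! ### An exceptional rest is itself a surplus or triangle piece -/

section ExceptionalRest

variable {V W : Type u} [Fintype V] [DecidableEq V] [Fintype W] [DecidableEq W]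
  {G : SimpleGraph V} {f : W ↪ V} {c : V} {D : Finset V}

lemma IsRest.attach (h : IsRest f c D) (hat : G.Attach c D) : G.Attach c (Finset.univ.map f) := by
  rw [h.2]
  refine ⟨by simp, fun u hu v hv ha => ?_⟩
  rw [Finset.mem_compl] at hu
  rw [Finset.mem_compl, not_not] at hv
  rcases Finset.mem_insert.1 hv with hv | hv
  · exact hv
  · exact absurd ha.symm (hat.not_adj hv hu)

lemma IsProfile.dIn_le {u : W} {A : Set W} {N e : ℕ} {H : SimpleGraph W}
    (_ : H.IsProfile N u A) {x : W} (ht : ∃ t : Finset W, t.card ≤ e ∧ ∀ w, H.Adj x w → w ∈ t) :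
    H.dIn Finset.univ x ≤ e := by
  obtain ⟨t, ht, hx⟩ := ht
  exact (dIn_le_card_of_forall fun w _ ha => hx w ha).trans ht

/-- A vertex of `A` not adjacent to `c` keeps its small degree in `G`. The product condition against
the low-degree vertex `y` of `D`, and against its nonneighbour `x'` within the profile, then fails.
-/
lemma IsRest.adj_of_isProfile (h : IsRest f c D) (hat : G.Attach c D) (hG : G.ProductCond)
    (hD : ∃ y ∈ D, ∃ y' ∈ D, G.dIn Finset.univ y + G.dIn Finset.univ y' ≤ D.card + 1)
    {u : W} {A : Set W} (hp : (G.comap f).IsProfile (Fintype.card W) u A) :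
    ∀ x ∈ A, G.Adj c (f x) := by
  classical
  intro x hx
  by_contra hcx
  obtain ⟨y, hy, y', hy', hyy⟩ := hD
  wlog hle : G.dIn Finset.univ y ≤ G.dIn Finset.univ y' generalizing y y'
  · exact this y' hy' y hy (by omega) (by omega)
  obtain ⟨x', hx', hne, hna, e, e', hb, h1, h2⟩ := hp.low x hx
  have d1 := h.dIn_eq hat x
  rw [if_neg fun ha => hcx ha.symm] at d1
  have d1' := hp.dIn_le h1
  have d2 := h.dIn_le hat x'
  have d2' := hp.dIn_le h2
  have hcard := h.card
  have hyX : ∀ w, y ≠ f w ∧ ¬ G.Adj y (f w) := fun w =>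
    ⟨fun h' => h.notMem w (Finset.mem_insert_of_mem (h' ▸ hy)), hat.not_adj hy (h.notMem w)⟩
  have hne' := f.injective.ne hne
  have e1 := hG y (f x) (f x) (hyX x).1 (hyX x).2
  have e2 := hG y (f x') (f x') (hyX x').1 (hyX x').2
  have e3 := hG (f x) (f x') (f x') hne' hna
  have e4 := hG (f x) (f x') (f x) hne' hna
  generalize G.dIn Finset.univ (f x) = p at *
  generalize G.dIn Finset.univ (f x') = q at *
  generalize G.dIn Finset.univ y = a at *
  generalize G.dIn Finset.univ y' = b at *
  have m : ∀ {x y z : ℕ}, y ≤ z → x * y ≤ x * z := fun h => Nat.mul_le_mul_left _ h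
  have m' : ∀ {x y z : ℕ}, y ≤ z → y * x ≤ z * x := fun h => Nat.mul_le_mul_right _ h
  -- From 2a ≤ a + b ≤ |D| + 1 we have n ≥ |W| + 2a. When p ≤ 2 this contradicts n ≤ ap + p. In the
  -- other cases n ≤ 3a + 3 forces `a`, and with it n, to be too large for the product pq.
  rcases hb with ⟨hN, rfl, rfl⟩ | ⟨hN, rfl, rfl⟩ | ⟨s, hs, hN, ⟨rfl, rfl⟩ | ⟨rfl, rfl⟩⟩
  · have := m (x := a) (show p ≤ 2 by omega)
    omega
  · have := m (x := a) (show p ≤ 3 by omega)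
    have := m (x := p) (show q ≤ 4 by omega)
    omega
  · have := m (x := a) (show q ≤ 3 by omega)
    have := m (x := p) (show q ≤ 3 by omega)
    omega
  · have := m (x := a) (show p ≤ 2 by omega)
    omega

/-- The hubs `c` and `f u` make the rest together with `c` a single 2-connected part, while `x` and
`x'` form an independent set of size two. -/
lemma IsRest.surplus_of_isProfile (h : IsRest f c D) (hat : G.Attach c D) {u : W} {A : Set W}
    (hp : (G.comap f).IsProfile (Fintype.card W) u A) (hA : ∀ x ∈ A, G.Adj c (f x)) :
    G.Surplus c (Finset.univ.map f) := by
  obtain ⟨x, hx⟩ := hp.nonempty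
  obtain ⟨x', hx', hne, hna, e, e', hb, h1, h2⟩ := hp.low x hx
  have hne' := f.injective.ne hne
  have mem : ∀ w, f w ∈ Finset.univ.map f := fun w => Finset.mem_map_of_mem f (Finset.mem_univ w)
  have htc : G.TwoConn (insert c (Finset.univ.map f)) := by
    refine twoConn_of_hubs (h := c) (h' := f u) (Finset.mem_insert_self _ _)
      (Finset.mem_insert_of_mem (mem u))
      (fun h' => h.notMem u (h' ▸ Finset.mem_insert_self _ _)) (f '' A) ?_ ?_ ?_
      ⟨f x, ⟨x, hx, rfl⟩, f x', ⟨x', hx', rfl⟩, hne'⟩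
    · rintro _ ⟨w, -, rfl⟩
      exact Finset.mem_insert_of_mem (mem w)
    · rintro _ ⟨w, hw, rfl⟩
      exact ⟨hA w hw, hp.adj w hw⟩
    · intro z hz hzc hzu hzA
      obtain ⟨w, -, rfl⟩ := Finset.mem_map.1 (Finset.mem_of_mem_insert_of_ne hz hzc)
      obtain ⟨p, hpA, q, hq, hpq, k1, k2⟩ := hp.two w (fun h' => hzu (h' ▸ rfl))
        (fun h' => hzA ⟨w, h', rfl⟩)
      exact ⟨f p, ⟨p, hpA, rfl⟩, f q, ⟨q, hq, rfl⟩, f.injective.ne hpq, k1, k2⟩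
  have d1 := h.dIn_le hat x
  have d1' := hp.dIn_le h1
  have d2 := h.dIn_le hat x'
  have d2' := hp.dIn_le h2
  have hsum : G.dIn Finset.univ (f x) + G.dIn Finset.univ (f x') ≤ Fintype.card W + 1 := by
    rcases hb with ⟨hN, rfl, rfl⟩ | ⟨hN, rfl, rfl⟩ | ⟨s, hs, hN, ⟨rfl, rfl⟩ | ⟨rfl, rfl⟩⟩ <;> omega
  refine ⟨{f x, f x'}, ?_, ?_, ⟨1, htc.hasPart, ?_⟩, ?_, f x, mem x, f x', mem x', ?_⟩
  · intro z hz
    rcases Finset.mem_insert.1 hz with rfl | hz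
    · exact mem x
    · rw [Finset.mem_singleton.1 hz]
      exact mem x'
  · intro p hp' q hq ha
    simp only [Finset.mem_insert, Finset.mem_singleton] at hp' hq
    rcases hp' with rfl | rfl <;> rcases hq with rfl | rfl
    exacts [ha.ne rfl, hna ha, hna ha.symm, ha.ne rfl]
  · rw [Finset.card_pair hne']
  · rw [Finset.card_pair hne', Finset.sum_pair hne', Finset.card_map, Finset.card_univ]
    omega
  · rw [Finset.card_map, Finset.card_univ]
    exact hsum

/-- Minimum degree 2 forces both ends of the remaining edge to be adjacent to `c`. -/
lemma IsRest.trianglePiece (h : IsRest f c D) (hat : G.Attach c D)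
    (h2 : ∀ v, 2 ≤ G.dIn Finset.univ v)
    (φ : G.comap f ≃g (⊤ : SimpleGraph (Fin 2))) : G.TrianglePiece c (Finset.univ.map f) := by
  classical
  have hW : (Finset.univ : Finset W) = {φ.symm 0, φ.symm 1} := by
    ext w
    simp only [Finset.mem_univ, Finset.mem_insert, Finset.mem_singleton, true_iff]
    have : φ w = 0 ∨ φ w = 1 := by omega
    rcases this with h | h
    · left; rw [← h]; simp
    · right; rw [← h]; simp
  have hadj : (G.comap f).Adj (φ.symm 0) (φ.symm 1) := by
    rw [φ.symm.map_adj_iff]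
    simp
  have hc : ∀ w, G.Adj c (f w) := by
    intro w
    by_contra hcw
    have h3 := h.dIn_eq hat w
    rw [if_neg fun ha => hcw ha.symm] at h3
    have h4 := dIn_add_one_le_card (G := G.comap f) (Finset.mem_univ w)
    rw [hW, Finset.card_pair hadj.ne, ← hW] at h4
    have := h2 (f w)
    omega
  exact ⟨f (φ.symm 0), f (φ.symm 1), by rw [hW, Finset.map_insert, Finset.map_singleton],
    hadj, hc _, hc _⟩

end ExceptionalRest

/-! ### Recognising the families ℱ₁₁ and ℱ₁₂ -/

section Isomorphisms

variable {V : Type u} [Fintype V] [DecidableEq V] {G : SimpleGraph V}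

/-- The centres of the two copies of F₅ become `b₁` and `b₂`, and `c` becomes `a`; the edges from
`c` to the centres are optional and make up `L`. -/
lemma exceptional_of_F5_F5 {c : V} {P Q : Fin 5 → V} (hV : Fintype.card V = 11)
    (hcover : ∀ v, v = c ∨ (∃ i, v = P i) ∨ ∃ i, v = Q i)
    (hP : ∀ i j, G.Adj (P i) (P j) ↔ graphF5.Adj i j)
    (hQ : ∀ i j, G.Adj (Q i) (Q j) ↔ graphF5.Adj i j)
    (hPQ : ∀ i j, ¬ G.Adj (P i) (Q j)) (hcP : ∀ i, i ≠ 0 → G.Adj c (P i))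
    (hcQ : ∀ i, i ≠ 0 → G.Adj c (Q i)) : G.IsExceptional := by
  let F : VertexF 8 → V := fun p => match p with
    | .a => c
    | .b₁ => P 0
    | .b₂ => Q 0
    | .c i => ![P 1, P 2, P 3, P 4, Q 1, Q 2, Q 3, Q 4] i
  have hsurj : Function.Surjective F := by
    intro v
    rcases hcover v with rfl | ⟨i, rfl⟩ | ⟨i, rfl⟩
    · exact ⟨.a, rfl⟩
    · fin_cases i
      exacts [⟨.b₁, rfl⟩, ⟨.c 0, rfl⟩, ⟨.c 1, rfl⟩, ⟨.c 2, rfl⟩, ⟨.c 3, rfl⟩]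
    · fin_cases i
      exacts [⟨.b₂, rfl⟩, ⟨.c 4, rfl⟩, ⟨.c 5, rfl⟩, ⟨.c 6, rfl⟩, ⟨.c 7, rfl⟩]
  have := (VertexF.card 8).2
  have hbij : Function.Bijective F := hsurj.bijective_of_nat_card_le (by
    rw [(VertexF.card 8).1, Nat.card_eq_fintype_card, hV])
  let L : Set (Sym2 (VertexF 8)) :=
    {e | (e = s(.a, .b₁) ∧ G.Adj c (P 0)) ∨ (e = s(.a, .b₂) ∧ G.Adj c (Q 0))}
  have hL : L ⊆ {s(.a, .b₁), s(.a, .b₂)} := by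
    rintro e (h | h)
    exacts [Or.inl h.1, Or.inr h.1]
  refine Or.inr (Or.inr (Or.inl ⟨L, hL, nonempty_iso_of_bijective F hbij ?_⟩))
  have hQP : ∀ i j, ¬ G.Adj (Q i) (P j) := fun i j h => hPQ j i h.symm
  have hcc : ∀ (i : Fin 8) p, (graphF11 L).Adj (.c i) p ↔ G.Adj (F (.c i)) (F p) := by
    intro i p
    rw [graphF11_adj_c hL]
    have hci : G.Adj (F (.c i)) c := by
      fin_cases i <;> first | exact (hcP _ (by decide)).symm | exact (hcQ _ (by decide)).symm
    cases p with
    | a => exact iff_of_true trivial hci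
    | b₁ => fin_cases i <;> simp [F, hP, hQP, graphF5_adj]
    | b₂ => fin_cases i <;> simp [F, hQ, hPQ, graphF5_adj]
    | c j => fin_cases i <;> fin_cases j <;> simp [F, hP, hQ, hPQ, hQP, graphF5_adj]
  intro p q
  cases p with
  | c i => exact hcc i q
  | a =>
    cases q with
    | c i => rw [adj_comm, G.adj_comm]; exact hcc i _
    | a => simp
    | b₁ => simp [graphF11, baseRelF11, L, F]
    | b₂ => simp [graphF11, baseRelF11, L, F]
  | b₁ =>
    cases q with
    | c i => rw [adj_comm, G.adj_comm]; exact hcc i _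
    | a => rw [adj_comm, G.adj_comm]; simp [graphF11, baseRelF11, L, F]
    | b₁ => simp
    | b₂ => simp [graphF11, baseRelF11, L, F, hPQ]
  | b₂ =>
    cases q with
    | c i => rw [adj_comm, G.adj_comm]; exact hcc i _
    | a => rw [adj_comm, G.adj_comm]; simp [graphF11, baseRelF11, L, F]
    | b₁ => simp [graphF11, baseRelF11, L, F, hQP]
    | b₂ => simp

/-- The vertex `a` of H becomes `b₂` and `b` becomes the last `c`-vertex. The alternatives in `hb`
are the two edges of which `L` must contain at least one. -/
lemma exceptional_of_F5_H {c : V} {P : Fin 5 → V} {Q : VertexH 2 2 → V}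
    (hV : Fintype.card V = 12)
    (hcover : ∀ v, v = c ∨ (∃ i, v = P i) ∨ ∃ i, v = Q i)
    (hP : ∀ i j, G.Adj (P i) (P j) ↔ graphF5.Adj i j)
    (hQ : ∀ p q, s(p, q) ≠ s(.a, .b) → (G.Adj (Q p) (Q q) ↔ (graphH 2 2).Adj p q))
    (hPQ : ∀ i j, ¬ G.Adj (P i) (Q j)) (hcP : ∀ i, i ≠ 0 → G.Adj c (P i))
    (hcQ : ∀ p, p ≠ .a → p ≠ .b → G.Adj c (Q p))
    (hb : G.Adj c (Q .b) ∨ G.Adj (Q .a) (Q .b)) : G.IsExceptional := by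
  let F : VertexF 9 → V := fun p => match p with
    | .a => c
    | .b₁ => P 0
    | .b₂ => Q .a
    | .c i => ![P 1, P 2, P 3, P 4, Q .c₁, Q .c₂, Q (.x 0), Q (.y 0), Q .b] i
  have hsurj : Function.Surjective F := by
    intro v
    rcases hcover v with rfl | ⟨i, rfl⟩ | ⟨i, rfl⟩
    · exact ⟨.a, rfl⟩
    · fin_cases i
      exacts [⟨.b₁, rfl⟩, ⟨.c 0, rfl⟩, ⟨.c 1, rfl⟩, ⟨.c 2, rfl⟩, ⟨.c 3, rfl⟩]
    · cases i with
      | a => exact ⟨.b₂, rfl⟩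
      | b => exact ⟨.c 8, rfl⟩
      | c₁ => exact ⟨.c 4, rfl⟩
      | c₂ => exact ⟨.c 5, rfl⟩
      | x i => exact ⟨.c 6, by rw [show i = 0 by omega]; rfl⟩
      | y i => exact ⟨.c 7, by rw [show i = 0 by omega]; rfl⟩
  have := (VertexF.card 9).2
  have hbij : Function.Bijective F := hsurj.bijective_of_nat_card_le (by
    rw [(VertexF.card 9).1, Nat.card_eq_fintype_card, hV])
  let L : Set (Sym2 (VertexF 9)) :=
    {e | (e = s(.a, .b₁) ∧ G.Adj c (P 0)) ∨ (e = s(.a, .b₂) ∧ G.Adj c (Q .a)) ∨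
      (e = s(.a, .c 8) ∧ G.Adj c (Q .b)) ∨ (e = s(.b₂, .c 8) ∧ G.Adj (Q .a) (Q .b))}
  have hL : L ⊆ {s(.a, .b₁), s(.a, .b₂), s(.a, .c 8), s(.b₂, .c 8)} := by
    rintro e (h | h | h | h)
    exacts [Or.inl h.1, Or.inr (Or.inl h.1), Or.inr (Or.inr (Or.inl h.1)),
      Or.inr (Or.inr (Or.inr h.1))]
  have hL' : (L ∩ {s(.a, .c 8), s(.b₂, .c 8)}).Nonempty := by
    rcases hb with hb | hb
    · exact ⟨s(.a, .c 8), Or.inr (Or.inr (Or.inl ⟨rfl, hb⟩)), Or.inl rfl⟩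
    · exact ⟨s(.b₂, .c 8), Or.inr (Or.inr (Or.inr ⟨rfl, hb⟩)), Or.inr rfl⟩
  refine Or.inr (Or.inr (Or.inr (Or.inl ⟨L, hL, hL', nonempty_iso_of_bijective F hbij ?_⟩)))
  have hQP : ∀ i j, ¬ G.Adj (Q i) (P j) := fun i j h => hPQ j i h.symm
  have hQ1 : ∀ p q, s(p, q) ≠ s(.a, .b) → (G.Adj (Q p) (Q q) ↔
    p ≠ q ∧ (relH 2 2 p q ∨ relH 2 2 q p)) := fun p q h => by
    rw [hQ p q h, graphH, fromRel_adj]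
  have hcc : ∀ (i : Fin 9), i.val < 8 → ∀ p, (graphF12 L).Adj (.c i) p ↔
      G.Adj (F (.c i)) (F p) := by
    intro i hi p
    rw [graphF12_adj_c hL i hi]
    have hci : G.Adj (F (.c i)) c := by
      fin_cases i <;> first
        | exact (hcP _ (by decide)).symm
        | exact (hcQ _ (by decide) (by decide)).symm
        | exact absurd hi (by decide)
    have h8 : i ≠ 8 := fun h => by simp [h] at hi
    cases p with
    | a => exact iff_of_true trivial hci
    | b₁ => fin_cases i <;> simp [F, hP, hQP, graphF5_adj] at hi h8 ⊢
    | b₂ => fin_cases i <;> simp [F, hQ1, hPQ, relH] at hi h8 ⊢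
    | c j =>
      fin_cases i <;> fin_cases j <;>
        simp [F, hP, hQ1, hPQ, hQP, graphF5_adj, relH] at hi h8 ⊢
  intro p q
  have hc8 : ∀ {i : Fin 9}, ¬ i.val < 8 → i = 8 := fun h => by omega
  have h8a : (graphF12 L).Adj (.c 8) .a ↔ G.Adj (F (.c 8)) (F .a) := by
    rw [G.adj_comm]
    simp [graphF12, baseRelF12, L, F]
  have h8b₁ : (graphF12 L).Adj (.c 8) .b₁ ↔ G.Adj (F (.c 8)) (F .b₁) := by
    simp [graphF12, baseRelF12, L, F, hQP]
  have h8b₂ : (graphF12 L).Adj (.c 8) .b₂ ↔ G.Adj (F (.c 8)) (F .b₂) := by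
    rw [G.adj_comm]
    simp [graphF12, baseRelF12, L, F]
  have hall : ∀ (i : Fin 9) p, (graphF12 L).Adj (.c i) p ↔ G.Adj (F (.c i)) (F p) := by
    intro i p
    by_cases hi : i.val < 8
    · exact hcc i hi p
    · rw [hc8 hi]
      cases p with
      | a => exact h8a
      | b₁ => exact h8b₁
      | b₂ => exact h8b₂
      | c j =>
        by_cases hj : j.val < 8
        · rw [adj_comm, G.adj_comm]
          exact hcc j hj _
        · rw [hc8 hj]
          simp
  cases p with
  | c i => exact hall i q
  | a =>
    cases q with
    | c i => rw [adj_comm, G.adj_comm]; exact hall i _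
    | a => simp
    | b₁ => simp [graphF12, baseRelF12, L, F]
    | b₂ => simp [graphF12, baseRelF12, L, F]
  | b₁ =>
    cases q with
    | c i => rw [adj_comm, G.adj_comm]; exact hall i _
    | a => rw [adj_comm, G.adj_comm]; simp [graphF12, baseRelF12, L, F]
    | b₁ => simp
    | b₂ => simp [graphF12, baseRelF12, L, F, hPQ]
  | b₂ =>
    cases q with
    | c i => rw [adj_comm, G.adj_comm]; exact hall i _
    | a => rw [adj_comm, G.adj_comm]; simp [graphF12, baseRelF12, L, F]
    | b₁ => simp [graphF12, baseRelF12, L, F, hQP]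
    | b₂ => simp

end Isomorphisms

/-! ### Both sides of the cut vertex exceptional -/

section BothExceptional

variable {V W W' : Type u} [Fintype V] [DecidableEq V] [Fintype W] [DecidableEq W]
  [Fintype W'] [DecidableEq W'] {G : SimpleGraph V} {f : W ↪ V} {g : W' ↪ V} {c : V}
  {D X : Finset V}

lemma IsRest.cover (hf : IsRest f c D) (hD : Finset.univ.map g = D) (v : V) :
    v = c ∨ (∃ w, v = f w) ∨ ∃ w, v = g w := by
  by_cases hv : v ∈ insert c D
  · rcases Finset.mem_insert.1 hv with h | h
    · exact Or.inl h
    · rw [← hD] at h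
      obtain ⟨w, -, rfl⟩ := Finset.mem_map.1 h
      exact Or.inr (Or.inr ⟨w, rfl⟩)
  · obtain ⟨w, rfl⟩ := hf.exists_eq hv
    exact Or.inr (Or.inl ⟨w, rfl⟩)

lemma IsRest.mem_of_map (hD : Finset.univ.map g = D) (w : W') : g w ∈ D := by
  rw [← hD]
  exact Finset.mem_map_of_mem g (Finset.mem_univ w)

lemma exceptional_of_iso_F5_F5 (hf : IsRest f c D) (hg : IsRest g c X) (hat : G.Attach c D)
    (hatX : G.Attach c X) (hD : Finset.univ.map g = D) (hG : G.ProductCond)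
    (hsD : G.Surplus c D) (hsX : G.Surplus c X)
    (φ : G.comap f ≃g graphF5) (ψ : G.comap g ≃g graphF5) : G.IsExceptional := by
  have c1 : Fintype.card W = 5 := Fintype.card_congr φ.toEquiv
  have c2 : Fintype.card W' = 5 := Fintype.card_congr ψ.toEquiv
  have c3 : D.card = Fintype.card W' := by rw [← hD, Finset.card_map, Finset.card_univ]
  obtain ⟨-, -, -, -, -, pD⟩ := hsD
  obtain ⟨-, -, -, -, -, pX⟩ := hsX
  have a1 := hf.adj_of_isProfile hat hG pD (by rw [c1]; exact isProfile_graphF5.of_iso φ)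
  have a2 := hg.adj_of_isProfile hatX hG pX (by rw [c2]; exact isProfile_graphF5.of_iso ψ)
  have hcard := hf.card
  refine exceptional_of_F5_F5 (c := c) (P := fun i => f (φ.symm i)) (Q := fun i => g (ψ.symm i))
    (by omega) (fun v => ?_) (fun i j => φ.symm.map_adj_iff) (fun i j => ψ.symm.map_adj_iff)
    (fun i j ha => hat.not_adj (IsRest.mem_of_map hD (ψ.symm j)) (hf.notMem (φ.symm i)) ha.symm)
    (fun i hi => a1 _ (by simpa using hi)) (fun i hi => a2 _ (by simpa using hi))
  rcases hf.cover hD v with h | ⟨w, rfl⟩ | ⟨w, rfl⟩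
  · exact Or.inl h
  · exact Or.inr (Or.inl ⟨φ w, by simp⟩)
  · exact Or.inr (Or.inr ⟨ψ w, by simp⟩)

lemma exceptional_of_iso_F5_H (hf : IsRest f c D) (hg : IsRest g c X) (hat : G.Attach c D)
    (hatX : G.Attach c X) (hD : Finset.univ.map g = D) (hG : G.ProductCond)
    (hsD : G.Surplus c D) (hsX : G.Surplus c X) (h3 : ∀ w, 3 ≤ G.dIn Finset.univ (g w))
    {K : SimpleGraph (VertexH 2 2)}
    (hK : ∀ p q, s(p, q) ≠ s(.a, .b) → (K.Adj p q ↔ (graphH 2 2).Adj p q))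
    (φ : G.comap f ≃g graphF5) (ψ : G.comap g ≃g K) (c2 : Fintype.card W' = 6) :
    G.IsExceptional := by
  classical
  have c1 : Fintype.card W = 5 := Fintype.card_congr φ.toEquiv
  have c3 : D.card = Fintype.card W' := by rw [← hD, Finset.card_map, Finset.card_univ]
  obtain ⟨-, -, -, -, -, pD⟩ := hsD
  obtain ⟨-, -, -, -, -, pX⟩ := hsX
  have a1 := hf.adj_of_isProfile hat hG pD (by rw [c1]; exact isProfile_graphF5.of_iso φ)
  have a2 := hg.adj_of_isProfile hatX hG pX
    (by rw [c2]; exact (isProfile_of_graphH le_rfl hK).of_iso ψ)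
  have hcard := hf.card
  refine exceptional_of_F5_H (c := c) (P := fun i => f (φ.symm i)) (Q := fun i => g (ψ.symm i))
    (by omega) (fun v => ?_) (fun i j => φ.symm.map_adj_iff)
    (fun p q hpq => (show _ ↔ K.Adj p q from ψ.symm.map_adj_iff).trans (hK p q hpq))
    (fun i j ha => hat.not_adj (IsRest.mem_of_map hD (ψ.symm j)) (hf.notMem (φ.symm i)) ha.symm)
    (fun i hi => a1 _ (by simpa using hi)) (fun p h1 h2 => a2 _ (by simpa using ⟨h1, h2⟩)) ?_
  · rcases hf.cover hD v with h | ⟨w, rfl⟩ | ⟨w, rfl⟩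
    · exact Or.inl h
    · exact Or.inr (Or.inl ⟨φ w, by simp⟩)
    · exact Or.inr (Or.inr ⟨ψ w, by simp⟩)
  -- Without both edges, `b` would see only the single vertices of the two cliques, contradicting
  -- degree at least 3.
  · by_contra hcon
    rw [not_or] at hcon
    have hab : ¬ K.Adj .a .b := fun h => hcon.2 (ψ.symm.map_adj_iff.2 h)
    have h4 := hg.dIn_eq hatX (ψ.symm .b)
    rw [if_neg fun ha => hcon.1 ha.symm] at h4
    have h5 : (G.comap g).dIn Finset.univ (ψ.symm .b) ≤ ({ψ.symm (.x 0), ψ.symm (.y 0)} :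
        Finset W').card := dIn_le_card_of_forall fun w _ ha => by
      rw [← ψ.map_adj_iff, RelIso.apply_symm_apply] at ha
      have hwa : ψ w ≠ .a := fun h => hab (by rw [h] at ha; exact ha.symm)
      rw [hK _ _ (by simpa using hwa)] at ha
      have hw : w = ψ.symm (ψ w) := by simp
      rw [hw]
      generalize ψ w = p at ha hwa
      cases p with
      | a => exact absurd rfl hwa
      | b => exact absurd rfl ha.ne
      | c₁ => simp [graphH, relH] at ha
      | c₂ => simp [graphH, relH] at ha
      | x i => rw [show i = 0 by omega]; simp
      | y i => rw [show i = 0 by omega]; simp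
    have h6 := Finset.card_le_two (a := ψ.symm (VertexH.x 0)) (b := ψ.symm (VertexH.y 0))
    have := h3 (ψ.symm .b)
    omega

lemma IsProfile.exists_low {H : SimpleGraph W} {u : W} {A : Set W}
    (hp : H.IsProfile (Fintype.card W) u A) :
    ∃ x, (H.dIn Finset.univ x ≤ 2 ∧ 5 ≤ Fintype.card W) ∨
      (H.dIn Finset.univ x ≤ 3 ∧ 11 ≤ Fintype.card W) := by
  obtain ⟨x, hx⟩ := hp.nonempty
  obtain ⟨x', -, -, -, e, e', hb, h1, h2⟩ := hp.low x hx
  have d1 := hp.dIn_le h1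
  have d2 := hp.dIn_le h2
  rcases hb with ⟨hN, rfl, rfl⟩ | ⟨hN, rfl, rfl⟩ | ⟨s, hs, hN, ⟨rfl, rfl⟩ | ⟨rfl, rfl⟩⟩
  · exact ⟨x, Or.inl ⟨d1, by omega⟩⟩
  · exact ⟨x, Or.inr ⟨d1, hN⟩⟩
  · exact ⟨x', Or.inl ⟨d2, by omega⟩⟩
  · exact ⟨x, Or.inl ⟨d1, by omega⟩⟩

lemma IsExceptional.of_card_le {H : SimpleGraph W} (h : H.IsExceptional)
    (h5 : 5 ≤ Fintype.card W) (h6 : Fintype.card W ≤ 6) :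
    (Fintype.card W = 5 ∧ Nonempty (H ≃g graphF5)) ∨ (Fintype.card W = 6 ∧
      ∃ K : SimpleGraph (VertexH 2 2),
        (∀ p q, s(p, q) ≠ s(.a, .b) → (K.Adj p q ↔ (graphH 2 2).Adj p q)) ∧
        Nonempty (H ≃g K)) := by
  rcases h with ⟨⟨φ⟩⟩ | ⟨⟨φ⟩⟩ | ⟨L, hL, ⟨φ⟩⟩ | ⟨L, hL, -, ⟨φ⟩⟩ | ⟨s, hs, hcard, h⟩
  · have := Fintype.card_congr φ.toEquiv
    rw [Fintype.card_fin] at this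
    omega
  · exact Or.inl ⟨Fintype.card_congr φ.toEquiv, ⟨φ⟩⟩
  · have := (Nat.card_congr φ.toEquiv).trans (VertexF.card 8).1
    rw [Nat.card_eq_fintype_card] at this
    omega
  · have := (Nat.card_congr φ.toEquiv).trans (VertexF.card 9).1
    rw [Nat.card_eq_fintype_card] at this
    omega
  · obtain rfl : s = 2 := by omega
    refine Or.inr ⟨by omega, ?_⟩
    rcases h with h | h
    · exact ⟨_, fun _ _ _ => Iff.rfl, h⟩
    · exact ⟨_, graphHMinus_adj, h⟩

/-- Vertices on different sides are nonadjacent, so low-degree vertices from both sides bound the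
order of `G`. The sides can then only be of orders 5 and 5, or 5 and 6. -/
lemma exceptional_of_both (hf : IsRest f c D) (hg : IsRest g c X) (hat : G.Attach c D)
    (hatX : G.Attach c X) (hD : Finset.univ.map g = D) (hX : Finset.univ.map f = X)
    (hG : G.ProductCond) (hsD : G.Surplus c D) (hsX : G.Surplus c X)
    (ef : (G.comap f).IsExceptional) (eg : (G.comap g).IsExceptional)
    (pf : ∃ u A, (G.comap f).IsProfile (Fintype.card W) u A)
    (pg : ∃ u A, (G.comap g).IsProfile (Fintype.card W') u A) : G.IsExceptional := by
  obtain ⟨u, A, pf⟩ := pf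
  obtain ⟨u', A', pg⟩ := pg
  obtain ⟨x, hx⟩ := pf.exists_low
  obtain ⟨z, hz⟩ := pg.exists_low
  have hcard := hf.card
  have c3 : D.card = Fintype.card W' := by rw [← hD, Finset.card_map, Finset.card_univ]
  have hna : ∀ w w', f w ≠ g w' ∧ ¬ G.Adj (f w) (g w') := fun w w' =>
    ⟨fun h => hf.notMem w (Finset.mem_insert_of_mem (h ▸ IsRest.mem_of_map hD w')),
      fun h => hat.not_adj (IsRest.mem_of_map hD w') (hf.notMem w) h.symm⟩
  have hprod := fun w w' => hG (f w) (g w') (f w) (hna w w').1 (hna w w').2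
  have hprod' := fun w w' => hG (f w) (g w') (g w') (hna w w').1 (hna w w').2
  have dx := hf.dIn_le hat x
  have dz := hg.dIn_le hatX z
  have m : ∀ {a b a' b' : ℕ}, a ≤ a' → b ≤ b' → a * b ≤ a' * b' := Nat.mul_le_mul
  -- Adding `c` turns low degrees 2 and 3 into at most 3 and 4. Two vertices of degree at most 3
  -- give n ≤ 3 · 3 + 3 = 12; a side of order at least 11 would exceed the bounds 15 or 20 of the
  -- other cases.
  have hsum : (Fintype.card W + Fintype.card W' ≤ 11 ∧ 5 ≤ Fintype.card W ∧
      5 ≤ Fintype.card W') ∧ G.dIn Finset.univ (f x) ≤ 3 ∧ G.dIn Finset.univ (g z) ≤ 3 := by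
    have e1 := hprod x z
    have e2 := hprod' x z
    rcases hx with ⟨hx, hN⟩ | ⟨hx, hN⟩ <;> rcases hz with ⟨hz, hN'⟩ | ⟨hz, hN'⟩
    · have := m (dx.trans (Nat.succ_le_succ hx)) (dz.trans (Nat.succ_le_succ hz))
      omega
    · have := m (dx.trans (Nat.succ_le_succ hx)) (dz.trans (Nat.succ_le_succ hz))
      omega
    · have := m (dx.trans (Nat.succ_le_succ hx)) (dz.trans (Nat.succ_le_succ hz))
      omega
    · have := m (dx.trans (Nat.succ_le_succ hx)) (dz.trans (Nat.succ_le_succ hz))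
      omega
  obtain ⟨⟨hN, h5, h5'⟩, dx3, dz3⟩ := hsum
  -- A vertex of degree at most 2 would give n ≤ 2 · 3 + 2 = 8, but n ≥ 11.
  have hf3 : ∀ w, 3 ≤ G.dIn Finset.univ (f w) := fun w => by
    by_contra hcon
    have e1 := hprod w z
    have := m (show G.dIn Finset.univ (f w) ≤ 2 by omega) dz3
    omega
  have hg3 : ∀ w, 3 ≤ G.dIn Finset.univ (g w) := fun w => by
    by_contra hcon
    have e1 := hprod' x w
    have := m dx3 (show G.dIn Finset.univ (g w) ≤ 2 by omega)
    omega
  rcases ef.of_card_le h5 (by omega) with ⟨k1, ⟨φ⟩⟩ | ⟨k1, K, hK, ⟨φ⟩⟩ <;>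
    rcases eg.of_card_le h5' (by omega) with ⟨k2, ⟨ψ⟩⟩ | ⟨k2, K', hK', ⟨ψ⟩⟩
  · exact exceptional_of_iso_F5_F5 hf hg hat hatX hD hG hsD hsX φ ψ
  · exact exceptional_of_iso_F5_H hf hg hat hatX hD hG hsD hsX hg3 hK' φ ψ k2
  · exact exceptional_of_iso_F5_H hg hf hatX hat hX hG hsX hsD hf3 hK ψ φ k1
  · omega

end BothExceptional

/-! ### The induction on the order -/

section Main

/-- A nonneighbour `u` of `v` has degree at most n - 2, so d(v)d(u) + d(v) ≤ n - 1. Hence `v` is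
adjacent to all other vertices, of which there is just one. -/
lemma nonempty_iso_top {V : Type u} [Fintype V] [DecidableEq V] {G : SimpleGraph V}
    (hn : 2 ≤ Fintype.card V) (hG : G.ProductCond) {v : V} (hv : G.dIn Finset.univ v ≤ 1) :
    Nonempty (G ≃g (⊤ : SimpleGraph (Fin 2))) := by
  have hall : ∀ u, u ≠ v → G.Adj v u := by
    intro u hu
    by_contra ha
    have h1 := hG v u v hu.symm ha
    have h2 : G.dIn Finset.univ u ≤ ((Finset.univ.erase u).erase v).card :=
      dIn_le_card_of_forall fun w _ hw => by
        simp only [Finset.mem_erase, Finset.mem_univ, and_true]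
        exact ⟨fun h => ha (h ▸ hw.symm), hw.ne'⟩
    rw [Finset.card_erase_of_mem (Finset.mem_erase.2 ⟨hu.symm, Finset.mem_univ _⟩),
      Finset.card_erase_of_mem (Finset.mem_univ _), Finset.card_univ] at h2
    have := Nat.mul_le_mul_right (G.dIn Finset.univ u) hv
    omega
  have h1 : (Finset.univ.erase v).card ≤ G.dIn Finset.univ v := by
    refine Finset.card_le_card fun u hu => mem_nbrIn.2 ⟨Finset.mem_univ _, hall u ?_⟩
    exact Finset.ne_of_mem_erase hu
  rw [Finset.card_erase_of_mem (Finset.mem_univ _), Finset.card_univ] at h1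
  have hcard : Fintype.card V = 2 := by omega
  let e := Fintype.equivFinOfCardEq hcard
  refine ⟨⟨e, fun {a b} => ?_⟩⟩
  rw [top_adj, e.injective.ne_iff]
  refine ⟨fun hab => ?_, fun h => h.ne⟩
  have hc2 : (Finset.univ.erase v).card = 1 := by
    rw [Finset.card_erase_of_mem (Finset.mem_univ _), Finset.card_univ, hcard]
  by_cases hav : a = v
  · subst hav
    exact hall b hab.symm
  · by_cases hbv : b = v
    · subst hbv
      exact (hall a hav).symm
    · exact absurd (Finset.card_le_one.1 hc2.le a (Finset.mem_erase.2 ⟨hav, Finset.mem_univ _⟩) b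
        (Finset.mem_erase.2 ⟨hbv, Finset.mem_univ _⟩)) hab

theorem good_or_isExceptional (n : ℕ) : ∀ (V : Type u) [Fintype V] [DecidableEq V]
    (G : SimpleGraph V), Fintype.card V = n → 2 ≤ n → G.ProductCond →
    G.Good ∨ G.IsExceptional := by
  induction n using Nat.strong_induction_on with
  | _ n ih =>
    intro V _ _ G hV hn hG
    by_cases h2 : ∀ v, 2 ≤ G.dIn Finset.univ v
    swap
    · push Not at h2
      obtain ⟨v, hv⟩ := h2
      exact Or.inr (Or.inl (nonempty_iso_top (v := v) (by omega) hG (by omega)))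
    have : Nonempty V := Fintype.card_pos_iff.1 (by omega)
    have h1 : ∀ v, 1 ≤ G.dIn Finset.univ v := fun v => by have := h2 v; omega
    rcases good_or_needy hG h2 with hgood | ⟨c, D, hat, ⟨v, hv⟩, hD⟩
    · exact Or.inl hgood
    rcases hD with hD | hD
    swap
    · exact hD.good_or_exceptional hG h2 hat ⟨v, hv⟩
    -- Stated for an arbitrary surplus piece `E`, because it is applied twice: to `D`, and then to
    -- the rest of `D` with the roles exchanged.
    have step : ∀ (W : Type u) [Fintype W] [DecidableEq W] (f : W ↪ V) (E : Finset V),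
        IsRest f c E → G.Attach c E → G.Surplus c E → Nonempty W →
        (G.Good ∨ G.IsExceptional) ∨ ((G.comap f).IsExceptional ∧
          ∃ u A, (G.comap f).IsProfile (Fintype.card W) u A) := by
      intro W _ _ f E hf hatE hE hW
      have hcard := hf.card
      have hE' := hE
      obtain ⟨-, -, -, -, -, y, hy, y', hy', hyy⟩ := hE'
      have hW2 : 2 ≤ Fintype.card W := by
        obtain ⟨w⟩ := hW
        have h3 := hf.dIn_le hatE w
        have h4 := h2 (f w)
        have h5 := dIn_add_one_le_card (G := G.comap f) (Finset.mem_univ w)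
        rw [Finset.card_univ] at h5
        omega
      rcases ih (Fintype.card W) (by omega) W (G.comap f) rfl hW2
        (hf.productCond hatE hG h2 ⟨y, hy, y', hy', hyy⟩) with h | h
      · exact Or.inl (Or.inl (hf.good hatE hG h1 hE h))
      · by_cases hK : Nonempty (G.comap f ≃g (⊤ : SimpleGraph (Fin 2)))
        · obtain ⟨φ⟩ := hK
          refine Or.inl ((hf.trianglePiece hatE h2 φ).good_or_exceptional hG h2 (hf.attach hatE)
            ⟨y, fun hyX => ?_⟩)
          rw [hf.2] at hyX
          rcases Finset.mem_insert.1 hyX with rfl | h'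
          · exact hatE.1 hy
          · exact Finset.mem_compl.1 h' (Finset.mem_insert_of_mem hy)
        · exact Or.inr ⟨h, h.exists_isProfile hK⟩
    let f : {x // x ∉ insert c D} ↪ V := Function.Embedding.subtype _
    have hf : IsRest f c D := by
      refine ⟨hat.1, ?_⟩
      ext x
      simp [f]
    rcases step _ f D hf hat hD ⟨⟨v, hv⟩⟩ with h | ⟨ef, pf⟩
    · exact h
    have hatX := hf.attach hat
    have hsX : G.Surplus c (Finset.univ.map f) := by
      obtain ⟨u, A, hp⟩ := pf
      have hD' := hD
      obtain ⟨-, -, -, -, -, pD⟩ := hD'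
      exact hf.surplus_of_isProfile hat hp (hf.adj_of_isProfile hat hG pD hp)
    let g : {x // x ∈ D} ↪ V := Function.Embedding.subtype _
    have hgD : Finset.univ.map g = D := by
      ext x
      simp [g]
    have hg : IsRest g c (Finset.univ.map f) := by
      refine ⟨hatX.1, ?_⟩
      rw [hgD, hf.2]
      ext x
      have := hat.1
      simp only [Finset.mem_compl, Finset.mem_insert, not_or, not_and, not_not]
      constructor
      · intro hx
        exact ⟨fun h => this (h ▸ hx), fun _ => hx⟩
      · exact fun h => h.2 h.1
    obtain ⟨-, -, -, -, -, y, hy, -⟩ := id hD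
    rcases step _ g _ hg hatX hsX ⟨⟨y, hy⟩⟩ with h | ⟨eg, pg⟩
    · exact h
    exact Or.inr (exceptional_of_both hf hg hat hatX hgD rfl hG hD hsX ef eg pf pg)

end Main

/-! ### Translation to degrees and `k`-connectedness -/

section Conversion

variable {V : Type u} [Fintype V] [DecidableEq V] {G : SimpleGraph V}

lemma dIn_univ_eq_degree [DecidableRel G.Adj] (v : V) : G.dIn Finset.univ v = G.degree v := by
  unfold dIn
  rw [← card_neighborFinset_eq_degree]
  congr 1
  ext w
  simp [mem_nbrIn]

lemma productCond_of_minDegreeProduct [DecidableRel G.Adj]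
    (hπ : ((Fintype.card V - G.minDegree : ℕ) : ℕ∞) ≤ G.minDegreeProduct) : G.ProductCond := by
  intro u v w huv hadj
  simp only [dIn_univ_eq_degree]
  have h1 : G.minDegreeProduct ≤ ((G.degree u * G.degree v : ℕ) : ℕ∞) :=
    iInf_le_of_le u (iInf_le_of_le v (iInf_le_of_le huv (iInf_le_of_le hadj le_rfl)))
  have h2 : Fintype.card V - G.minDegree ≤ G.degree u * G.degree v := by
    exact_mod_cast hπ.trans h1
  have h3 := G.minDegree_le_degree w
  omega

/-- A walk from inside a proper subset to its outside has a crossing edge. Conversely, the set of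
vertices reachable from `u` has no leaving edge, so it is everything. -/
lemma induce_connected_iff {s : Set V} {t : Finset V} (h : ∀ x, x ∈ s ↔ x ∈ t) :
    (G.induce s).Connected ↔ G.Conn t := by
  classical
  constructor
  · intro hc
    refine ⟨?_, fun A hA ⟨a, ha⟩ hne => ?_⟩
    · obtain ⟨x⟩ := hc.nonempty
      exact ⟨x, (h x).1 x.2⟩
    · obtain ⟨b, hb, hbA⟩ : ∃ b ∈ t, b ∉ A := by
        by_contra hcon
        push Not at hcon
        exact hne (hA.antisymm hcon)
      obtain ⟨p⟩ := hc.preconnected ⟨a, (h a).2 (hA ha)⟩ ⟨b, (h b).2 hb⟩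
      obtain ⟨d, -, hd1, hd2⟩ := p.exists_boundary_dart {x | x.1 ∈ A} ha hbA
      exact ⟨d.fst, hd1, d.snd, (h _).1 d.snd.2, hd2, d.adj⟩
  · rintro ⟨⟨x, hx⟩, hc⟩
    have : Nonempty s := ⟨⟨x, (h x).2 hx⟩⟩
    refine ⟨fun u v => ?_⟩
    set A : Finset V := t.filter fun y => ∃ hy : y ∈ s, (G.induce s).Reachable u ⟨y, hy⟩ with hAdef
    have huA : u.1 ∈ A := Finset.mem_filter.2 ⟨(h _).1 u.2, u.2, Reachable.refl _⟩
    by_cases hAt : A = t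
    · have hv : v.1 ∈ A := hAt ▸ (h _).1 v.2
      exact (Finset.mem_filter.1 hv).2.2
    · obtain ⟨y, hy, z, hz, hzA, hyz⟩ := hc A (Finset.filter_subset _ _) ⟨_, huA⟩ hAt
      obtain ⟨-, hys, hr⟩ := Finset.mem_filter.1 hy
      refine absurd (Finset.mem_filter.2 ⟨hz, (h z).2 hz, hr.trans ?_⟩) hzA
      exact Adj.reachable (G := G.induce s) (u := ⟨y, hys⟩) (v := ⟨z, (h z).2 hz⟩) hyz

lemma isKConnected_two_iff_twoConn_univ : G.IsKConnected 2 ↔ G.TwoConn Finset.univ := by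
  unfold IsKConnected TwoConn
  rw [Nat.card_eq_fintype_card, Finset.card_univ]
  refine and_congr Iff.rfl ⟨fun h => ⟨?_, fun x _ => ?_⟩, fun h S hS => ?_⟩
  · exact (induce_connected_iff (by simp)).1 (h ∅ (by simp))
  · exact (induce_connected_iff (by simp)).1 (h {x} (by simp))
  · rcases Nat.le_one_iff_eq_zero_or_eq_one.1 (Nat.lt_succ_iff.1 hS) with h0 | h1
    · rw [Finset.card_eq_zero.1 h0]
      exact (induce_connected_iff (by simp)).2 h.1
    · obtain ⟨x, rfl⟩ := Finset.card_eq_one.1 h1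
      exact (induce_connected_iff (by simp)).2 (h.2 x (Finset.mem_univ x))

end Conversion

/-! ### Translation to partitions and α* -/

section Parts

variable {V : Type u} [Fintype V] [DecidableEq V] {G : SimpleGraph V}

lemma isKConnected_two_induce_iff (p : Finset V) :
    (G.induce (p : Set V)).IsKConnected 2 ↔ G.TwoConn p := by
  let f : (p : Set V) ↪ V := Function.Embedding.subtype _
  have hf : Finset.univ.map f = p := by
    ext x
    simp [f]
  have h := twoConn_comap (G := G) (f := f) Finset.univ
  rw [hf] at h
  exact isKConnected_two_iff_twoConn_univ.trans h

lemma HasPart.exists_finpartition {s : Finset V} {k : ℕ} (h : G.HasPart s k) :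
    ∃ P : Finpartition s, (∀ p ∈ P.parts, G.TwoConn p) ∧ P.parts.card ≤ k := by
  induction h with
  | empty => exact ⟨Finpartition.empty _, by simp, by simp⟩
  | @union p s k hp hs hd ih =>
    obtain ⟨P, hP, hk⟩ := ih
    have hne : p ≠ ⊥ := by
      rintro rfl
      have := hp.1
      simp at this
    refine ⟨P.extend hne hd.symm (Finset.union_comm s p), ?_, ?_⟩
    · intro q hq
      rcases Finset.mem_insert.1 hq with rfl | hq
      · exact hp
      · exact hP q hq
    · exact (Finset.card_insert_le _ _).trans (by omega)

lemma bddAbove_light [DecidableRel G.Adj] :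
    BddAbove {m : ℕ | ∃ I : Finset V, G.IsLightIndepSet I ∧ I.card = m} :=
  ⟨Fintype.card V, by rintro _ ⟨I, -, rfl⟩; exact Finset.card_le_univ I⟩

lemma Good.exists_isProperPartition [DecidableRel G.Adj] (h : G.Good) :
    ∃ P : Finpartition (Finset.univ : Finset V),
      G.IsProperPartition 2 P ∧ P.parts.card ≤ G.lightIndepNum := by
  obtain ⟨I, hI, hs, k, hk, hp⟩ := h
  obtain ⟨P, hP, hPk⟩ := hp.exists_finpartition
  refine ⟨P, fun p hp => (isKConnected_two_induce_iff p).2 (hP p hp), hPk.trans (hk.trans ?_)⟩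
  refine le_csSup bddAbove_light ⟨I, ⟨fun u hu v hv _ => hI u hu v hv, ?_⟩, rfl⟩
  simp only [dIn_univ_eq_degree] at hs
  omega

lemma lightIndepNum_le [DecidableRel G.Adj] {k : ℕ}
    (h : ∀ I : Finset V, G.IsLightIndepSet I → I.card ≤ k) : G.lightIndepNum ≤ k :=
  csSup_le' (by rintro _ ⟨I, hI, rfl⟩; exact h I hI)

end Parts

/-! ### Exceptional graphs without 2-proper partitions -/

section Obstruction

/-- `p` assigns to each vertex the part containing it in a partition of the vertex set into sets
inducing `2`-connected subgraphs. -/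
structure IsProperParts {T : Type*} [DecidableEq T] (K : SimpleGraph T) (p : T → Finset T) :
    Prop where
  mem : ∀ v, v ∈ p v
  eq : ∀ v w, w ∈ p v → p w = p v
  twoConn : ∀ v, K.TwoConn (p v)

variable {T : Type*} [DecidableEq T] {K : SimpleGraph T} {p : T → Finset T}

lemma IsProperPartition.isProperParts {V : Type*} [Fintype V] [DecidableEq V] {G : SimpleGraph V}
    {P : Finpartition (Finset.univ : Finset V)} (h : G.IsProperPartition 2 P) :
    G.IsProperParts P.part where
  mem v := P.mem_part (Finset.mem_univ v)
  eq v _ hw := P.part_eq_of_mem (P.part_mem.2 (Finset.mem_univ v)) hw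
  twoConn v := (isKConnected_two_induce_iff _).1 (h _ (P.part_mem.2 (Finset.mem_univ v)))

lemma IsProperParts.map {V : Type*} [DecidableEq V] {G : SimpleGraph V} {q : V → Finset V}
    (h : G.IsProperParts q) (φ : G ≃g K) :
    K.IsProperParts fun t => (q (φ.symm t)).map φ.toEquiv.toEmbedding where
  mem t := by
    rw [Finset.mem_map]
    exact ⟨φ.symm t, h.mem _, φ.apply_symm_apply t⟩
  eq t _ hw := by
    obtain ⟨v, hv, rfl⟩ := Finset.mem_map.1 hw
    have h1 := h.eq _ _ hv
    have h2 : φ.symm (φ.toEquiv.toEmbedding v) = v := φ.symm_apply_apply v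
    rw [h2, h1]
  twoConn t := by
    rw [← twoConn_comap]
    have : K.comap φ.toEquiv.toEmbedding = G := by
      ext x y
      exact φ.map_adj_iff
    rw [this]
    exact h.twoConn _

/-- A 2-connected set stays connected without `u`, so it cannot extend beyond a side whose only exit
is `u`. -/
lemma TwoConn.mem_side {s : Finset T} (hs : K.TwoConn s) {u x y : T} {A : Set T}
    (hA : ∀ v ∈ A, ∀ w ∈ s, K.Adj v w → w ∈ A ∨ w = u) (hx : x ∈ s) (hxA : x ∈ A) (hxu : x ≠ u)
    (hy : y ∈ s) (hyu : y ≠ u) : y ∈ A := by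
  classical
  have hc : K.Conn (s.erase u) := by
    by_cases hu : u ∈ s
    · exact hs.2.2 u hu
    · rw [Finset.erase_eq_of_notMem hu]
      exact hs.2.1
  by_contra hyA
  obtain ⟨v, hv, w, hw, hwA, hvw⟩ := hc.2 ((s.erase u).filter (· ∈ A)) (Finset.filter_subset _ _)
    ⟨x, Finset.mem_filter.2 ⟨Finset.mem_erase.2 ⟨hxu, hx⟩, hxA⟩⟩ fun h => hyA
      (Finset.filter_eq_self.1 h y (Finset.mem_erase.2 ⟨hyu, hy⟩))
  obtain ⟨hwu, hws⟩ := Finset.mem_erase.1 hw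
  rcases hA v (Finset.mem_filter.1 hv).2 w hws hvw with h | h
  · exact hwA (Finset.mem_filter.2 ⟨hw, h⟩)
  · exact hwu h

/-- Every vertex of a 2-connected set has at least two neighbours in it: otherwise `b` alone would
cut `v` off. -/
lemma TwoConn.mem_of_nbrs {s : Finset T} (hs : K.TwoConn s) {v a b : T} (hv : v ∈ s)
    (h : ∀ w ∈ s, K.Adj v w → w = a ∨ w = b) : a ∈ s := by
  by_contra ha
  have hb : ∀ y ∈ s, y ≠ b → y = v ∨ v = b := fun y hy hyb => by
    by_cases hvb : v = b
    · exact Or.inr hvb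
    · refine Or.inl (hs.mem_side (A := {v}) (u := b) ?_ hv rfl hvb hy hyb)
      rintro _ rfl w hw hvw
      rcases h w hw hvw with rfl | rfl
      · exact absurd hw ha
      · exact Or.inr rfl
  by_cases hvb : v = b
  · subst hvb
    obtain ⟨u, hu, w, hw, -, huw⟩ := hs.2.1.2 {v} (by simpa using hv) ⟨v, by simp⟩ (by
      intro hsv
      have := hs.1
      rw [← hsv] at this
      simp at this)
    rw [Finset.mem_singleton] at hu
    subst hu
    rcases h w hw huw with rfl | rfl
    · exact ha hw
    · exact huw.ne rfl
  · have hsub : s ⊆ {v, b} := fun y hy => by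
      rw [Finset.mem_insert, Finset.mem_singleton]
      by_cases hyb : y = b
      · exact Or.inr hyb
      · exact Or.inl ((hb y hy hyb).resolve_right hvb)
    have h1 := Finset.card_le_card hsub
    have h2 : ({v, b} : Finset T).card ≤ 2 := Finset.card_le_two
    have h3 := hs.1
    omega

/-- Two vertices of degree two hanging at a cut vertex `b` cannot be covered. -/
lemma IsProperParts.false_of_butterfly (h : K.IsProperParts p) {b x x' y y' : T}
    (hx : ∀ w ∈ p x, K.Adj x w → w = b ∨ w = x') (hx' : ∀ w ∈ p x, K.Adj x' w → w = b ∨ w = x)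
    (hy : ∀ w ∈ p y, K.Adj y w → w = b ∨ w = y') (hxb : x ≠ b) (hyb : y ≠ b) (hyx : y ≠ x)
    (hyx' : y ≠ x') : False := by
  -- The parts of `x` and `y` both contain `b`, hence coincide; but `b` separates `y` from {x, x'}.
  have h1 := h.eq _ _ ((h.twoConn x).mem_of_nbrs (h.mem x) hx)
  have h2 := h.eq _ _ ((h.twoConn y).mem_of_nbrs (h.mem y) hy)
  have hyp : y ∈ p x := by
    rw [← h1, h2]
    exact h.mem y
  have := (h.twoConn x).mem_side (A := {x, x'}) (u := b) ?_ (h.mem x) (by simp) hxb hyp hyb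
  · rcases this with h | h
    · exact hyx h
    · exact hyx' h
  · rintro v (rfl | rfl) w hw hvw
    · rcases hx w hw hvw with rfl | rfl
      · exact Or.inr rfl
      · exact Or.inl (by simp)
    · rcases hx' w hw hvw with rfl | rfl
      · exact Or.inr rfl
      · exact Or.inl (by simp)

/-- On each side of the cut vertex `a`, one of the two marked vertices must share the part of `a`:
otherwise the parts there avoid `a` and meet a butterfly. The part of `a`, however, cannot reach
both sides. -/
lemma IsProperParts.false_of_two_butterflies (h : K.IsProperParts p)
    {a b x x' y y' d z z' t t' : T} {A : Set T}
    (hA : ∀ v ∈ A, ∀ w, K.Adj v w → w ∈ A ∨ w = a) (hxA : x ∈ A) (hyA : y ∈ A)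
    (hzA : z ∉ A) (htA : t ∉ A) (hza : z ≠ a) (hta : t ≠ a) (hxa : x ≠ a) (hya : y ≠ a)
    (hx : ∀ w, K.Adj x w → w = a ∨ w = b ∨ w = x') (hx' : ∀ w, K.Adj x' w → w = a ∨ w = b ∨ w = x)
    (hy : ∀ w, K.Adj y w → w = a ∨ w = b ∨ w = y') (hxb : x ≠ b) (hyb : y ≠ b) (hyx : y ≠ x)
    (hyx' : y ≠ x')
    (hz : ∀ w, K.Adj z w → w = a ∨ w = d ∨ w = z') (hz' : ∀ w, K.Adj z' w → w = a ∨ w = d ∨ w = z)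
    (ht : ∀ w, K.Adj t w → w = a ∨ w = d ∨ w = t') (hzd : z ≠ d) (htd : t ≠ d) (htz : t ≠ z)
    (htz' : t ≠ z') : False := by
  have key : ∀ {b x x' y y' : T}, (∀ w, K.Adj x w → w = a ∨ w = b ∨ w = x') →
      (∀ w, K.Adj x' w → w = a ∨ w = b ∨ w = x) → (∀ w, K.Adj y w → w = a ∨ w = b ∨ w = y') →
      x ≠ b → y ≠ b → y ≠ x → y ≠ x' → x ∈ p a ∨ y ∈ p a := by
    intro b x x' y y' hx hx' hy h1 h2 h3 h4
    by_contra hcon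
    push Not at hcon
    have hax : a ∉ p x := fun hm => hcon.1 (h.eq _ _ hm ▸ h.mem x)
    have hay : a ∉ p y := fun hm => hcon.2 (h.eq _ _ hm ▸ h.mem y)
    refine h.false_of_butterfly (b := b) (x := x) (x' := x') (y := y) (y' := y') ?_ ?_ ?_ h1 h2 h3 h4
    · exact fun w hw ha => (hx w ha).resolve_left fun e => hax (e ▸ hw)
    · exact fun w hw ha => (hx' w ha).resolve_left fun e => hax (e ▸ hw)
    · exact fun w hw ha => (hy w ha).resolve_left fun e => hay (e ▸ hw)
  have side : ∀ {v w : T}, v ∈ p a → v ∈ A → v ≠ a → w ∈ p a → w ∉ A → w ≠ a → False :=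
    fun hv hvA hva hw hwA hwa => hwA ((h.twoConn a).mem_side (fun v hv w _ e => hA v hv w e)
      hv hvA hva hw hwa)
  rcases key hx hx' hy hxb hyb hyx hyx' with h1 | h1 <;>
    rcases key hz hz' ht hzd htd htz htz' with h2 | h2
  · exact side h1 hxA hxa h2 hzA hza
  · exact side h1 hxA hxa h2 htA hta
  · exact side h1 hyA hya h2 hzA hza
  · exact side h1 hyA hya h2 htA hta

lemma not_isProperParts_graphF5 (p : Fin 5 → Finset (Fin 5)) : ¬ graphF5.IsProperParts p := by
  intro h
  refine h.false_of_butterfly (b := 0) (x := 1) (x' := 2) (y := 3) (y' := 4) ?_ ?_ ?_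
    (by decide) (by decide) (by decide) (by decide) <;>
  · intro w _ hw
    rw [graphF5_adj] at hw
    clear * - hw
    revert w
    decide

lemma not_isProperParts_graphF11 {L : Set (Sym2 (VertexF 8))} (hL : L ⊆ {s(.a, .b₁), s(.a, .b₂)})
    (p : VertexF 8 → Finset (VertexF 8)) : ¬ (graphF11 L).IsProperParts p := by
  intro h
  have ad := graphF11_adj_c hL
  have nb : ∀ i : Fin 8, ∀ w, (graphF11 L).Adj (.c i) w → ∀ b : VertexF 8, ∀ j : Fin 8,
      (b = if i.val < 4 then .b₁ else .b₂) → j.val / 2 = i.val / 2 → j ≠ i →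
      w = .a ∨ w = b ∨ w = .c j := by
    rintro i w hw b j rfl hj hji
    rw [ad] at hw
    rcases w with _ | _ | _ | k
    · simp
    · simp_all
    · simp_all
    · simp only at hw
      right; right
      congr 1
      omega
  refine h.false_of_two_butterflies (a := .a) (b := .b₁) (d := .b₂) (x := .c 0) (x' := .c 1)
    (y := .c 2) (y' := .c 3) (z := .c 4) (z' := .c 5) (t := .c 6) (t' := .c 7)
    (A := {q | q = .b₁ ∨ ∃ i : Fin 8, i.val < 4 ∧ q = .c i}) ?_
    (Or.inr ⟨0, by decide, rfl⟩) (Or.inr ⟨2, by decide, rfl⟩) ?_ ?_ (by simp) (by simp) (by simp)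
    (by simp) (fun w hw => nb 0 w hw _ 1 rfl rfl (by decide))
    (fun w hw => nb 1 w hw _ 0 rfl rfl (by decide)) (fun w hw => nb 2 w hw _ 3 rfl rfl (by decide))
    (by simp) (by simp) (by simp) (by simp) (fun w hw => nb 4 w hw _ 5 rfl rfl (by decide))
    (fun w hw => nb 5 w hw _ 4 rfl rfl (by decide)) (fun w hw => nb 6 w hw _ 7 rfl rfl (by decide))
    (by simp) (by simp) (by simp) (by simp)
  · rintro v (rfl | ⟨i, hi, rfl⟩) w hw
    · rcases w with _ | _ | _ | k
      · simp
      · simp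
      · simp only [graphF11, sup_adj, fromRel_adj, fromEdgeSet_adj, baseRelF11] at hw
        rcases hw with ⟨-, hw | hw⟩ | ⟨hw, -⟩
        · exact hw.elim
        · exact hw.elim
        · simpa using hL hw
      · rw [adj_comm, ad] at hw
        exact Or.inl (Or.inr ⟨k, hw, rfl⟩)
    · rw [ad] at hw
      rcases w with _ | _ | _ | k
      · simp
      · simp
      · simp only at hw
        omega
      · simp only at hw
        exact Or.inl (Or.inr ⟨k, by omega, rfl⟩)
  · rintro (hq | ⟨i, hi, hq⟩)
    · cases hq
    · cases hq
      revert hi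
      decide
  · rintro (hq | ⟨i, hi, hq⟩)
    · cases hq
    · cases hq
      revert hi
      decide

end Obstruction

lemma not_isProperParts_graphF12 {L : Set (Sym2 (VertexF 9))}
    (hL : L ⊆ {s(.a, .b₁), s(.a, .b₂), s(.a, .c 8), s(.b₂, .c 8)})
    (p : VertexF 9 → Finset (VertexF 9)) : ¬ (graphF12 L).IsProperParts p := by
  intro h
  have ad := graphF12_adj_c hL
  have nb : ∀ i : Fin 9, i.val < 8 → ∀ w, (graphF12 L).Adj (.c i) w → ∀ b : VertexF 9, ∀ j : Fin 9,
      (b = if i.val < 4 then .b₁ else .b₂) →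
      (i.val < 6 ∧ j.val / 2 = i.val / 2 ∧ j ≠ i ∨ 6 ≤ i.val ∧ j = 8) →
      w = .a ∨ w = b ∨ w = .c j := by
    rintro i hi w hw b j rfl hj
    rw [ad i hi] at hw
    rcases w with _ | _ | _ | k
    · simp
    · simp_all
    · simp_all
    · simp only at hw
      right; right
      congr 1
      omega
  have n8 : ∀ w, (graphF12 L).Adj (.c 8) w → w = .a ∨ w = .b₂ ∨ w = .c 6 ∨ w = .c 7 := by
    intro w hw
    rw [adj_comm] at hw
    rcases w with _ | _ | _ | k
    · simp
    · simp only [graphF12, sup_adj, fromRel_adj, fromEdgeSet_adj, baseRelF12] at hw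
      rcases hw with ⟨-, hw | hw⟩ | ⟨hw, -⟩
      · revert hw
        decide
      · exact hw.elim
      · simpa using hL hw
    · simp
    · by_cases hk : k.val < 8
      · rw [ad k hk] at hw
        simp only at hw
        right; right
        rcases hw with hw | hw
        · have : (8 : Fin 9).val = 8 := rfl
          omega
        · have : k = 6 ∨ k = 7 := by omega
          simpa using this
      · have : k = 8 := by omega
        subst this
        exact absurd hw (graphF12 L).irrefl
  refine h.false_of_two_butterflies (a := .a) (b := .b₁) (d := .b₂) (x := .c 0) (x' := .c 1)
    (y := .c 2) (y' := .c 3) (z := .c 4) (z' := .c 5) (t := .c 6) (t' := .c 8)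
    (A := {q | q = .b₁ ∨ ∃ i : Fin 9, i.val < 4 ∧ q = .c i}) ?_
    (Or.inr ⟨0, by decide, rfl⟩) (Or.inr ⟨2, by decide, rfl⟩) ?_ ?_ (by simp) (by simp) (by simp)
    (by simp) (fun w hw => nb 0 (by decide) w hw _ 1 rfl (by decide))
    (fun w hw => nb 1 (by decide) w hw _ 0 rfl (by decide))
    (fun w hw => nb 2 (by decide) w hw _ 3 rfl (by decide))
    (by simp) (by simp) (by simp) (by simp)
    (fun w hw => nb 4 (by decide) w hw _ 5 rfl (by decide))
    (fun w hw => nb 5 (by decide) w hw _ 4 rfl (by decide))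
    (fun w hw => nb 6 (by decide) w hw _ 8 rfl (by decide))
    (by simp) (by simp) (by simp) (by simp)
  · rintro v (rfl | ⟨i, hi, rfl⟩) w hw
    · rcases w with _ | _ | _ | k
      · simp
      · simp
      · simp only [graphF12, sup_adj, fromRel_adj, fromEdgeSet_adj, baseRelF12] at hw
        rcases hw with ⟨-, hw | hw⟩ | ⟨hw, -⟩
        · exact hw.elim
        · exact hw.elim
        · simpa using hL hw
      · by_cases hk : k.val < 8
        · rw [adj_comm, ad k hk] at hw
          exact Or.inl (Or.inr ⟨k, hw, rfl⟩)
        · have : k = 8 := by omega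
          subst this
          rcases n8 _ hw.symm with h | h | h | h <;> cases h
    · rw [ad i (by omega)] at hw
      rcases w with _ | _ | _ | k
      · simp
      · simp
      · simp only at hw
        omega
      · simp only at hw
        exact Or.inl (Or.inr ⟨k, by omega, rfl⟩)
  · rintro (hq | ⟨i, hi, hq⟩)
    · cases hq
    · cases hq
      revert hi
      decide
  · rintro (hq | ⟨i, hi, hq⟩)
    · cases hq
    · cases hq
      revert hi
      decide

/-! ### The graphs H: at least three parts, but α* ≤ 2 -/

section GraphH

variable {s : ℕ} {K : SimpleGraph (VertexH s s)}

/-- The part of `c₁` contains `a` and is confined to the triangle. The parts meeting the cliques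
therefore avoid `a`, and without `a` the vertex `b` separates the cliques. -/
lemma IsProperParts.three_parts_of_graphH (hs : 2 ≤ s)
    (hK : ∀ p q, s(p, q) ≠ s(.a, .b) → (K.Adj p q ↔ (graphH s s).Adj p q))
    {p : VertexH s s → Finset (VertexH s s)} (h : K.IsProperParts p) :
    ∃ u v w, p u ≠ p v ∧ p u ≠ p w ∧ p v ≠ p w := by
  have i0 : Fin (s - 1) := ⟨0, by omega⟩
  have nc : ∀ w, K.Adj .c₁ w → w = .a ∨ w = .c₂ := by
    intro w hw
    rw [hK _ _ (by simp), graphH, fromRel_adj] at hw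
    cases w <;> simp_all [relH]
  have nc' : ∀ w, K.Adj .c₂ w → w = .a ∨ w = .c₁ := by
    intro w hw
    rw [hK _ _ (by simp), graphH, fromRel_adj] at hw
    cases w <;> simp_all [relH]
  have nx : ∀ i w, K.Adj (.x i) w → w = .a ∨ w = .b ∨ ∃ j, w = .x j := by
    intro i w hw
    rw [hK _ _ (by simp), graphH, fromRel_adj] at hw
    cases w <;> simp_all [relH]
  have ha : p .a = p .c₁ := h.eq _ _ ((h.twoConn .c₁).mem_of_nbrs (h.mem _) fun w _ e => nc w e)
  have side : ∀ v ∈ p .c₁, v ≠ .a → v = .c₁ ∨ v = .c₂ := by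
    intro v hv hva
    refine (h.twoConn .c₁).mem_side (A := {.c₁, .c₂}) (u := .a) ?_ (h.mem _) (by simp) (by simp)
      hv hva
    rintro _ (rfl | rfl) w - e
    · rcases nc w e with rfl | rfl <;> simp
    · rcases nc' w e with rfl | rfl <;> simp
  have hx : p .c₁ ≠ p (.x i0) := fun e => by
    have := side (.x i0) (e ▸ h.mem _) (by simp)
    simp at this
  have hy : p .c₁ ≠ p (.y i0) := fun e => by
    have := side (.y i0) (e ▸ h.mem _) (by simp)
    simp at this
  refine ⟨.c₁, .x i0, .y i0, hx, hy, fun e => ?_⟩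
  have := (h.twoConn (.x i0)).mem_side (A := Set.range .x) (u := .b) (x := .x i0) (y := .y i0) ?_
    (h.mem _) ⟨i0, rfl⟩ (by simp) (e ▸ h.mem _) (by simp)
  · simp at this
  · rintro _ ⟨i, rfl⟩ w hw hiw
    rcases nx i w hiw with rfl | rfl | ⟨j, rfl⟩
    · exact absurd (ha.symm.trans (h.eq _ _ hw)) hx
    · exact Or.inr rfl
    · exact Or.inl ⟨j, rfl⟩

lemma card_le_two_of_injOn {V : Type*} {I : Finset V} (g : V → Bool)
    (hg : ∀ u ∈ I, ∀ v ∈ I, g u = g v → u = v) : I.card ≤ 2 :=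
  Finset.card_le_card_of_injOn (t := Finset.univ) g (fun _ _ => Finset.mem_coe.2 (Finset.mem_univ _))
    fun u hu v hv => hg u hu v hv

/-- An independent set of three vertices must meet both cliques and {c₁, c₂}, and then its degree
sum is at least s + s + 2 = n. In all other cases two cliques of the graph cover the set, and a
Boolean colouring tells them apart. -/
lemma card_le_two_of_graphH [DecidableRel K.Adj] [Fintype (VertexH s s)] (hs : 2 ≤ s)
    (hK : ∀ p q, s(p, q) ≠ s(.a, .b) → (K.Adj p q ↔ (graphH s s).Adj p q))
    (hn : Fintype.card (VertexH s s) = 2 * s + 2)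
    {I : Finset (VertexH s s)} (hI : K.IsLightIndepSet I) : I.card ≤ 2 := by
  obtain ⟨hind, hsum⟩ := hI
  rw [hn] at hsum
  have hno : ∀ u ∈ I, ∀ v ∈ I, s(u, v) ≠ s(.a, .b) → ¬ (graphH s s).Adj u v :=
    fun u hu v hv hne ha => hind hu hv ha.ne ((hK u v hne).2 ha)
  have deg : ∀ v : VertexH s s, ∀ t : Finset (VertexH s s),
      (∀ w ∈ t, s(v, w) ≠ s(.a, .b) ∧ (graphH s s).Adj v w) → t.card ≤ K.degree v := by
    intro v t ht
    rw [← card_neighborFinset_eq_degree]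
    refine Finset.card_le_card fun w hw => ?_
    rw [mem_neighborFinset, hK _ _ (ht w hw).1]
    exact (ht w hw).2
  have degx : ∀ i, s ≤ K.degree (.x i) := by
    intro i
    have h1 := deg (.x i) (insert .a (insert .b ((Finset.univ.erase i).image .x))) ?_
    · rw [Finset.card_insert_of_notMem (by simp), Finset.card_insert_of_notMem (by simp),
        Finset.card_image_of_injective _ (fun _ _ => VertexH.x.inj),
        Finset.card_erase_of_mem (Finset.mem_univ _), Finset.card_univ, Fintype.card_fin] at h1
      omega
    · intro w hw
      simp only [Finset.mem_insert, Finset.mem_image, Finset.mem_erase, Finset.mem_univ,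
        and_true] at hw
      rcases hw with rfl | rfl | ⟨j, hj, rfl⟩ <;> simp [graphH, relH]
      exact hj.symm
  have degy : ∀ i, s ≤ K.degree (.y i) := by
    intro i
    have h1 := deg (.y i) (insert .a (insert .b ((Finset.univ.erase i).image .y))) ?_
    · rw [Finset.card_insert_of_notMem (by simp), Finset.card_insert_of_notMem (by simp),
        Finset.card_image_of_injective _ (fun _ _ => VertexH.y.inj),
        Finset.card_erase_of_mem (Finset.mem_univ _), Finset.card_univ, Fintype.card_fin] at h1
      omega
    · intro w hw
      simp only [Finset.mem_insert, Finset.mem_image, Finset.mem_erase, Finset.mem_univ,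
        and_true] at hw
      rcases hw with rfl | rfl | ⟨j, hj, rfl⟩ <;> simp [graphH, relH]
      exact hj.symm
  have inj : ∀ g : VertexH s s → Bool,
      (∀ u ∈ I, ∀ v ∈ I, g u = g v → u ≠ v → s(u, v) ≠ s(.a, .b) ∧ (graphH s s).Adj u v) →
      I.card ≤ 2 := fun g hg => card_le_two_of_injOn g fun u hu v hv e => by
    by_contra hne
    obtain ⟨h1, h2⟩ := hg u hu v hv e hne
    exact hno u hu v hv h1 h2
  by_cases hx : ∃ i, .x i ∈ I
  · by_cases hy : ∃ i, .y i ∈ I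
    · obtain ⟨i, hi⟩ := hx
      obtain ⟨j, hj⟩ := hy
      have ha : .a ∉ I := fun h => hno _ h _ hi (by simp) (by simp [graphH, relH])
      have hb : .b ∉ I := fun h => hno _ h _ hi (by simp) (by simp [graphH, relH])
      by_cases hc : ∃ c ∈ I, c = .c₁ ∨ c = .c₂
      · obtain ⟨c, hcI, hc⟩ := hc
        have degc : 2 ≤ K.degree c := by
          rcases hc with rfl | rfl
          · refine le_trans ?_ (deg .c₁ {.a, .c₂} ?_)
            · rw [Finset.card_pair (by simp)]
            · intro w hw
              simp only [Finset.mem_insert, Finset.mem_singleton] at hw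
              rcases hw with rfl | rfl <;> simp [graphH, relH]
          · refine le_trans ?_ (deg .c₂ {.a, .c₁} ?_)
            · rw [Finset.card_pair (by simp)]
            · intro w hw
              simp only [Finset.mem_insert, Finset.mem_singleton] at hw
              rcases hw with rfl | rfl <;> simp [graphH, relH]
        have hcx : c ≠ .x i := by rcases hc with rfl | rfl <;> simp
        have hcy : c ≠ .y j := by rcases hc with rfl | rfl <;> simp
        have h1 : ∑ u ∈ {c, .x i, .y j}, K.degree u ≤ ∑ u ∈ I, K.degree u :=
          Finset.sum_le_sum_of_subset (by
            intro w hw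
            simp only [Finset.mem_insert, Finset.mem_singleton] at hw
            rcases hw with rfl | rfl | rfl <;> assumption)
        rw [Finset.sum_insert (by simp [hcx, hcy]), Finset.sum_pair (by simp)] at h1
        have := degx i
        have := degy j
        omega
      · refine inj (fun v => match v with | .x _ => true | _ => false) ?_
        push Not at hc
        intro u hu v hv huv hne
        have h1 := hc u hu
        have h2 := hc v hv
        have h3 : u ≠ .a := fun e => ha (e ▸ hu)
        have h4 : u ≠ .b := fun e => hb (e ▸ hu)
        have h5 : v ≠ .a := fun e => ha (e ▸ hv)
        have h6 : v ≠ .b := fun e => hb (e ▸ hv)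
        clear * - huv hne h1 h2 h3 h4 h5 h6
        cases u <;> cases v <;> simp_all [graphH, relH]
    -- The vertices `a` and `b` get different colours, so the possibly missing edge between them
    -- plays no role.
    · refine inj (fun v => match v with | .x _ => true | .b => true | _ => false) ?_
      push Not at hy
      intro u hu v hv huv hne
      have h1 : ∀ i, u ≠ .y i := fun i e => hy i (e ▸ hu)
      have h2 : ∀ i, v ≠ .y i := fun i e => hy i (e ▸ hv)
      clear * - huv hne h1 h2
      cases u <;> cases v <;> simp_all [graphH, relH]
  · refine inj (fun v => match v with | .y _ => true | .b => true | _ => false) ?_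
    push Not at hx
    intro u hu v hv huv hne
    have h1 : ∀ i, u ≠ .x i := fun i e => hx i (e ▸ hu)
    have h2 : ∀ i, v ≠ .x i := fun i e => hx i (e ▸ hv)
    clear * - huv hne h1 h2
    cases u <;> cases v <;> simp_all [graphH, relH]

end GraphH

/-! ### The two alternatives exclude each other -/

section Exclusion

variable {V : Type u} [Fintype V] [DecidableEq V] {G : SimpleGraph V}

lemma IsLightIndepSet.map {T : Type*} [Fintype T] [DecidableRel G.Adj] {K : SimpleGraph T}
    [DecidableRel K.Adj] (φ : G ≃g K) {I : Finset V} (hI : G.IsLightIndepSet I) :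
    K.IsLightIndepSet (I.map φ.toEquiv.toEmbedding) := by
  refine ⟨?_, ?_⟩
  · intro x hx y hy hne ha
    obtain ⟨u, hu, rfl⟩ := Finset.mem_map.1 (Finset.mem_coe.1 hx)
    obtain ⟨v, hv, rfl⟩ := Finset.mem_map.1 (Finset.mem_coe.1 hy)
    exact hI.1 hu hv (fun e => hne (e ▸ rfl)) (φ.map_adj_iff.1 ha)
  · rw [Finset.sum_map, ← Fintype.card_congr φ.toEquiv]
    refine le_trans (le_of_eq (Finset.sum_congr rfl fun v _ => ?_)) hI.2
    exact φ.degree_eq v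

lemma not_proper_of_iso_graphH [DecidableRel G.Adj] {s : ℕ} (hs : 2 ≤ s)
    (hn : 2 * s + 2 = Fintype.card V) {K : SimpleGraph (VertexH s s)}
    (hK : ∀ p q, s(p, q) ≠ s(.a, .b) → (K.Adj p q ↔ (graphH s s).Adj p q)) (φ : G ≃g K)
    {P : Finpartition (Finset.univ : Finset V)} (hP : G.IsProperPartition 2 P)
    (hc : P.parts.card ≤ G.lightIndepNum) : False := by
  classical
  have : Fintype (VertexH s s) := Fintype.ofEquiv V φ.toEquiv
  have h1 : G.lightIndepNum ≤ 2 := lightIndepNum_le fun I hI => by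
    have h2 := card_le_two_of_graphH hs hK
      ((Fintype.card_congr φ.toEquiv).symm.trans hn.symm) (hI.map φ)
    rwa [Finset.card_map] at h2
  obtain ⟨u, v, w, huv, huw, hvw⟩ := (hP.isProperParts.map φ).three_parts_of_graphH hs hK
  have h3 : ({P.part (φ.symm u), P.part (φ.symm v), P.part (φ.symm w)} : Finset (Finset V)) ⊆
      P.parts := by
    intro q hq
    simp only [Finset.mem_insert, Finset.mem_singleton] at hq
    rcases hq with rfl | rfl | rfl <;> exact P.part_mem.2 (Finset.mem_univ _)
  have h4 := Finset.card_le_card h3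
  rw [Finset.card_insert_of_notMem, Finset.card_pair] at h4
  · omega
  · exact fun e => hvw (congrArg (Finset.map φ.toEquiv.toEmbedding) e)
  · simp only [Finset.mem_insert, Finset.mem_singleton, not_or]
    exact ⟨fun e => huv (congrArg (Finset.map φ.toEquiv.toEmbedding) e),
      fun e => huw (congrArg (Finset.map φ.toEquiv.toEmbedding) e)⟩

lemma IsExceptional.false_of_isProperPartition [DecidableRel G.Adj] (h : G.IsExceptional)
    {P : Finpartition (Finset.univ : Finset V)} (hP : G.IsProperPartition 2 P)
    (hc : P.parts.card ≤ G.lightIndepNum) : False := by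
  rcases h with ⟨⟨φ⟩⟩ | ⟨⟨φ⟩⟩ | ⟨L, hL, ⟨φ⟩⟩ | ⟨L, hL, -, ⟨φ⟩⟩ | ⟨s, hs, hcard, ⟨⟨φ⟩⟩ | ⟨⟨φ⟩⟩⟩
  · have h1 := ((hP.isProperParts.map φ).twoConn 0).1
    have h2 := Finset.card_le_univ ((P.part (φ.symm 0)).map φ.toEquiv.toEmbedding)
    rw [Fintype.card_fin] at h2
    omega
  · exact not_isProperParts_graphF5 _ (hP.isProperParts.map φ)
  · exact not_isProperParts_graphF11 hL _ (hP.isProperParts.map φ)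
  · exact not_isProperParts_graphF12 hL _ (hP.isProperParts.map φ)
  · exact not_proper_of_iso_graphH hs hcard (fun _ _ _ => Iff.rfl) φ hP hc
  · exact not_proper_of_iso_graphH hs hcard graphHMinus_adj φ hP hc

end Exclusion

end SimpleGraph

theorem corollary1p11 {V : Type*} [Fintype V] [DecidableEq V] (G : SimpleGraph V)
    [DecidableRel G.Adj] (hV : 2 ≤ Fintype.card V)
    (hπ : ((Fintype.card V - G.minDegree : ℕ) : ℕ∞) ≤ G.minDegreeProduct) :
    ((∃ P : Finpartition (Finset.univ : Finset V),
        G.IsProperPartition 2 P ∧ P.parts.card ≤ G.lightIndepNum) ∨ G.IsExceptional) ∧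
    ¬ ((∃ P : Finpartition (Finset.univ : Finset V),
        G.IsProperPartition 2 P ∧ P.parts.card ≤ G.lightIndepNum) ∧ G.IsExceptional) := by
  refine ⟨?_, ?_⟩
  · exact (SimpleGraph.good_or_isExceptional _ V G rfl hV
      (SimpleGraph.productCond_of_minDegreeProduct hπ)).imp_left
      SimpleGraph.Good.exists_isProperPartition
  · rintro ⟨⟨P, hP, hc⟩, h⟩
    exact h.false_of_isProperPartition hP hc
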